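/- Let $K_0(\mathrm{Var}_{\mathbb C})$ be the Grothendieck ring of complex quasi-projective varieties (not necessarily irreducible): the abelian group generated by isomorphism classes $[X]$ modulo $[X]=[Y]+[X\setminus Y]$ for $Y\subset X$ Zariski closed, with multiplication $[X][X']=[X\times X']$. Let a $G$-variety $(X,G)$ be a complex quasi-projective variety $X$ with an action of a finite group $G$ by automorphisms, and let $K_0^{\mathrm{fGr}}(\mathrm{Var}_{\mathbb C})$ be the abelian group generated by the classes $[(X,G)]$ of $G$-varieties (for all finite groups $G$) modulo the relations: 1. $[(X,G)]=[(X',G')]$ if there are an isomorphism of varieties $\psi:X\to X'$ and a group isomorphism $\varphi:G\to G'$ with $\psi(gx)=\varphi(g)\psi(x)$; 2. $[(X,G)]=[(Y,G)]+[(X\setminus Y,G)]$ if $Y$ is a Zariski closed $G$-invariant subvariety of $X$; 3. $[(\mathrm{Ind}_G^H X,H)]=[(X,G)]$ if $G$ is a subgroup of a finite group $H$, where $\mathrm{Ind}_G^H X$ is the quotient of $H\times X$ by the right action $(h,x)*g=(hg,g^{-1}x)$ of $G$, with the $H$-action $h_0(h,x)=(h_0h,x)$; with multiplication $[(X_1,G_1)]\cdot[(X_2,G_2)]=[(X_1\times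 X_2,G_1\times G_2)]$. For a $G$-variety $(X,G)$ put $\chi_g^{(0)}(X,G)=[X/G]\in K_0(\mathrm{Var}_{\mathbb C})$ and, for $k\ge 1$, $$\chi_g^{(k)}(X,G)=\sum_{[g]\in\mathrm{Conj}\,G}\chi_g^{(k-1)}\bigl(X^{\langle g\rangle},C_G(g)\bigr),$$ where $g$ is a representative of the conjugacy class $[g]$, $X^{\langle g\rangle}$ is the fixed point set of $g$, and $C_G(g)$ is the centralizer of $g$ in $G$. Then the quotient $X/G$ is a quasi-projective variety for every $G$-variety $(X,G)$, the definition of $\chi_g^{(k)}(X,G)$ does not depend on the choice of the representatives $g$, and for every $k\ge 0$ the function $\chi_g^{(k)}$ respects the relations 1, 2 and 3, and there is a unique ring homomorphism $K_0^{\mathrm{fGr}}(\mathrm{Var}_{\mathbb C})\to K_0(\mathrm{Var}_{\mathbb C})$ sending $[(X,G)]$ to $\chi_g^{(k)}(X,G)$ for all $G$-varieties $(X,G)$. -/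

import Mathlib

open Topology Filter

noncomputable section

namespace MotivicEuler

/-- A space with functions: a topological space together with a sheaf of `ℂ`-valued functions,
which contains the constants, is closed under sums and products, and in which a function that does
not vanish at a point is invertible near that point. The sheaf is recorded by the relation
"`f` is regular in some neighbourhood of `x`"; the sections over an open set `U` are the functions
that are regular at every point of `U`. -/
structure SpaceWithFunctions : Type 1 where
  carrier : Type
  topology : TopologicalSpace carrier
  RegularAt : (carrier → ℂ) → carrier → Prop
  regularAt_congr : ∀ {f g : carrier → ℂ} {x : carrier},
    f =ᶠ[𝓝 x] g → RegularAt f x → RegularAt g x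
  eventually_regularAt : ∀ {f : carrier → ℂ} {x : carrier},
    RegularAt f x → ∀ᶠ y in 𝓝 x, RegularAt f y
  regularAt_const : ∀ (c : ℂ) (x : carrier), RegularAt (fun _ => c) x
  regularAt_add : ∀ {f g : carrier → ℂ} {x : carrier},
    RegularAt f x → RegularAt g x → RegularAt (f + g) x
  regularAt_mul : ∀ {f g : carrier → ℂ} {x : carrier},
    RegularAt f x → RegularAt g x → RegularAt (f * g) x
  eventually_ne_zero : ∀ {f : carrier → ℂ} {x : carrier},
    RegularAt f x → f x ≠ 0 → ∀ᶠ y in 𝓝 x, f y ≠ 0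
  regularAt_inv : ∀ {f : carrier → ℂ} {x : carrier},
    RegularAt f x → f x ≠ 0 → RegularAt f⁻¹ x

instance : CoeSort SpaceWithFunctions Type := ⟨SpaceWithFunctions.carrier⟩

instance (X : SpaceWithFunctions) : TopologicalSpace X := X.topology

/-- A morphism of spaces with functions: a continuous map that pulls back regular functions to
regular functions. -/
structure IsMorphism {X Y : SpaceWithFunctions} (φ : X → Y) : Prop where
  continuous : Continuous φ
  regularAt_comp : ∀ (f : Y → ℂ) (x : X), Y.RegularAt f (φ x) → X.RegularAt (f ∘ φ) x

theorem isMorphism_id (X : SpaceWithFunctions) : IsMorphism (id : X → X) :=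
  ⟨continuous_id, fun _ _ h => h⟩

theorem IsMorphism.comp {X Y Z : SpaceWithFunctions} {ψ : Y → Z} {φ : X → Y}
    (hψ : IsMorphism ψ) (hφ : IsMorphism φ) : IsMorphism (ψ ∘ φ) :=
  ⟨hψ.continuous.comp hφ.continuous,
    fun f x h => hφ.regularAt_comp (f ∘ ψ) x (hψ.regularAt_comp f (φ x) h)⟩

theorem isMorphism_const {X Y : SpaceWithFunctions} (y : Y) : IsMorphism (fun _ : X => y) :=
  ⟨continuous_const, fun f x _ => X.regularAt_const (f y) x⟩

/-- Isomorphisms of spaces with functions. -/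
structure Iso (X Y : SpaceWithFunctions) extends X ≃ Y where
  isMorphism_toFun : IsMorphism toFun
  isMorphism_invFun : IsMorphism invFun

def Iso.refl (X : SpaceWithFunctions) : Iso X X :=
  ⟨Equiv.refl X, isMorphism_id X, isMorphism_id X⟩

def Iso.symm {X Y : SpaceWithFunctions} (e : Iso X Y) : Iso Y X :=
  ⟨e.toEquiv.symm, e.isMorphism_invFun, e.isMorphism_toFun⟩

def Iso.trans {X Y Z : SpaceWithFunctions} (e : Iso X Y) (e' : Iso Y Z) : Iso X Z :=
  ⟨e.toEquiv.trans e'.toEquiv, e'.isMorphism_toFun.comp e.isMorphism_toFun,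
    e.isMorphism_invFun.comp e'.isMorphism_invFun⟩

namespace SpaceWithFunctions

/-! ### Subspaces, disjoint unions, quotients and products -/

/-- A subset with the induced structure: the subspace topology, and the functions that locally
extend to regular functions on the ambient space. -/
def sub (X : SpaceWithFunctions) (s : Set X) : SpaceWithFunctions where
  carrier := s
  topology := inferInstance
  RegularAt f y := ∃ F : X → ℂ, X.RegularAt F y ∧ ∀ᶠ z in 𝓝 y, f z = F z
  regularAt_congr := by
    rintro f g x hfg ⟨F, hF, h⟩
    exact ⟨F, hF, by filter_upwards [hfg, h] with z h1 h2 using h1.symm.trans h2⟩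
  eventually_regularAt := by
    rintro f x ⟨F, hF, h⟩
    filter_upwards [eventually_eventually_nhds.2 h,
      continuous_subtype_val.continuousAt.eventually (X.eventually_regularAt hF)] with z h1 h2
    exact ⟨F, h2, h1⟩
  regularAt_const c x := ⟨fun _ => c, X.regularAt_const c x, by simp⟩
  regularAt_add := by
    rintro f g x ⟨F, hF, h⟩ ⟨G, hG, h'⟩
    refine ⟨F + G, X.regularAt_add hF hG, ?_⟩
    filter_upwards [h, h'] with z h1 h2
    simp [h1, h2]
  regularAt_mul := by
    rintro f g x ⟨F, hF, h⟩ ⟨G, hG, h'⟩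
    refine ⟨F * G, X.regularAt_mul hF hG, ?_⟩
    filter_upwards [h, h'] with z h1 h2
    simp [h1, h2]
  eventually_ne_zero := by
    rintro f x ⟨F, hF, h⟩ hx
    rw [h.self_of_nhds] at hx
    filter_upwards [h, continuous_subtype_val.continuousAt.eventually
      (X.eventually_ne_zero hF hx)] with z h1 h2
    rwa [h1]
  regularAt_inv := by
    rintro f x ⟨F, hF, h⟩ hx
    rw [h.self_of_nhds] at hx
    refine ⟨F⁻¹, X.regularAt_inv hF hx, ?_⟩
    filter_upwards [h] with z h1
    simp [h1]

theorem isMorphism_val (X : SpaceWithFunctions) (s : Set X) :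
    IsMorphism (X := X.sub s) (Y := X) Subtype.val :=
  ⟨continuous_subtype_val, fun f _ h => ⟨f, h, Eventually.of_forall fun _ => rfl⟩⟩

theorem isMorphism_sub_iff {W X : SpaceWithFunctions} {s : Set X} {φ : W → X.sub s} :
    IsMorphism φ ↔ IsMorphism (Y := X) (fun w => (φ w).1) := by
  refine ⟨fun h => (X.isMorphism_val s).comp h, fun h => ⟨?_, ?_⟩⟩
  · exact continuous_induced_rng.2 h.continuous
  · rintro f w ⟨F, hF, hf⟩
    have hc : Continuous φ := continuous_induced_rng.2 h.continuous
    refine W.regularAt_congr ?_ (h.regularAt_comp F w hF)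
    filter_upwards [hc.continuousAt.eventually hf] with z hz
    exact hz.symm

/-- The disjoint union of copies of `X` indexed by a set `I`. -/
def copies (I : Type) (X : SpaceWithFunctions) : SpaceWithFunctions where
  carrier := Σ _ : I, X
  topology := inferInstance
  RegularAt f p := X.RegularAt (fun x => f ⟨p.1, x⟩) p.2
  regularAt_congr := by
    rintro f g ⟨i, x⟩ hfg h
    rw [EventuallyEq, Sigma.nhds_mk, eventually_map] at hfg
    exact X.regularAt_congr hfg h
  eventually_regularAt := by
    rintro f ⟨i, x⟩ h
    rw [Sigma.nhds_mk, eventually_map]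
    exact X.eventually_regularAt h
  regularAt_const c p := X.regularAt_const c p.2
  regularAt_add hf hg := X.regularAt_add hf hg
  regularAt_mul hf hg := X.regularAt_mul hf hg
  eventually_ne_zero := by
    rintro f ⟨i, x⟩ h hx
    rw [Sigma.nhds_mk, eventually_map]
    exact X.eventually_ne_zero h hx
  regularAt_inv hf hx := X.regularAt_inv hf hx

theorem isMorphism_copies_mk (I : Type) (X : SpaceWithFunctions) (i : I) :
    IsMorphism (X := X) (Y := copies I X) (fun x => ⟨i, x⟩) :=
  ⟨continuous_sigmaMk (σ := fun _ : I => X.carrier), fun _ _ h => h⟩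

theorem isMorphism_copies_iff {I : Type} {X Y : SpaceWithFunctions} {φ : copies I X → Y} :
    IsMorphism φ ↔ ∀ i, IsMorphism (X := X) (fun x => φ ⟨i, x⟩) := by
  refine ⟨fun h i => h.comp (isMorphism_copies_mk I X i), fun h => ⟨?_, ?_⟩⟩
  · exact continuous_sigma fun i => (h i).continuous
  · rintro f ⟨i, x⟩ hf
    exact (h i).regularAt_comp f x hf

/-- A map to a disjoint union whose label is locally constant and whose component is a morphism,
is a morphism. -/
theorem isMorphism_to_copies {I : Type} {W X : SpaceWithFunctions} (l : W → I) (φ : W → X)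
    (hl : ∀ w, ∀ᶠ z in 𝓝 w, l z = l w) (hφ : IsMorphism φ) :
    IsMorphism (Y := copies I X) (fun w => ⟨l w, φ w⟩) := by
  have key : ∀ w, (fun z => (⟨l z, φ z⟩ : Σ _ : I, X)) =ᶠ[𝓝 w] fun z => ⟨l w, φ z⟩ := by
    intro w
    filter_upwards [hl w] with z hz
    rw [hz]
  have hi := fun i => (isMorphism_copies_mk I X i).comp hφ
  refine ⟨continuous_iff_continuousAt.2 fun w => ?_, fun f w hf => ?_⟩
  · exact ((hi (l w)).continuous.continuousAt).congr (key w).symm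
  · refine W.regularAt_congr ?_ ((hi (l w)).regularAt_comp f w hf)
    filter_upwards [key w] with z hz
    exact congrArg f hz.symm

/-- The quotient by an equivalence relation: the quotient topology, and the functions on open
sets whose pull-back is regular. -/
def quotient (X : SpaceWithFunctions) (r : Setoid X) : SpaceWithFunctions where
  carrier := Quotient r
  topology := inferInstance
  RegularAt f q := ∀ᶠ q' in 𝓝 q, ∀ x : X, Quotient.mk r x = q' → X.RegularAt (f ∘ Quotient.mk r) x
  regularAt_congr := by
    intro f g q hfg h
    filter_upwards [h, eventually_eventually_nhds.2 hfg] with q' h1 h2 x hx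
    refine X.regularAt_congr ?_ (h1 x hx)
    subst hx
    exact (continuous_quotient_mk'.continuousAt (x := x)).eventually h2
  eventually_regularAt h := eventually_eventually_nhds.2 h
  regularAt_const c q := Eventually.of_forall fun _ x _ => X.regularAt_const c x
  regularAt_add hf hg := by
    filter_upwards [hf, hg] with q' h1 h2 x hx using X.regularAt_add (h1 x hx) (h2 x hx)
  regularAt_mul hf hg := by
    filter_upwards [hf, hg] with q' h1 h2 x hx using X.regularAt_mul (h1 x hx) (h2 x hx)
  eventually_ne_zero := by
    intro f q hf hq
    obtain ⟨U, hU, hUo, hqU⟩ := eventually_nhds_iff.1 hf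
    refine eventually_nhds_iff.2 ⟨{p | p ∈ U ∧ f p ≠ 0}, fun p hp => hp.2, ?_, hqU, hq⟩
    refine isOpen_coinduced.2 (isOpen_iff_mem_nhds.2 fun x hx => ?_)
    have h1 : ∀ᶠ y in 𝓝 x, Quotient.mk r y ∈ U :=
      (continuous_quotient_mk'.continuousAt (x := x)).eventually (hUo.mem_nhds hx.1)
    filter_upwards [h1, X.eventually_ne_zero (hU _ hx.1 x rfl) hx.2] with y h2 h3
    exact ⟨h2, h3⟩
  regularAt_inv := by
    intro f q hf hq
    have hne : ∀ᶠ p in 𝓝 q, f p ≠ 0 := by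
      obtain ⟨U, hU, hUo, hqU⟩ := eventually_nhds_iff.1 hf
      refine eventually_nhds_iff.2 ⟨{p | p ∈ U ∧ f p ≠ 0}, fun p hp => hp.2, ?_, hqU, hq⟩
      refine isOpen_coinduced.2 (isOpen_iff_mem_nhds.2 fun x hx => ?_)
      have h1 : ∀ᶠ y in 𝓝 x, Quotient.mk r y ∈ U :=
        (continuous_quotient_mk'.continuousAt (x := x)).eventually (hUo.mem_nhds hx.1)
      filter_upwards [h1, X.eventually_ne_zero (hU _ hx.1 x rfl) hx.2] with y h2 h3
      exact ⟨h2, h3⟩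
    filter_upwards [hf, hne] with p h1 h2 x hx
    exact X.regularAt_inv (h1 x hx) (by simpa [hx] using h2)

theorem isMorphism_quotient_mk (X : SpaceWithFunctions) (r : Setoid X) :
    IsMorphism (X := X) (Y := X.quotient r) (Quotient.mk r) :=
  ⟨continuous_quotient_mk', fun _ x h => h.self_of_nhds x rfl⟩

theorem isMorphism_quotient_iff {X Y : SpaceWithFunctions} {r : Setoid X}
    {φ : X.quotient r → Y} :
    IsMorphism φ ↔ IsMorphism (X := X) (fun x => φ (Quotient.mk r x)) := by
  refine ⟨fun h => h.comp (isMorphism_quotient_mk X r), fun h => ?_⟩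
  have hc : Continuous φ := continuous_coinduced_dom.2 h.continuous
  refine ⟨hc, fun f q hf => ?_⟩
  filter_upwards [hc.continuousAt.eventually (Y.eventually_regularAt hf)] with q' h1 x hx
  subst hx
  exact h.regularAt_comp f x h1

section Prod

variable (X Y : SpaceWithFunctions)

/-- The functions on `X × Y` of the form `∑ aᵢ(x) bᵢ(y)` with `aᵢ` regular at `x₀` and `bᵢ` regular
at `y₀`: the algebra generated by the pull-backs of such `a` and `b`. -/
def tensorFunctions (p : X × Y) : Subalgebra ℂ (X × Y → ℂ) :=
  Algebra.adjoin ℂ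
    ({h | ∃ a : X → ℂ, X.RegularAt a p.1 ∧ h = a ∘ Prod.fst} ∪
      {h | ∃ b : Y → ℂ, Y.RegularAt b p.2 ∧ h = b ∘ Prod.snd})

variable {X Y}

theorem fst_mem_tensorFunctions {p : X × Y} {a : X → ℂ} (ha : X.RegularAt a p.1) :
    a ∘ Prod.fst ∈ tensorFunctions X Y p :=
  Algebra.subset_adjoin (Or.inl ⟨a, ha, rfl⟩)

theorem snd_mem_tensorFunctions {p : X × Y} {b : Y → ℂ} (hb : Y.RegularAt b p.2) :
    b ∘ Prod.snd ∈ tensorFunctions X Y p :=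
  Algebra.subset_adjoin (Or.inr ⟨b, hb, rfl⟩)

theorem exists_mem_tensorFunctions {p : X × Y} {h : X × Y → ℂ} (hh : h ∈ tensorFunctions X Y p) :
    ∃ U : Set X, ∃ V : Set Y, IsOpen U ∧ IsOpen V ∧ p.1 ∈ U ∧ p.2 ∈ V ∧
      ∀ q : X × Y, q.1 ∈ U → q.2 ∈ V → h ∈ tensorFunctions X Y q := by
  induction hh using Algebra.adjoin_induction with
  | mem h hh =>
    rcases hh with ⟨a, ha, rfl⟩ | ⟨b, hb, rfl⟩
    · obtain ⟨U, hU, hUo, hp⟩ := eventually_nhds_iff.1 (X.eventually_regularAt ha)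
      exact ⟨U, Set.univ, hUo, isOpen_univ, hp, trivial,
        fun q hq _ => fst_mem_tensorFunctions (hU _ hq)⟩
    · obtain ⟨V, hV, hVo, hp⟩ := eventually_nhds_iff.1 (Y.eventually_regularAt hb)
      exact ⟨Set.univ, V, isOpen_univ, hVo, trivial, hp,
        fun q _ hq => snd_mem_tensorFunctions (hV _ hq)⟩
  | algebraMap c =>
    exact ⟨Set.univ, Set.univ, isOpen_univ, isOpen_univ, trivial, trivial,
      fun q _ _ => Subalgebra.algebraMap_mem _ c⟩
  | add f g _ _ hf hg =>
    obtain ⟨U, V, hU, hV, hpU, hpV, h⟩ := hf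
    obtain ⟨U', V', hU', hV', hpU', hpV', h'⟩ := hg
    exact ⟨U ∩ U', V ∩ V', hU.inter hU', hV.inter hV', ⟨hpU, hpU'⟩, ⟨hpV, hpV'⟩,
      fun q h1 h2 => add_mem (h q h1.1 h2.1) (h' q h1.2 h2.2)⟩
  | mul f g _ _ hf hg =>
    obtain ⟨U, V, hU, hV, hpU, hpV, h⟩ := hf
    obtain ⟨U', V', hU', hV', hpU', hpV', h'⟩ := hg
    exact ⟨U ∩ U', V ∩ V', hU.inter hU', hV.inter hV', ⟨hpU, hpU'⟩, ⟨hpV, hpV'⟩,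
      fun q h1 h2 => mul_mem (h q h1.1 h2.1) (h' q h1.2 h2.2)⟩

/-- The Zariski topology of the product (finer than the product topology): the sets
`{(x, y) | x ∈ U, y ∈ V, h (x, y) ≠ 0}` with `U`, `V` open and `h = ∑ aᵢ bᵢ`, `aᵢ` regular on `U`,
`bᵢ` regular on `V`, form a basis. -/
@[reducible] def prodTopology (X Y : SpaceWithFunctions) : TopologicalSpace (X × Y) where
  IsOpen W := ∀ p ∈ W, ∃ U : Set X, ∃ V : Set Y, ∃ h ∈ tensorFunctions X Y p,
    IsOpen U ∧ IsOpen V ∧ p.1 ∈ U ∧ p.2 ∈ V ∧ h p ≠ 0 ∧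
      ∀ q : X × Y, q.1 ∈ U → q.2 ∈ V → h q ≠ 0 → q ∈ W
  isOpen_univ := fun p _ => ⟨Set.univ, Set.univ, 1, one_mem _, isOpen_univ, isOpen_univ,
    trivial, trivial, one_ne_zero, fun _ _ _ _ => trivial⟩
  isOpen_inter := by
    intro W W' hW hW' p hp
    obtain ⟨U, V, h, hh, hU, hV, hpU, hpV, hp0, H⟩ := hW p hp.1
    obtain ⟨U', V', h', hh', hU', hV', hpU', hpV', hp0', H'⟩ := hW' p hp.2
    refine ⟨U ∩ U', V ∩ V', h * h', mul_mem hh hh', hU.inter hU', hV.inter hV', ⟨hpU, hpU'⟩,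
      ⟨hpV, hpV'⟩, mul_ne_zero hp0 hp0', fun q h1 h2 h3 => ?_⟩
    exact ⟨H q h1.1 h2.1 (left_ne_zero_of_mul h3), H' q h1.2 h2.2 (right_ne_zero_of_mul h3)⟩
  isOpen_sUnion := by
    intro S hS p ⟨W, hW, hp⟩
    obtain ⟨U, V, h, hh, hU, hV, hpU, hpV, hp0, H⟩ := hS W hW p hp
    exact ⟨U, V, h, hh, hU, hV, hpU, hpV, hp0, fun q h1 h2 h3 => ⟨W, hW, H q h1 h2 h3⟩⟩

theorem eventually_prod {p : X × Y} {P : X × Y → Prop} {U : Set X} {V : Set Y}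
    {h : X × Y → ℂ} (hh : h ∈ tensorFunctions X Y p) (hU : IsOpen U) (hV : IsOpen V)
    (hpU : p.1 ∈ U) (hpV : p.2 ∈ V) (hp : h p ≠ 0)
    (H : ∀ q : X × Y, q.1 ∈ U → q.2 ∈ V → h q ≠ 0 → P q) :
    ∀ᶠ q in @nhds _ (prodTopology X Y) p, P q := by
  obtain ⟨U', V', hU', hV', hpU', hpV', H'⟩ := exists_mem_tensorFunctions hh
  refine (@eventually_nhds_iff _ (prodTopology X Y) _ _).2
    ⟨{q | q.1 ∈ U ∩ U' ∧ q.2 ∈ V ∩ V' ∧ h q ≠ 0}, fun q hq => H q hq.1.1 hq.2.1.1 hq.2.2, ?_,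
      ⟨hpU, hpU'⟩, ⟨hpV, hpV'⟩, hp⟩
  exact fun q hq => ⟨U ∩ U', V ∩ V', h, H' q hq.1.2 hq.2.1.2, hU.inter hU', hV.inter hV', hq.1,
    hq.2.1, hq.2.2, fun q' h1 h2 h3 => ⟨h1, h2, h3⟩⟩

theorem eventually_prod_ne_zero {p : X × Y} {h : X × Y → ℂ} (hh : h ∈ tensorFunctions X Y p)
    (hp : h p ≠ 0) : ∀ᶠ q in @nhds _ (prodTopology X Y) p, h q ≠ 0 :=
  eventually_prod hh isOpen_univ isOpen_univ trivial trivial hp fun _ _ _ h => h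

theorem eventually_mem_tensorFunctions {p : X × Y} {h : X × Y → ℂ}
    (hh : h ∈ tensorFunctions X Y p) :
    ∀ᶠ q in @nhds _ (prodTopology X Y) p, h ∈ tensorFunctions X Y q := by
  obtain ⟨U, V, hU, hV, hpU, hpV, H⟩ := exists_mem_tensorFunctions hh
  exact eventually_prod (one_mem _) hU hV hpU hpV one_ne_zero fun q h1 h2 _ => H q h1 h2

/-- The product of two spaces with functions. A function is regular at `p` if near `p` it is a
fraction of functions of the form `∑ aᵢ(x) bᵢ(y)`. -/
def prod (X Y : SpaceWithFunctions) : SpaceWithFunctions where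
  carrier := X × Y
  topology := prodTopology X Y
  RegularAt f p := ∃ h₁ ∈ tensorFunctions X Y p, ∃ h₂ ∈ tensorFunctions X Y p, h₂ p ≠ 0 ∧
    ∀ᶠ q in @nhds _ (prodTopology X Y) p, f q = h₁ q / h₂ q
  regularAt_congr := by
    rintro f g p hfg ⟨h₁, m₁, h₂, m₂, hp, h⟩
    refine ⟨h₁, m₁, h₂, m₂, hp, ?_⟩
    filter_upwards [hfg, h] with q e1 e2 using e1.symm.trans e2
  eventually_regularAt := by
    rintro f p ⟨h₁, m₁, h₂, m₂, hp, h⟩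
    filter_upwards [eventually_mem_tensorFunctions m₁, eventually_mem_tensorFunctions m₂,
      eventually_prod_ne_zero m₂ hp, (@eventually_eventually_nhds _ (prodTopology X Y) _ _).2 h]
      with q e1 e2 e3 e4
    exact ⟨h₁, e1, h₂, e2, e3, e4⟩
  regularAt_const c p := ⟨fun _ => c, Subalgebra.algebraMap_mem _ c, 1, one_mem _, one_ne_zero,
    Eventually.of_forall fun _ => by simp⟩
  regularAt_add := by
    rintro f g p ⟨h₁, m₁, h₂, m₂, hp, h⟩ ⟨h₁', m₁', h₂', m₂', hp', h'⟩
    refine ⟨h₁ * h₂' + h₂ * h₁', add_mem (mul_mem m₁ m₂') (mul_mem m₂ m₁'), h₂ * h₂',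
      mul_mem m₂ m₂', mul_ne_zero hp hp', ?_⟩
    filter_upwards [h, h', eventually_prod_ne_zero m₂ hp, eventually_prod_ne_zero m₂' hp']
      with q e1 e2 e3 e4
    simp [e1, e2, div_add_div _ _ e3 e4]
  regularAt_mul := by
    rintro f g p ⟨h₁, m₁, h₂, m₂, hp, h⟩ ⟨h₁', m₁', h₂', m₂', hp', h'⟩
    refine ⟨h₁ * h₁', mul_mem m₁ m₁', h₂ * h₂', mul_mem m₂ m₂', mul_ne_zero hp hp', ?_⟩
    filter_upwards [h, h'] with q e1 e2
    simp [e1, e2, div_mul_div_comm]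
  eventually_ne_zero := by
    rintro f p ⟨h₁, m₁, h₂, m₂, hp, h⟩ hf
    have h1 : h₁ p ≠ 0 := by
      intro h0
      exact hf (by rw [(@Eventually.self_of_nhds _ (prodTopology X Y) _ _ h), h0, zero_div])
    filter_upwards [h, eventually_prod_ne_zero m₁ h1, eventually_prod_ne_zero m₂ hp]
      with q e1 e2 e3
    rw [e1]
    exact div_ne_zero e2 e3
  regularAt_inv := by
    rintro f p ⟨h₁, m₁, h₂, m₂, hp, h⟩ hf
    have h1 : h₁ p ≠ 0 := by
      intro h0
      exact hf (by rw [(@Eventually.self_of_nhds _ (prodTopology X Y) _ _ h), h0, zero_div])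
    refine ⟨h₂, m₂, h₁, m₁, h1, ?_⟩
    filter_upwards [h] with q e1
    simp [e1]

theorem isMorphism_fst (X Y : SpaceWithFunctions) :
    IsMorphism (X := X.prod Y) (Y := X) Prod.fst := by
  refine ⟨continuous_iff_continuousAt.2 fun p s hs => ?_, fun f p hf => ?_⟩
  · obtain ⟨U, hUs, hU, hpU⟩ := mem_nhds_iff.1 hs
    exact eventually_prod (one_mem _) hU isOpen_univ hpU trivial one_ne_zero
      fun q hq _ _ => hUs hq
  · exact ⟨f ∘ Prod.fst, fst_mem_tensorFunctions hf, 1, one_mem _, one_ne_zero,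
      Eventually.of_forall fun _ => (div_one _).symm⟩

theorem isMorphism_snd (X Y : SpaceWithFunctions) :
    IsMorphism (X := X.prod Y) (Y := Y) Prod.snd := by
  refine ⟨continuous_iff_continuousAt.2 fun p s hs => ?_, fun f p hf => ?_⟩
  · obtain ⟨U, hUs, hU, hpU⟩ := mem_nhds_iff.1 hs
    exact eventually_prod (one_mem _) isOpen_univ hU trivial hpU one_ne_zero
      fun q _ hq _ => hUs hq
  · exact ⟨f ∘ Prod.snd, snd_mem_tensorFunctions hf, 1, one_mem _, one_ne_zero,
      Eventually.of_forall fun _ => (div_one _).symm⟩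

theorem regularAt_div (X : SpaceWithFunctions) {f g : X → ℂ} {x : X} (hf : X.RegularAt f x)
    (hg : X.RegularAt g x) (h0 : g x ≠ 0) : X.RegularAt (fun y => f y / g y) x := by
  simpa [div_eq_mul_inv] using! X.regularAt_mul hf (X.regularAt_inv hg h0)

theorem regularAt_tensor_comp {W X Y : SpaceWithFunctions} {φ : W → X} {ψ : W → Y}
    (hφ : IsMorphism φ) (hψ : IsMorphism ψ) {w : W} {h : X × Y → ℂ}
    (hh : h ∈ tensorFunctions X Y (φ w, ψ w)) : W.RegularAt (fun z => h (φ z, ψ z)) w := by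
  induction hh using Algebra.adjoin_induction with
  | mem h hh =>
    rcases hh with ⟨a, ha, rfl⟩ | ⟨b, hb, rfl⟩
    · exact hφ.regularAt_comp a w ha
    · exact hψ.regularAt_comp b w hb
  | algebraMap c => exact W.regularAt_const c w
  | add f g _ _ hf hg => exact W.regularAt_add hf hg
  | mul f g _ _ hf hg => exact W.regularAt_mul hf hg

/-- The universal property of the product. -/
theorem isMorphism_prodMk {W X Y : SpaceWithFunctions} {φ : W → X} {ψ : W → Y}
    (hφ : IsMorphism φ) (hψ : IsMorphism ψ) :
    IsMorphism (Y := X.prod Y) (fun w => (φ w, ψ w)) := by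
  have hc : Continuous (Y := X.prod Y) (fun w => ((φ w, ψ w) : X × Y)) := by
    refine continuous_iff_continuousAt.2 fun w s hs => ?_
    obtain ⟨O, hOs, hO, hwO⟩ := mem_nhds_iff.1 hs
    obtain ⟨U, V, h, hh, hU, hV, hpU, hpV, hp0, H⟩ := hO _ hwO
    refine Filter.mem_map.2 ?_
    filter_upwards [hφ.continuous.continuousAt.eventually (hU.mem_nhds hpU),
      hψ.continuous.continuousAt.eventually (hV.mem_nhds hpV),
      W.eventually_ne_zero (regularAt_tensor_comp hφ hψ hh) hp0] with z h1 h2 h3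
    exact hOs (H _ h1 h2 h3)
  refine ⟨hc, ?_⟩
  rintro f w ⟨h₁, m₁, h₂, m₂, hp, h⟩
  refine W.regularAt_congr ?_ (W.regularAt_div (regularAt_tensor_comp hφ hψ m₁)
    (regularAt_tensor_comp hφ hψ m₂) hp)
  filter_upwards [hc.continuousAt.eventually h] with z hz using hz.symm

theorem isMorphism_prodMap {X Y X' Y' : SpaceWithFunctions} {φ : X → X'} {ψ : Y → Y'}
    (hφ : IsMorphism φ) (hψ : IsMorphism ψ) :
    IsMorphism (X := X.prod Y) (Y := X'.prod Y') (fun p => (φ p.1, ψ p.2)) :=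
  isMorphism_prodMk (W := X.prod Y) (hφ.comp (isMorphism_fst X Y))
    (hψ.comp (isMorphism_snd X Y))

end Prod

end SpaceWithFunctions

/-! ### Projective space and quasi-projective varieties -/

theorem eval_smul_of_isHomogeneous {ι : Type} {p : MvPolynomial ι ℂ} {d : ℕ}
    (hp : p.IsHomogeneous d) (c : ℂ) (v : ι → ℂ) :
    MvPolynomial.eval (c • v) p = c ^ d * MvPolynomial.eval v p := by
  rw [MvPolynomial.eval_eq, MvPolynomial.eval_eq, Finset.mul_sum]
  refine Finset.sum_congr rfl fun m hm => ?_
  rw [hp.degree_eq_sum_deg_support hm]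
  simp only [Pi.smul_apply, smul_eq_mul, mul_pow, Finset.prod_mul_distrib, Finset.prod_pow_eq_pow_sum]
  ring

theorem eval_div_of_isHomogeneous {ι : Type} {p q : MvPolynomial ι ℂ} {d : ℕ}
    (hp : p.IsHomogeneous d) (hq : q.IsHomogeneous d) {c : ℂ} (hc : c ≠ 0) (v : ι → ℂ) :
    MvPolynomial.eval (c • v) p / MvPolynomial.eval (c • v) q =
      MvPolynomial.eval v p / MvPolynomial.eval v q := by
  rw [eval_smul_of_isHomogeneous hp, eval_smul_of_isHomogeneous hq]
  exact mul_div_mul_left _ _ (pow_ne_zero _ hc)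

theorem exists_rep_mk {V : Type} [AddCommGroup V] [Module ℂ V] (v : V) (hv : v ≠ 0) :
    ∃ c : ℂ, c ≠ 0 ∧ (Projectivization.mk ℂ v hv).rep = c • v := by
  obtain ⟨a, ha⟩ := Projectivization.exists_smul_eq_mk_rep ℂ v hv
  exact ⟨a, a.ne_zero, ha.symm⟩

/-- The Zariski topology on projective space: the sets `{p ≠ 0}`, for homogeneous polynomials `p`,
form a basis of open sets. -/
@[reducible] def zariskiTopology (ι : Type) : TopologicalSpace (Projectivization ℂ (ι → ℂ)) :=
  TopologicalSpace.generateFrom {U | ∃ (d : ℕ) (p : MvPolynomial ι ℂ), p.IsHomogeneous d ∧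
    U = {x | MvPolynomial.eval x.rep p ≠ 0}}

theorem eventually_eval_ne_zero {ι : Type} {p : MvPolynomial ι ℂ} {d : ℕ} (hp : p.IsHomogeneous d)
    {x : Projectivization ℂ (ι → ℂ)} (hx : MvPolynomial.eval x.rep p ≠ 0) :
    ∀ᶠ y in @nhds _ (zariskiTopology ι) x, MvPolynomial.eval y.rep p ≠ 0 :=
  letI := zariskiTopology ι
  (TopologicalSpace.isOpen_generateFrom_of_mem ⟨d, p, hp, rfl⟩ :
    IsOpen {y : Projectivization ℂ (ι → ℂ) | MvPolynomial.eval y.rep p ≠ 0}).mem_nhds hx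

/-- Projective space `ℙ(ℂ^ι)` as a space with functions: a function is regular at `x` if near `x`
it is a quotient `p / q` of homogeneous polynomials of the same degree, with `q(x) ≠ 0`. (The value
of `p / q` at a point does not depend on the representative of the point.) -/
def projectiveSpace (ι : Type) : SpaceWithFunctions where
  carrier := Projectivization ℂ (ι → ℂ)
  topology := zariskiTopology ι
  RegularAt f x := ∃ (d : ℕ) (p q : MvPolynomial ι ℂ), p.IsHomogeneous d ∧ q.IsHomogeneous d ∧
    MvPolynomial.eval x.rep q ≠ 0 ∧ ∀ᶠ y in @nhds _ (zariskiTopology ι) x,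
      f y = MvPolynomial.eval y.rep p / MvPolynomial.eval y.rep q
  regularAt_congr := by
    rintro f g x hfg ⟨d, p, q, hp, hq, hx, h⟩
    refine ⟨d, p, q, hp, hq, hx, ?_⟩
    filter_upwards [hfg, h] with y e1 e2 using e1.symm.trans e2
  eventually_regularAt := by
    rintro f x ⟨d, p, q, hp, hq, hx, h⟩
    filter_upwards [eventually_eval_ne_zero hq hx,
      (@eventually_eventually_nhds _ (zariskiTopology ι) _ _).2 h] with y e1 e2
    exact ⟨d, p, q, hp, hq, e1, e2⟩
  regularAt_const c x := ⟨0, MvPolynomial.C c, 1, MvPolynomial.isHomogeneous_C _ c,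
    MvPolynomial.isHomogeneous_one _ _, by simp, Eventually.of_forall fun _ => by simp⟩
  regularAt_add := by
    rintro f g x ⟨d, p, q, hp, hq, hx, h⟩ ⟨d', p', q', hp', hq', hx', h'⟩
    refine ⟨d + d', p * q' + q * p', q * q', (hp.mul hq').add (hq.mul hp'), hq.mul hq', ?_, ?_⟩
    · simpa using ⟨hx, hx'⟩
    · filter_upwards [h, h', eventually_eval_ne_zero hq hx, eventually_eval_ne_zero hq' hx']
        with y e1 e2 e3 e4
      simp [e1, e2, div_add_div _ _ e3 e4]
  regularAt_mul := by
    rintro f g x ⟨d, p, q, hp, hq, hx, h⟩ ⟨d', p', q', hp', hq', hx', h'⟩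
    refine ⟨d + d', p * p', q * q', hp.mul hp', hq.mul hq', ?_, ?_⟩
    · simpa using ⟨hx, hx'⟩
    · filter_upwards [h, h'] with y e1 e2
      simp [e1, e2, div_mul_div_comm]
  eventually_ne_zero := by
    rintro f x ⟨d, p, q, hp, hq, hx, h⟩ hf
    have h1 : MvPolynomial.eval x.rep p ≠ 0 := by
      intro h0
      exact hf (by rw [(@Eventually.self_of_nhds _ (zariskiTopology ι) _ _ h), h0, zero_div])
    filter_upwards [h, eventually_eval_ne_zero hp h1, eventually_eval_ne_zero hq hx]
      with y e1 e2 e3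
    rw [e1]
    exact div_ne_zero e2 e3
  regularAt_inv := by
    rintro f x ⟨d, p, q, hp, hq, hx, h⟩ hf
    have h1 : MvPolynomial.eval x.rep p ≠ 0 := by
      intro h0
      exact hf (by rw [(@Eventually.self_of_nhds _ (zariskiTopology ι) _ _ h), h0, zero_div])
    refine ⟨d, q, p, hq, hp, h1, ?_⟩
    filter_upwards [h] with y e1
    simp [e1]

/-- An isomorphism onto a locally closed subset with its induced structure. -/
structure IsImmersion {X Y : SpaceWithFunctions} (e : X → Y) : Prop where
  isEmbedding : IsEmbedding e
  isLocallyClosed_range : IsLocallyClosed (Set.range e)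
  regularAt_iff : ∀ (f : X → ℂ) (x : X), X.RegularAt f x ↔
    ∃ F : Y → ℂ, Y.RegularAt F (e x) ∧ ∀ᶠ z in 𝓝 x, f z = F (e z)

/-- A space with functions is a quasi-projective variety if it is isomorphic to a locally closed
subset of a projective space. -/
def SpaceWithFunctions.IsQuasiProjective (X : SpaceWithFunctions) : Prop :=
  ∃ (ι : Type) (_ : Fintype ι) (e : X → projectiveSpace ι), IsImmersion e

theorem IsImmersion.isMorphism {X Y : SpaceWithFunctions} {e : X → Y} (he : IsImmersion e) :
    IsMorphism e :=
  ⟨he.isEmbedding.continuous, fun F x hF =>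
    (he.regularAt_iff _ x).2 ⟨F, hF, Eventually.of_forall fun _ => rfl⟩⟩

theorem IsImmersion.comp {X Y Z : SpaceWithFunctions} {e' : Y → Z} {e : X → Y}
    (he' : IsImmersion e') (he : IsImmersion e) : IsImmersion (e' ∘ e) := by
  refine ⟨he'.isEmbedding.comp he.isEmbedding, ?_, fun f x => ⟨fun hf => ?_, ?_⟩⟩
  · rw [Set.range_comp]
    exact he.isLocallyClosed_range.image he'.isEmbedding.isInducing he'.isLocallyClosed_range
  · obtain ⟨F, hF, h⟩ := (he.regularAt_iff f x).1 hf
    obtain ⟨F', hF', h'⟩ := (he'.regularAt_iff F (e x)).1 hF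
    refine ⟨F', hF', ?_⟩
    filter_upwards [h, he.isEmbedding.continuous.continuousAt.eventually h'] with z e1 e2
    exact e1.trans e2
  · rintro ⟨F, hF, h⟩
    exact X.regularAt_congr (h.mono fun z hz => hz.symm)
      ((he'.isMorphism.comp he.isMorphism).regularAt_comp F x hF)

theorem isImmersion_val (X : SpaceWithFunctions) {s : Set X} (hs : IsLocallyClosed s) :
    IsImmersion (X := X.sub s) (Y := X) Subtype.val :=
  ⟨.subtypeVal, by
    have h : Set.range (Subtype.val : s → X) = s := Subtype.range_coe
    exact h.symm ▸ hs, fun _ _ => Iff.rfl⟩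

theorem Iso.isImmersion {X Y : SpaceWithFunctions} (e : Iso X Y) :
    IsImmersion (X := X) (Y := Y) e.toFun := by
  have h : Function.LeftInverse e.invFun e.toFun := e.left_inv
  refine ⟨.of_leftInverse h e.isMorphism_invFun.continuous e.isMorphism_toFun.continuous, ?_,
    fun f x => ⟨fun hf => ⟨f ∘ e.invFun, ?_, Eventually.of_forall fun z => ?_⟩, ?_⟩⟩
  · have h2 : Set.range e.toFun = Set.univ := e.toEquiv.range_eq_univ
    rw [h2]
    exact isOpen_univ.isLocallyClosed
  · refine e.isMorphism_invFun.regularAt_comp f _ ?_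
    rwa [h x]
  · exact congrArg f (h z).symm
  · rintro ⟨F, hF, hz⟩
    exact X.regularAt_congr (hz.mono fun z hz => hz.symm)
      (e.isMorphism_toFun.regularAt_comp F x hF)

namespace SpaceWithFunctions

theorem IsQuasiProjective.of_isImmersion {X Y : SpaceWithFunctions} (hY : Y.IsQuasiProjective)
    {e : X → Y} (he : IsImmersion e) : X.IsQuasiProjective := by
  obtain ⟨ι, hι, e', he'⟩ := hY
  exact ⟨ι, hι, _, he'.comp he⟩

theorem IsQuasiProjective.sub {X : SpaceWithFunctions} (hX : X.IsQuasiProjective) {s : Set X}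
    (hs : IsLocallyClosed s) : (X.sub s).IsQuasiProjective :=
  hX.of_isImmersion (isImmersion_val X hs)

/-- A way to recognize immersions of products. -/
theorem isImmersion_of_prod {X Y Z : SpaceWithFunctions} {m : X.prod Y → Z} (hm : IsMorphism m)
    (hinj : Function.Injective m) (hr : IsLocallyClosed (Set.range m))
    (h₁ : ∀ p : X.prod Y, Tendsto Prod.fst (comap m (𝓝 (m p))) (𝓝 p.1))
    (h₂ : ∀ p : X.prod Y, Tendsto Prod.snd (comap m (𝓝 (m p))) (𝓝 p.2))
    (hf₁ : ∀ (p : X.prod Y) (a : X → ℂ), X.RegularAt a p.1 →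
      ∃ F, Z.RegularAt F (m p) ∧ ∀ᶠ q in comap m (𝓝 (m p)), a q.1 = F (m q))
    (hf₂ : ∀ (p : X.prod Y) (b : Y → ℂ), Y.RegularAt b p.2 →
      ∃ F, Z.RegularAt F (m p) ∧ ∀ᶠ q in comap m (𝓝 (m p)), b q.2 = F (m q)) :
    IsImmersion m := by
  have key : ∀ (p : X.prod Y) (h : X × Y → ℂ), h ∈ tensorFunctions X Y p →
      ∃ F, Z.RegularAt F (m p) ∧ ∀ᶠ q in comap m (𝓝 (m p)), h q = F (m q) := by
    intro p h hh
    induction hh using Algebra.adjoin_induction with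
    | mem h hh =>
      rcases hh with ⟨a, ha, rfl⟩ | ⟨b, hb, rfl⟩
      · exact hf₁ p a ha
      · exact hf₂ p b hb
    | algebraMap c => exact ⟨fun _ => c, Z.regularAt_const c _, Eventually.of_forall fun _ => rfl⟩
    | add f g _ _ hf hg =>
      obtain ⟨F, hF, h⟩ := hf
      obtain ⟨G, hG, h'⟩ := hg
      refine ⟨F + G, Z.regularAt_add hF hG, ?_⟩
      filter_upwards [h, h'] with q e1 e2
      simp [e1, e2]
    | mul f g _ _ hf hg =>
      obtain ⟨F, hF, h⟩ := hf
      obtain ⟨G, hG, h'⟩ := hg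
      refine ⟨F * G, Z.regularAt_mul hF hG, ?_⟩
      filter_upwards [h, h'] with q e1 e2
      simp [e1, e2]
  have hself : ∀ {p : X.prod Y} {P : X.prod Y → Prop}, (∀ᶠ q in comap m (𝓝 (m p)), P q) → P p := by
    intro p P hP
    obtain ⟨V, hV, hVP⟩ := mem_comap.1 hP
    exact hVP (show m p ∈ V from mem_of_mem_nhds hV)
  have hle : ∀ p : X.prod Y, 𝓝 p ≤ comap m (𝓝 (m p)) := fun p =>
    tendsto_iff_comap.1 hm.continuous.continuousAt
  have hne : ∀ (p : X.prod Y) (h : X × Y → ℂ), h ∈ tensorFunctions X Y p → h p ≠ 0 →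
      ∀ᶠ q in comap m (𝓝 (m p)), h q ≠ 0 := by
    intro p h hh hp
    obtain ⟨F, hF, hFh⟩ := key p h hh
    rw [hself hFh] at hp
    filter_upwards [hFh, tendsto_comap.eventually (Z.eventually_ne_zero hF hp)] with q e1 e2
    rwa [e1]
  have hind : IsInducing m := by
    refine isInducing_iff_nhds.2 fun p => le_antisymm (hle p) fun s hs => ?_
    obtain ⟨O, hOs, hO, hpO⟩ := mem_nhds_iff.1 hs
    obtain ⟨U, V, h, hh, hU, hV, hpU, hpV, hp0, H⟩ := hO p hpO
    filter_upwards [(h₁ p).eventually (hU.mem_nhds hpU), (h₂ p).eventually (hV.mem_nhds hpV),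
      hne p h hh hp0] with q e1 e2 e3
    exact hOs (H q e1 e2 e3)
  refine ⟨⟨hind, hinj⟩, hr, fun f p => ⟨?_, ?_⟩⟩
  · rintro ⟨a, ha, b, hb, hp, h⟩
    obtain ⟨A, hA, hAa⟩ := key p a ha
    obtain ⟨B, hB, hBb⟩ := key p b hb
    have hBp : B (m p) ≠ 0 := by rwa [← hself hBb]
    refine ⟨_, Z.regularAt_div hA hB hBp, ?_⟩
    filter_upwards [h, hle p hAa, hle p hBb] with q e1 e2 e3
    rw [e1, e2, e3]
  · rintro ⟨F, hF, hz⟩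
    exact (X.prod Y).regularAt_congr (hz.mono fun z hz => hz.symm) (hm.regularAt_comp F p hF)

theorem isImmersion_prodMap {X Y X' Y' : SpaceWithFunctions} {φ : X → X'} {ψ : Y → Y'}
    (hφ : IsImmersion φ) (hψ : IsImmersion ψ) :
    IsImmersion (X := X.prod Y) (Y := X'.prod Y') (fun p => (φ p.1, ψ p.2)) := by
  have hm := isMorphism_prodMap hφ.isMorphism hψ.isMorphism
  set m : X.prod Y → X'.prod Y' := fun p => (φ p.1, ψ p.2) with hmdef
  have h₁ : ∀ p : X.prod Y, Tendsto Prod.fst (comap m (𝓝 (m p))) (𝓝 p.1) := by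
    intro p
    rw [hφ.isEmbedding.isInducing.nhds_eq_comap, tendsto_comap_iff]
    exact (isMorphism_fst X' Y').continuous.continuousAt.tendsto.comp
      (tendsto_comap (f := m) (x := 𝓝 (m p)))
  have h₂ : ∀ p : X.prod Y, Tendsto Prod.snd (comap m (𝓝 (m p))) (𝓝 p.2) := by
    intro p
    rw [hψ.isEmbedding.isInducing.nhds_eq_comap, tendsto_comap_iff]
    exact (isMorphism_snd X' Y').continuous.continuousAt.tendsto.comp
      (tendsto_comap (f := m) (x := 𝓝 (m p)))
  refine isImmersion_of_prod hm ?_ ?_ h₁ h₂ ?_ ?_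
  · rintro ⟨x, y⟩ ⟨x', y'⟩ h
    have h' := Prod.mk.inj h
    exact Prod.ext (hφ.isEmbedding.injective h'.1) (hψ.isEmbedding.injective h'.2)
  · have : Set.range m = (Prod.fst : X'.prod Y' → X') ⁻¹' Set.range φ ∩
        (Prod.snd : X'.prod Y' → Y') ⁻¹' Set.range ψ := by
      ext ⟨a, b⟩
      constructor
      · rintro ⟨q, hq⟩
        have h' := Prod.mk.inj hq
        exact ⟨⟨q.1, h'.1⟩, ⟨q.2, h'.2⟩⟩
      · rintro ⟨⟨x, hx⟩, ⟨y, hy⟩⟩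
        exact ⟨(x, y), Prod.ext hx hy⟩
    rw [this]
    exact (hφ.isLocallyClosed_range.preimage (isMorphism_fst X' Y').continuous).inter
      (hψ.isLocallyClosed_range.preimage (isMorphism_snd X' Y').continuous)
  · intro p a ha
    obtain ⟨A, hA, h⟩ := (hφ.regularAt_iff a p.1).1 ha
    exact ⟨A ∘ Prod.fst, (isMorphism_fst X' Y').regularAt_comp A (m p) hA,
      (h₁ p).eventually h⟩
  · intro p b hb
    obtain ⟨B, hB, h⟩ := (hψ.regularAt_iff b p.2).1 hb
    exact ⟨B ∘ Prod.snd, (isMorphism_snd X' Y').regularAt_comp B (m p) hB,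
      (h₂ p).eventually h⟩

end SpaceWithFunctions

/-! ### The Segre embedding, disjoint unions, and separatedness -/

section Projective

variable {ι κ I : Type}

theorem tendsto_projectiveSpace {α : Type} {l : Filter α} {φ : α → projectiveSpace ι}
    {x : projectiveSpace ι}
    (h : ∀ (d : ℕ) (p : MvPolynomial ι ℂ), p.IsHomogeneous d →
      MvPolynomial.eval (Projectivization.rep x) p ≠ 0 →
      ∀ᶠ a in l, MvPolynomial.eval (Projectivization.rep (φ a)) p ≠ 0) :
    Tendsto φ l (𝓝 x) := by
  refine TopologicalSpace.tendsto_nhds_generateFrom_iff.2 ?_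
  rintro s ⟨d, p, hp, rfl⟩ hx
  exact h d p hp hx

theorem exists_rep_ne_zero (x : projectiveSpace ι) : ∃ i, Projectivization.rep x i ≠ 0 :=
  Function.ne_iff.1 (Projectivization.rep_nonzero x)

theorem eventually_rep_ne_zero {x : projectiveSpace ι} {i : ι}
    (h : Projectivization.rep x i ≠ 0) :
    ∀ᶠ y : projectiveSpace ι in 𝓝 x, Projectivization.rep y i ≠ 0 := by
  have := eventually_eval_ne_zero (MvPolynomial.isHomogeneous_X ℂ i) (x := x) (by simpa using h)
  exact this.mono fun y hy => by simpa using hy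

theorem projectiveSpace_ext {x y : projectiveSpace ι} {c : ℂ}
    (h : Projectivization.rep x = c • Projectivization.rep y) : x = y := by
  have hx : Projectivization.mk ℂ _ (Projectivization.rep_nonzero x) = x :=
    Projectivization.mk_rep x
  have hy : Projectivization.mk ℂ _ (Projectivization.rep_nonzero y) = y :=
    Projectivization.mk_rep y
  exact hx.symm.trans (((Projectivization.mk_eq_mk_iff' ℂ _ _ _ _).2 ⟨c, h.symm⟩).trans hy)

theorem eval_rename_left (p : MvPolynomial ι ℂ) (j : κ) (z : ι × κ → ℂ) :
    MvPolynomial.eval z (MvPolynomial.rename (fun i => (i, j)) p) =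
      MvPolynomial.eval (fun i => z (i, j)) p := by
  rw [MvPolynomial.eval_rename]
  rfl

theorem eval_rename_right (p : MvPolynomial κ ℂ) (i : ι) (z : ι × κ → ℂ) :
    MvPolynomial.eval z (MvPolynomial.rename (fun j => (i, j)) p) =
      MvPolynomial.eval (fun j => z (i, j)) p := by
  rw [MvPolynomial.eval_rename]
  rfl

theorem segre_ne_zero (v : Projectivization ℂ (ι → ℂ)) (w : Projectivization ℂ (κ → ℂ)) :
    (fun q : ι × κ => v.rep q.1 * w.rep q.2) ≠ 0 := by
  obtain ⟨i, hi⟩ := exists_rep_ne_zero v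
  obtain ⟨j, hj⟩ := exists_rep_ne_zero w
  exact fun h => mul_ne_zero hi hj (congrFun h (i, j))

/-- The Segre map. -/
def segre (p : (projectiveSpace ι).prod (projectiveSpace κ)) : projectiveSpace (ι × κ) :=
  Projectivization.mk ℂ _ (segre_ne_zero p.1 p.2)

theorem exists_rep_segre (p : (projectiveSpace ι).prod (projectiveSpace κ)) :
    ∃ c : ℂ, c ≠ 0 ∧ Projectivization.rep (segre p) =
      c • fun q : ι × κ => Projectivization.rep p.1 q.1 * Projectivization.rep p.2 q.2 :=
  exists_rep_mk _ (segre_ne_zero p.1 p.2)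

theorem regularAt_coordinate {x : projectiveSpace ι} {i : ι} (j : ι)
    (h : Projectivization.rep x i ≠ 0) :
    (projectiveSpace ι).RegularAt
      (fun y => Projectivization.rep y j / Projectivization.rep y i) x :=
  ⟨1, MvPolynomial.X j, MvPolynomial.X i, MvPolynomial.isHomogeneous_X _ _,
    MvPolynomial.isHomogeneous_X _ _, by simpa using h, Eventually.of_forall fun _ => by simp⟩

open SpaceWithFunctions in
theorem isMorphism_segre :
    IsMorphism (segre : (projectiveSpace ι).prod (projectiveSpace κ) → _) := by
  have aux : ∀ p : (projectiveSpace ι).prod (projectiveSpace κ), ∃ i j,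
      Projectivization.rep p.1 i ≠ 0 ∧ Projectivization.rep p.2 j ≠ 0 := by
    intro p
    obtain ⟨i, hi⟩ := exists_rep_ne_zero p.1
    obtain ⟨j, hj⟩ := exists_rep_ne_zero p.2
    exact ⟨i, j, hi, hj⟩
  have ev : ∀ (p : (projectiveSpace ι).prod (projectiveSpace κ)) i j,
      Projectivization.rep p.1 i ≠ 0 → Projectivization.rep p.2 j ≠ 0 →
      ∀ᶠ q : (projectiveSpace ι).prod (projectiveSpace κ) in 𝓝 p,
        Projectivization.rep q.1 i ≠ 0 ∧ Projectivization.rep q.2 j ≠ 0 := by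
    intro p i j hi hj
    exact ((isMorphism_fst _ _).continuous.continuousAt.eventually
      (eventually_rep_ne_zero hi)).and ((isMorphism_snd _ _).continuous.continuousAt.eventually
      (eventually_rep_ne_zero hj))
  let H : MvPolynomial (ι × κ) ℂ → ι → κ → (projectiveSpace ι × projectiveSpace κ → ℂ) :=
    fun P i j q => MvPolynomial.eval (fun r => (Projectivization.rep q.1 r.1 /
      Projectivization.rep q.1 i) * (Projectivization.rep q.2 r.2 / Projectivization.rep q.2 j)) P
  have hmem : ∀ (p : (projectiveSpace ι).prod (projectiveSpace κ)) P i j,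
      Projectivization.rep p.1 i ≠ 0 → Projectivization.rep p.2 j ≠ 0 →
      H P i j ∈ tensorFunctions (projectiveSpace ι) (projectiveSpace κ) p := by
    intro p P i j hi hj
    induction P using MvPolynomial.induction_on with
    | C a =>
      have : H (MvPolynomial.C a) i j = algebraMap ℂ _ a := by
        ext q
        simp [H]
      rw [this]
      exact Subalgebra.algebraMap_mem _ a
    | add P Q hP hQ =>
      have : H (P + Q) i j = H P i j + H Q i j := by
        ext q
        simp [H]
      rw [this]
      exact add_mem hP hQ
    | mul_X P r hP =>
      have : H (P * MvPolynomial.X r) i j = H P i j *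
          (((fun y : projectiveSpace ι => Projectivization.rep y r.1 /
              Projectivization.rep y i) ∘ Prod.fst) *
            ((fun y : projectiveSpace κ => Projectivization.rep y r.2 /
              Projectivization.rep y j) ∘ Prod.snd)) := by
        ext q
        simp [H]
      rw [this]
      exact mul_mem hP (mul_mem (fst_mem_tensorFunctions (regularAt_coordinate _ hi))
        (snd_mem_tensorFunctions (regularAt_coordinate _ hj)))
  have hval : ∀ (q : (projectiveSpace ι).prod (projectiveSpace κ)) i j,
      Projectivization.rep q.1 i ≠ 0 → Projectivization.rep q.2 j ≠ 0 →
      ∃ c : ℂ, c ≠ 0 ∧ ∀ (d : ℕ) P, MvPolynomial.IsHomogeneous P d →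
        MvPolynomial.eval (Projectivization.rep (segre q)) P = c ^ d * H P i j q := by
    intro q i j hi hj
    obtain ⟨c, hc, hrep⟩ := exists_rep_segre q
    refine ⟨c * (Projectivization.rep q.1 i * Projectivization.rep q.2 j),
      mul_ne_zero hc (mul_ne_zero hi hj), fun d P hP => ?_⟩
    rw [← eval_smul_of_isHomogeneous hP, hrep]
    congr 2
    ext r
    simp only [Pi.smul_apply, smul_eq_mul]
    field_simp
  have hcont : Continuous (segre : (projectiveSpace ι).prod (projectiveSpace κ) → _) := by
    refine continuous_iff_continuousAt.2 fun p => tendsto_projectiveSpace fun d P hP hp => ?_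
    obtain ⟨i, j, hi, hj⟩ := aux p
    obtain ⟨c, hc, hcv⟩ := hval p i j hi hj
    rw [hcv d P hP] at hp
    filter_upwards [ev p i j hi hj, eventually_prod_ne_zero (hmem p P i j hi hj)
      (right_ne_zero_of_mul hp)] with q e1 e2
    obtain ⟨c', hc', hcv'⟩ := hval q i j e1.1 e1.2
    rw [hcv' d P hP]
    exact mul_ne_zero (pow_ne_zero _ hc') e2
  refine ⟨hcont, ?_⟩
  rintro f p ⟨d, P, Q, hP, hQ, hp, h⟩
  obtain ⟨i, j, hi, hj⟩ := aux p
  obtain ⟨c, hc, hcv⟩ := hval p i j hi hj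
  rw [hcv d Q hQ] at hp
  refine ⟨H P i j, hmem p P i j hi hj, H Q i j, hmem p Q i j hi hj, right_ne_zero_of_mul hp, ?_⟩
  filter_upwards [ev p i j hi hj, hcont.continuousAt.eventually h] with q e1 e2
  obtain ⟨c', hc', hcv'⟩ := hval q i j e1.1 e1.2
  refine Eq.trans e2 ?_
  rw [hcv' d P hP, hcv' d Q hQ, mul_div_mul_left _ _ (pow_ne_zero _ hc')]

theorem isClosed_projectiveSpace {s : Set (projectiveSpace ι)} {J : Type} (d : ℕ)
    (P : J → MvPolynomial ι ℂ) (hP : ∀ j, (P j).IsHomogeneous d)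
    (h : ∀ x, x ∈ s ↔ ∀ j, MvPolynomial.eval (Projectivization.rep x) (P j) = 0) :
    IsClosed s := by
  refine isClosed_iff_frequently.2 fun x hx => (h x).2 fun j => ?_
  by_contra hne
  have h2 := eventually_eval_ne_zero (hP j) hne
  obtain ⟨y, hy, hy'⟩ := (hx.and_eventually h2).exists
  exact hy' ((h y).1 hy j)

theorem isImmersion_segre :
    IsImmersion (segre : (projectiveSpace ι).prod (projectiveSpace κ) → _) := by
  have hself : ∀ {p : (projectiveSpace ι).prod (projectiveSpace κ)}
      {P : projectiveSpace (ι × κ) → Prop}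
      (_ : ∀ᶠ z in 𝓝 (segre p), P z), ∀ᶠ q in comap segre (𝓝 (segre p)), P (segre q) :=
    fun h => tendsto_comap.eventually h
  -- the pull-back of a form in the coordinates of one factor
  have hl : ∀ (q : (projectiveSpace ι).prod (projectiveSpace κ)) (j : κ), ∃ c : ℂ,
      (Projectivization.rep q.2 j ≠ 0 → c ≠ 0) ∧
      ∀ (d : ℕ) P, MvPolynomial.IsHomogeneous P d →
        MvPolynomial.eval (Projectivization.rep (segre q)) (MvPolynomial.rename (fun i => (i, j)) P)
          = c ^ d * MvPolynomial.eval (Projectivization.rep q.1) P := by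
    intro q j
    obtain ⟨c, hc, hrep⟩ := exists_rep_segre q
    refine ⟨c * Projectivization.rep q.2 j, fun h => mul_ne_zero hc h, fun d P hP => ?_⟩
    rw [← eval_smul_of_isHomogeneous hP, eval_rename_left, hrep]
    congr 2
    ext r
    simp only [Pi.smul_apply, smul_eq_mul]
    ring
  have hr : ∀ (q : (projectiveSpace ι).prod (projectiveSpace κ)) (i : ι), ∃ c : ℂ,
      (Projectivization.rep q.1 i ≠ 0 → c ≠ 0) ∧
      ∀ (d : ℕ) P, MvPolynomial.IsHomogeneous P d →
        MvPolynomial.eval (Projectivization.rep (segre q)) (MvPolynomial.rename (fun j => (i, j)) P)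
          = c ^ d * MvPolynomial.eval (Projectivization.rep q.2) P := by
    intro q i
    obtain ⟨c, hc, hrep⟩ := exists_rep_segre q
    refine ⟨c * Projectivization.rep q.1 i, fun h => mul_ne_zero hc h, fun d P hP => ?_⟩
    rw [← eval_smul_of_isHomogeneous hP, eval_rename_right, hrep]
    congr 2
    ext r
    simp only [Pi.smul_apply, smul_eq_mul]
    ring
  have h₁ : ∀ p : (projectiveSpace ι).prod (projectiveSpace κ),
      Tendsto Prod.fst (comap segre (𝓝 (segre p))) (𝓝 p.1) := by
    intro p
    refine tendsto_projectiveSpace fun d P hP hp => ?_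
    obtain ⟨j, hj⟩ := exists_rep_ne_zero p.2
    obtain ⟨c, hc, hcv⟩ := hl p j
    have h0 := eventually_eval_ne_zero (hP.rename_isHomogeneous (f := fun i => (i, j)))
      (x := segre p) (by rw [hcv d P hP]; exact mul_ne_zero (pow_ne_zero _ (hc hj)) hp)
    filter_upwards [hself h0] with q hq
    obtain ⟨c', hc', hcv'⟩ := hl q j
    exact fun h => hq ((hcv' d P hP).trans (by rw [h, mul_zero]))
  have h₂ : ∀ p : (projectiveSpace ι).prod (projectiveSpace κ),
      Tendsto Prod.snd (comap segre (𝓝 (segre p))) (𝓝 p.2) := by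
    intro p
    refine tendsto_projectiveSpace fun d P hP hp => ?_
    obtain ⟨i, hi⟩ := exists_rep_ne_zero p.1
    obtain ⟨c, hc, hcv⟩ := hr p i
    have h0 := eventually_eval_ne_zero (hP.rename_isHomogeneous (f := fun j => (i, j)))
      (x := segre p) (by rw [hcv d P hP]; exact mul_ne_zero (pow_ne_zero _ (hc hi)) hp)
    filter_upwards [hself h0] with q hq
    obtain ⟨c', hc', hcv'⟩ := hr q i
    exact fun h => hq ((hcv' d P hP).trans (by rw [h, mul_zero]))
  refine SpaceWithFunctions.isImmersion_of_prod isMorphism_segre ?_ ?_ h₁ h₂ ?_ ?_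
  · rintro ⟨v, w⟩ ⟨v', w'⟩ h
    obtain ⟨c, hc, hrep⟩ := exists_rep_segre (v, w)
    obtain ⟨c', hc', hrep'⟩ := exists_rep_segre (v', w')
    rw [h, hrep'] at hrep
    obtain ⟨i, hi⟩ := exists_rep_ne_zero v
    obtain ⟨j, hj⟩ := exists_rep_ne_zero w
    have e : ∀ a b, c' * (Projectivization.rep v' a * Projectivization.rep w' b) =
        c * (Projectivization.rep v a * Projectivization.rep w b) := fun a b =>
      congrFun hrep (a, b)
    refine Prod.ext (projectiveSpace_ext (c := c' * Projectivization.rep w' j /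
      (c * Projectivization.rep w j)) ?_) (projectiveSpace_ext (c := c' *
        Projectivization.rep v' i / (c * Projectivization.rep v i)) ?_)
    · ext a
      simp only [Pi.smul_apply, smul_eq_mul]
      rw [div_mul_eq_mul_div, eq_div_iff (mul_ne_zero hc hj)]
      linear_combination - e a j
    · ext b
      simp only [Pi.smul_apply, smul_eq_mul]
      rw [div_mul_eq_mul_div, eq_div_iff (mul_ne_zero hc hi)]
      linear_combination - e i b
  · refine IsClosed.isLocallyClosed (isClosed_projectiveSpace 2
      (fun r : (ι × ι) × (κ × κ) => MvPolynomial.X (r.1.1, r.2.1) * MvPolynomial.X (r.1.2, r.2.2) -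
        MvPolynomial.X (r.1.1, r.2.2) * MvPolynomial.X (r.1.2, r.2.1))
      (fun r => ((MvPolynomial.isHomogeneous_X _ _).mul (MvPolynomial.isHomogeneous_X _ _)).sub
        ((MvPolynomial.isHomogeneous_X _ _).mul (MvPolynomial.isHomogeneous_X _ _)))
      fun z => ⟨?_, fun hz => ?_⟩)
    · rintro ⟨p, rfl⟩ r
      obtain ⟨c, hc, hrep⟩ := exists_rep_segre p
      rw [hrep]
      simp
      ring
    · obtain ⟨⟨i, j⟩, hij⟩ := exists_rep_ne_zero z
      have hv : (fun a => Projectivization.rep z (a, j)) ≠ 0 := fun h => hij (congrFun h i)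
      have hw : (fun b => Projectivization.rep z (i, b)) ≠ 0 := fun h => hij (congrFun h j)
      obtain ⟨c, hc, hcv⟩ := exists_rep_mk _ hv
      obtain ⟨c', hc', hcw⟩ := exists_rep_mk _ hw
      refine ⟨(Projectivization.mk ℂ _ hv, Projectivization.mk ℂ _ hw), ?_⟩
      obtain ⟨c'', hc'', hrep⟩ := exists_rep_segre
        ((Projectivization.mk ℂ _ hv, Projectivization.mk ℂ _ hw) :
          (projectiveSpace ι).prod (projectiveSpace κ))
      refine projectiveSpace_ext (c := c'' * (c * c' * Projectivization.rep z (i, j))) ?_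
      rw [hrep]
      ext ⟨a, b⟩
      have h0 := hz ((a, i), (b, j))
      simp only [map_sub, map_mul, MvPolynomial.eval_X] at h0
      simp only [hcv, hcw, Pi.smul_apply, smul_eq_mul]
      linear_combination - (c'' * c * c') * h0
  · rintro p a ⟨d, P, Q, hP, hQ, hp, h⟩
    obtain ⟨j, hj⟩ := exists_rep_ne_zero p.2
    obtain ⟨c, hc, hcv⟩ := hl p j
    have h0 : MvPolynomial.eval (Projectivization.rep (segre p))
        (MvPolynomial.rename (fun i => (i, j)) Q) ≠ 0 := by
      rw [hcv d Q hQ]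
      exact mul_ne_zero (pow_ne_zero _ (hc hj)) hp
    refine ⟨_, ⟨d, MvPolynomial.rename (fun i => (i, j)) P, _, hP.rename_isHomogeneous, hQ.rename_isHomogeneous, h0,
      Eventually.of_forall fun _ => rfl⟩, ?_⟩
    filter_upwards [(h₁ p).eventually h,
      hself (eventually_eval_ne_zero hQ.rename_isHomogeneous h0)] with q e1 e2
    obtain ⟨c', hc', hcv'⟩ := hl q j
    rw [hcv' d Q hQ] at e2
    rw [e1, hcv' d P hP, hcv' d Q hQ, mul_div_mul_left _ _ (left_ne_zero_of_mul e2)]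
  · rintro p a ⟨d, P, Q, hP, hQ, hp, h⟩
    obtain ⟨i, hi⟩ := exists_rep_ne_zero p.1
    obtain ⟨c, hc, hcv⟩ := hr p i
    have h0 : MvPolynomial.eval (Projectivization.rep (segre p))
        (MvPolynomial.rename (fun j => (i, j)) Q) ≠ 0 := by
      rw [hcv d Q hQ]
      exact mul_ne_zero (pow_ne_zero _ (hc hi)) hp
    refine ⟨_, ⟨d, MvPolynomial.rename (fun j => (i, j)) P, _, hP.rename_isHomogeneous, hQ.rename_isHomogeneous, h0,
      Eventually.of_forall fun _ => rfl⟩, ?_⟩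
    filter_upwards [(h₂ p).eventually h,
      hself (eventually_eval_ne_zero hQ.rename_isHomogeneous h0)] with q e1 e2
    obtain ⟨c', hc', hcv'⟩ := hr q i
    rw [hcv' d Q hQ] at e2
    rw [e1, hcv' d P hP, hcv' d Q hQ, mul_div_mul_left _ _ (left_ne_zero_of_mul e2)]

theorem SpaceWithFunctions.IsQuasiProjective.prod {X Y : SpaceWithFunctions}
    (hX : X.IsQuasiProjective) (hY : Y.IsQuasiProjective) : (X.prod Y).IsQuasiProjective := by
  obtain ⟨ι, _, e, he⟩ := hX
  obtain ⟨κ, _, e', he'⟩ := hY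
  exact ⟨ι × κ, inferInstance, _,
    isImmersion_segre.comp (SpaceWithFunctions.isImmersion_prodMap he he')⟩

end Projective

section Copies

variable {ι I : Type}

theorem eventually_copies {X : SpaceWithFunctions} {i : I} {x : X} {P : X.copies I → Prop} :
    (∀ᶠ q : X.copies I in @nhds _ (X.copies I).topology ⟨i, x⟩, P q) ↔
      ∀ᶠ y in 𝓝 x, P (⟨i, y⟩ : Σ _ : I, X) := by
  have h : @nhds (X.copies I) (X.copies I).topology (⟨i, x⟩ : Σ _ : I, X) =
      map (Sigma.mk i) (𝓝 x) :=
    Sigma.nhds_mk (σ := fun _ : I => X.carrier) i x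
  exact h ▸ Iff.rfl

theorem isImmersion_copiesMap {X Y : SpaceWithFunctions} {e : X → Y} (he : IsImmersion e) :
    IsImmersion (X := X.copies I) (Y := Y.copies I) (fun p => ⟨p.1, e p.2⟩) := by
  have hfold : Continuous (fun p : Y.copies I => p.2) :=
    (SpaceWithFunctions.isMorphism_copies_iff (φ := fun p : Y.copies I => p.2)).2
      (fun _ => isMorphism_id Y) |>.continuous
  refine ⟨(Topology.isEmbedding_sigmaMap (f₁ := (id : I → I)) (σ := fun _ => X.carrier)
    (τ := fun _ => Y.carrier) (f₂ := fun _ => e)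
    Function.injective_id).2 fun _ => he.isEmbedding, ?_, ?_⟩
  · have : Set.range (fun p : X.copies I => (⟨p.1, e p.2⟩ : Σ _ : I, Y)) =
        (fun p : Y.copies I => p.2) ⁻¹' Set.range e := by
      ext ⟨i, y⟩
      constructor
      · rintro ⟨⟨j, x⟩, h⟩
        have h' := Sigma.mk.inj h
        exact ⟨x, eq_of_heq h'.2⟩
      · rintro ⟨x, rfl⟩
        exact ⟨⟨i, x⟩, rfl⟩
    exact this ▸ he.isLocallyClosed_range.preimage hfold
  · rintro f ⟨i, x⟩
    refine (he.regularAt_iff (fun z => f ⟨i, z⟩) x).trans ⟨?_, ?_⟩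
    · rintro ⟨F, hF, h⟩
      refine ⟨fun p => F p.2, hF, ?_⟩
      exact eventually_copies.2 h
    · rintro ⟨F, hF, h⟩
      exact ⟨fun y => F (⟨i, y⟩ : Σ _ : I, Y), hF, eventually_copies.1 h⟩

theorem copiesEmbedding_ne_zero [DecidableEq I] (p : Σ _ : I, Projectivization ℂ (ι → ℂ)) :
    (fun q : I × ι => if q.1 = p.1 then p.2.rep q.2 else 0) ≠ 0 := by
  obtain ⟨i, hi⟩ := exists_rep_ne_zero p.2
  exact fun h => hi (by simpa using congrFun h (p.1, i))

/-- The embedding of a disjoint union of copies of a projective space in a projective space. -/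
def copiesEmbedding [DecidableEq I] (p : (projectiveSpace ι).copies I) : projectiveSpace (I × ι) :=
  Projectivization.mk ℂ _ (copiesEmbedding_ne_zero p)

theorem exists_rep_copiesEmbedding [DecidableEq I] (p : (projectiveSpace ι).copies I) :
    ∃ c : ℂ, c ≠ 0 ∧ Projectivization.rep (copiesEmbedding p) =
      c • fun q : I × ι => if q.1 = p.1 then Projectivization.rep p.2 q.2 else 0 :=
  exists_rep_mk _ (copiesEmbedding_ne_zero p)

theorem isMorphism_copiesEmbedding [DecidableEq I] :
    IsMorphism (copiesEmbedding : (projectiveSpace ι).copies I → _) := by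
  refine SpaceWithFunctions.isMorphism_copies_iff.2 fun i => ?_
  let g : MvPolynomial (I × ι) ℂ → MvPolynomial ι ℂ := fun P =>
    MvPolynomial.aeval (fun q : I × ι => if q.1 = i then MvPolynomial.X q.2 else 0) P
  have hg : ∀ (d : ℕ) P, MvPolynomial.IsHomogeneous P d → (g P).IsHomogeneous d := by
    intro d P hP
    have := hP.aeval (S := ℂ) (fun q : I × ι => if q.1 = i then MvPolynomial.X q.2 else 0)
      (n := 1) (fun q => by
        split_ifs
        · exact MvPolynomial.isHomogeneous_X _ _
        · exact MvPolynomial.isHomogeneous_zero _ _ _)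
    rwa [one_mul] at this
  have hge : ∀ P (x : projectiveSpace ι), MvPolynomial.eval
      (fun q : I × ι => if q.1 = i then Projectivization.rep x q.2 else 0) P =
        MvPolynomial.eval (Projectivization.rep x) (g P) := by
    intro P x
    induction P using MvPolynomial.induction_on with
    | C a => simp [g]
    | add P Q hP hQ =>
      simp only [g] at hP hQ ⊢
      rw [map_add, map_add, map_add, hP, hQ]
    | mul_X P r hP =>
      simp only [g] at hP ⊢
      rw [map_mul, map_mul, map_mul, hP, MvPolynomial.aeval_X, MvPolynomial.eval_X]
      split_ifs
      · rw [MvPolynomial.eval_X]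
      · rw [map_zero]
  have hval : ∀ x : projectiveSpace ι, ∃ c : ℂ, c ≠ 0 ∧ ∀ (d : ℕ) P,
      MvPolynomial.IsHomogeneous P d →
      MvPolynomial.eval (Projectivization.rep (copiesEmbedding (⟨i, x⟩ : Σ _ : I, _))) P =
        c ^ d * MvPolynomial.eval (Projectivization.rep x) (g P) := by
    intro x
    obtain ⟨c, hc, hrep⟩ := exists_rep_copiesEmbedding (⟨i, x⟩ : (projectiveSpace ι).copies I)
    refine ⟨c, hc, fun d P hP => ?_⟩
    rw [hrep, eval_smul_of_isHomogeneous hP]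
    congr 1
    exact hge P x
  have hcont : Continuous (fun x : projectiveSpace ι =>
      copiesEmbedding (⟨i, x⟩ : Σ _ : I, projectiveSpace ι)) := by
    refine continuous_iff_continuousAt.2 fun x => tendsto_projectiveSpace fun d P hP hp => ?_
    obtain ⟨c, hc, hcv⟩ := hval x
    rw [hcv d P hP] at hp
    refine (eventually_eval_ne_zero (hg d P hP) (right_ne_zero_of_mul hp)).mono fun y hy => ?_
    obtain ⟨c', hc', hcv'⟩ := hval y
    rw [hcv' d P hP]
    exact mul_ne_zero (pow_ne_zero _ hc') hy
  refine ⟨hcont, ?_⟩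
  rintro f x ⟨d, P, Q, hP, hQ, hp, h⟩
  obtain ⟨c, hc, hcv⟩ := hval x
  rw [hcv d Q hQ] at hp
  refine ⟨d, g P, g Q, hg d P hP, hg d Q hQ, right_ne_zero_of_mul hp, ?_⟩
  refine (hcont.continuousAt.eventually h).mono fun y hy => Eq.trans hy ?_
  obtain ⟨c', hc', hcv'⟩ := hval y
  rw [hcv' d P hP, hcv' d Q hQ, mul_div_mul_left _ _ (pow_ne_zero _ hc')]

theorem isImmersion_copiesEmbedding [DecidableEq I] :
    IsImmersion (copiesEmbedding : (projectiveSpace ι).copies I → _) := by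
  have hm := isMorphism_copiesEmbedding (ι := ι) (I := I)
  have hl : ∀ (q : (projectiveSpace ι).copies I) (i : I), q.1 = i → ∃ c : ℂ, c ≠ 0 ∧
      ∀ (d : ℕ) P, MvPolynomial.IsHomogeneous P d →
        MvPolynomial.eval (Projectivization.rep (copiesEmbedding q))
          (MvPolynomial.rename (fun k => (i, k)) P) =
            c ^ d * MvPolynomial.eval (Projectivization.rep q.2) P := by
    rintro q i rfl
    obtain ⟨c, hc, hrep⟩ := exists_rep_copiesEmbedding q
    refine ⟨c, hc, fun d P hP => ?_⟩
    rw [← eval_smul_of_isHomogeneous hP, eval_rename_right, hrep]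
    congr 2
    ext r
    simp
  have h₁ : ∀ p : (projectiveSpace ι).copies I,
      ∀ᶠ q : (projectiveSpace ι).copies I in comap copiesEmbedding (𝓝 (copiesEmbedding p)),
        q.1 = p.1 := by
    intro p
    obtain ⟨k, hk⟩ := exists_rep_ne_zero p.2
    obtain ⟨c, hc, hrep⟩ := exists_rep_copiesEmbedding p
    have h0 : Projectivization.rep (copiesEmbedding p) (p.1, k) ≠ 0 := by
      rw [hrep]
      simpa using ⟨hc, hk⟩
    refine ((tendsto_comap (f := copiesEmbedding)).eventually
      (eventually_rep_ne_zero h0)).mono fun q hq => ?_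
    by_contra hne
    obtain ⟨c', hc', hrep'⟩ := exists_rep_copiesEmbedding q
    refine hq ?_
    rw [hrep']
    simp [Ne.symm hne]
  have h₂ : ∀ p : (projectiveSpace ι).copies I, Tendsto (fun q : (projectiveSpace ι).copies I => q.2)
      (comap copiesEmbedding (𝓝 (copiesEmbedding p))) (𝓝 p.2) := by
    intro p
    refine tendsto_projectiveSpace fun d P hP hp => ?_
    obtain ⟨c, hc, hcv⟩ := hl p p.1 rfl
    have h0 := eventually_eval_ne_zero (hP.rename_isHomogeneous (f := fun k => (p.1, k)))
      (x := copiesEmbedding p) (by rw [hcv d P hP]; exact mul_ne_zero (pow_ne_zero _ hc) hp)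
    refine ((tendsto_comap (f := copiesEmbedding)).eventually h0).mp ((h₁ p).mono fun q e hq => ?_)
    obtain ⟨c', hc', hcv'⟩ := hl q p.1 e
    exact fun h => hq ((hcv' d P hP).trans (by rw [h, mul_zero]))
  have hle : ∀ p : (projectiveSpace ι).copies I,
      𝓝 p ≤ comap copiesEmbedding (𝓝 (copiesEmbedding p)) := fun p =>
    tendsto_iff_comap.1 hm.continuous.continuousAt
  have hself : ∀ {p : (projectiveSpace ι).copies I} {P : (projectiveSpace ι).copies I → Prop},
      (∀ᶠ q in comap copiesEmbedding (𝓝 (copiesEmbedding p)), P q) → P p := by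
    intro p P hP
    obtain ⟨V, hV, hVP⟩ := mem_comap.1 hP
    exact hVP (show copiesEmbedding p ∈ V from mem_of_mem_nhds hV)
  have hind : IsInducing (copiesEmbedding : (projectiveSpace ι).copies I → _) := by
    refine isInducing_iff_nhds.2 fun p => le_antisymm (hle p) fun s hs => ?_
    obtain ⟨i, x⟩ := p
    have hs' : ∀ᶠ y in 𝓝 x, (⟨i, y⟩ : Σ _ : I, projectiveSpace ι) ∈ s :=
      eventually_copies.1 hs
    filter_upwards [h₁ ⟨i, x⟩, (h₂ ⟨i, x⟩).eventually hs'] with q e1 e2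
    obtain ⟨j, y⟩ := q
    obtain rfl : j = i := e1
    exact e2
  have hinj : Function.Injective (copiesEmbedding : (projectiveSpace ι).copies I → _) := by
    rintro ⟨i, x⟩ ⟨j, y⟩ h
    have h0 : (⟨j, y⟩ : (projectiveSpace ι).copies I).1 = i := by
      have h3 := h₁ (⟨i, x⟩ : (projectiveSpace ι).copies I)
      rw [h] at h3
      exact hself h3
    obtain rfl : j = i := h0
    obtain ⟨c, hc, hrep⟩ := exists_rep_copiesEmbedding (⟨j, x⟩ : (projectiveSpace ι).copies I)
    obtain ⟨c', hc', hrep'⟩ := exists_rep_copiesEmbedding (⟨j, y⟩ : (projectiveSpace ι).copies I)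
    rw [h, hrep'] at hrep
    have : x = y := by
      refine projectiveSpace_ext (c := c' / c) ?_
      ext k
      have h4 := congrFun hrep (j, k)
      simp only [Pi.smul_apply, smul_eq_mul, if_true] at h4 ⊢
      rw [div_mul_eq_mul_div, eq_div_iff hc]
      linear_combination - h4
    rw [this]
  refine ⟨⟨hind, hinj⟩, ?_, ?_⟩
  · refine IsClosed.isLocallyClosed (isClosed_projectiveSpace
      (J := {r : (I × I) × (ι × ι) // r.1.1 ≠ r.1.2}) 2
      (fun r => MvPolynomial.X (r.1.1.1, r.1.2.1) * MvPolynomial.X (r.1.1.2, r.1.2.2))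
      (fun r => ((MvPolynomial.isHomogeneous_X _ _).mul (MvPolynomial.isHomogeneous_X _ _)))
      fun z => ⟨?_, fun hz => ?_⟩)
    · rintro ⟨p, rfl⟩ ⟨⟨⟨i, j⟩, k, l⟩, hr⟩
      obtain ⟨c, hc, hrep⟩ := exists_rep_copiesEmbedding p
      rw [hrep]
      by_cases h : i = p.1
      · have h' : j ≠ p.1 := fun h' => hr (h.trans h'.symm)
        simp [h']
      · simp [h]
    · obtain ⟨⟨i, k⟩, hik⟩ := exists_rep_ne_zero z
      have hv : (fun b => Projectivization.rep z (i, b)) ≠ 0 := fun h => hik (congrFun h k)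
      obtain ⟨c, hc, hcv⟩ := exists_rep_mk _ hv
      refine ⟨⟨i, Projectivization.mk ℂ _ hv⟩, ?_⟩
      obtain ⟨c', hc', hrep⟩ := exists_rep_copiesEmbedding
        (⟨i, Projectivization.mk ℂ _ hv⟩ : (projectiveSpace ι).copies I)
      refine projectiveSpace_ext (c := c' * c) ?_
      rw [hrep]
      ext ⟨j, l⟩
      simp only [hcv, Pi.smul_apply, smul_eq_mul]
      by_cases h : j = i
      · subst h
        simp [mul_assoc]
      · have h0 := hz ⟨⟨⟨i, j⟩, k, l⟩, fun h' => h h'.symm⟩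
        simp only [map_mul, MvPolynomial.eval_X] at h0
        rw [(mul_eq_zero.1 h0).resolve_left hik]
        simp [h]
  · rintro f ⟨i, x⟩
    constructor
    · rintro ⟨d, P, Q, hP, hQ, hp, h⟩
      obtain ⟨c, hc, hcv⟩ := hl ⟨i, x⟩ i rfl
      have h0 : MvPolynomial.eval (Projectivization.rep (copiesEmbedding
          (⟨i, x⟩ : (projectiveSpace ι).copies I)))
          (MvPolynomial.rename (fun k => (i, k)) Q) ≠ 0 := by
        rw [hcv d Q hQ]
        exact mul_ne_zero (pow_ne_zero _ hc) hp
      refine ⟨_, ⟨d, MvPolynomial.rename (fun k => (i, k)) P, _, hP.rename_isHomogeneous, hQ.rename_isHomogeneous, h0,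
        Eventually.of_forall fun _ => rfl⟩, ?_⟩
      refine eventually_copies.2 (Eventually.mono h fun y hy => Eq.trans hy ?_)
      obtain ⟨c', hc', hcv'⟩ := hl ⟨i, y⟩ i rfl
      rw [hcv' d P hP, hcv' d Q hQ, mul_div_mul_left _ _ (pow_ne_zero _ hc')]
    · rintro ⟨F, hF, hz⟩
      exact SpaceWithFunctions.regularAt_congr _ (hz.mono fun z hz => hz.symm)
        (hm.regularAt_comp F _ hF)

theorem SpaceWithFunctions.IsQuasiProjective.copies [Finite I] {X : SpaceWithFunctions}
    (hX : X.IsQuasiProjective) : (X.copies I).IsQuasiProjective := by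
  classical
  obtain ⟨ι, _, e, he⟩ := hX
  have := Fintype.ofFinite I
  exact ⟨I × ι, inferInstance, _, isImmersion_copiesEmbedding.comp (isImmersion_copiesMap he)⟩

/-- Quasi-projective varieties are separated. -/
theorem isClosed_setOf_eq {X Y : SpaceWithFunctions} (hY : Y.IsQuasiProjective) {φ ψ : X → Y}
    (hφ : IsMorphism φ) (hψ : IsMorphism ψ) : IsClosed {x | φ x = ψ x} := by
  obtain ⟨ι, _, e, he⟩ := hY
  have h1 := he.isMorphism.comp hφ
  have h2 := he.isMorphism.comp hψ
  refine isClosed_iff_frequently.2 fun x hx => ?_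
  by_contra hne
  have hne' : e (φ x) ≠ e (ψ x) := fun h => hne (he.isEmbedding.injective h)
  obtain ⟨i, hi⟩ := exists_rep_ne_zero (e (φ x))
  obtain ⟨j, hj⟩ := exists_rep_ne_zero (e (ψ x))
  obtain ⟨k, l, hkl⟩ : ∃ k l, Projectivization.rep (e (φ x)) k * Projectivization.rep (e (ψ x)) l ≠
      Projectivization.rep (e (φ x)) l * Projectivization.rep (e (ψ x)) k := by
    by_contra! h
    refine hne' (projectiveSpace_ext
      (c := Projectivization.rep (e (φ x)) j / Projectivization.rep (e (ψ x)) j) ?_)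
    ext k
    simp only [Pi.smul_apply, smul_eq_mul]
    rw [div_mul_eq_mul_div, eq_div_iff hj]
    exact h k j
  have r1 := fun k => h1.regularAt_comp _ x (regularAt_coordinate k hi)
  have r2 := fun k => h2.regularAt_comp _ x (regularAt_coordinate k hj)
  have r := X.regularAt_add (X.regularAt_mul (r1 k) (r2 l))
    (X.regularAt_mul (X.regularAt_const (-1) x) (X.regularAt_mul (r1 l) (r2 k)))
  have hi' : ∀ᶠ y in 𝓝 x, Projectivization.rep (e (φ y)) i ≠ 0 :=
    h1.continuous.continuousAt.eventually (eventually_rep_ne_zero hi)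
  have hj' : ∀ᶠ y in 𝓝 x, Projectivization.rep (e (ψ y)) j ≠ 0 :=
    h2.continuous.continuousAt.eventually (eventually_rep_ne_zero hj)
  have hev := X.eventually_ne_zero r (by
    simp only [Pi.add_apply, Pi.mul_apply, Function.comp_apply]
    intro h
    field_simp at h
    exact hkl (by linear_combination h))
  obtain ⟨y, hy, h3, h4, h5⟩ := (hx.and_eventually (hev.and (hi'.and hj'))).exists
  have hy' : φ y = ψ y := hy
  refine h3 ?_
  simp only [Pi.add_apply, Pi.mul_apply, Function.comp_apply, hy']
  ring

end Copies

/-! ### Isomorphisms of products, and the point -/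

namespace SpaceWithFunctions

variable {X Y Z X' Y' : SpaceWithFunctions}

def isoProdCongr (e : Iso X X') (e' : Iso Y Y') : Iso (X.prod Y) (X'.prod Y') :=
  ⟨e.toEquiv.prodCongr e'.toEquiv, isMorphism_prodMap e.isMorphism_toFun e'.isMorphism_toFun,
    isMorphism_prodMap e.isMorphism_invFun e'.isMorphism_invFun⟩

def isoProdComm (X Y : SpaceWithFunctions) : Iso (X.prod Y) (Y.prod X) :=
  ⟨Equiv.prodComm X Y, isMorphism_prodMk (isMorphism_snd X Y) (isMorphism_fst X Y),
    isMorphism_prodMk (isMorphism_snd Y X) (isMorphism_fst Y X)⟩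

def isoProdAssoc (X Y Z : SpaceWithFunctions) :
    Iso ((X.prod Y).prod Z) (X.prod (Y.prod Z)) :=
  ⟨Equiv.prodAssoc X Y Z,
    isMorphism_prodMk ((isMorphism_fst X Y).comp (isMorphism_fst (X.prod Y) Z))
      (isMorphism_prodMk ((isMorphism_snd X Y).comp (isMorphism_fst (X.prod Y) Z))
        (isMorphism_snd (X.prod Y) Z)),
    isMorphism_prodMk (isMorphism_prodMk (isMorphism_fst X (Y.prod Z))
      ((isMorphism_fst Y Z).comp (isMorphism_snd X (Y.prod Z))))
      ((isMorphism_snd Y Z).comp (isMorphism_snd X (Y.prod Z)))⟩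

/-- The one-point space. -/
def point : SpaceWithFunctions where
  carrier := Unit
  topology := ⊥
  RegularAt _ _ := True
  regularAt_congr _ _ := trivial
  eventually_regularAt _ := Eventually.of_forall fun _ => trivial
  regularAt_const _ _ := trivial
  regularAt_add _ _ := trivial
  regularAt_mul _ _ := trivial
  eventually_ne_zero _ hx := Eventually.of_forall fun _ => hx
  regularAt_inv _ _ := trivial

def isoPointProd (X : SpaceWithFunctions) : Iso (point.prod X) X :=
  ⟨Equiv.punitProd X, isMorphism_snd point X,
    isMorphism_prodMk (isMorphism_const (Y := point) ()) (isMorphism_id X)⟩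

theorem isQuasiProjective_point : point.IsQuasiProjective := by
  let e : point → projectiveSpace Unit := fun _ =>
    Projectivization.mk ℂ (fun _ => 1) (fun h => one_ne_zero (congrFun h ()))
  have hs : ∀ x y : projectiveSpace Unit, x = y := by
    intro x y
    obtain ⟨i, hi⟩ := exists_rep_ne_zero y
    refine projectiveSpace_ext (c := Projectivization.rep x i / Projectivization.rep y i) ?_
    ext j
    simp only [Pi.smul_apply, smul_eq_mul]
    rw [Subsingleton.elim j i, div_mul_cancel₀ _ hi]
  have hr : Set.range e = Set.univ := Set.eq_univ_of_forall fun y => ⟨(), hs _ _⟩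
  have hemb : IsEmbedding e := by
    have hsub : Subsingleton point := inferInstanceAs (Subsingleton Unit)
    exact .of_subsingleton e
  refine ⟨Unit, inferInstance, e, hemb, hr ▸ isOpen_univ.isLocallyClosed, fun f x => ?_⟩
  exact ⟨fun _ => ⟨fun _ => f x, regularAt_const _ _ _, Eventually.of_forall fun _ => rfl⟩,
    fun _ => trivial⟩

/-- The product of a subspace with a space is a subspace of the product. -/
def isoSubProd (X Y : SpaceWithFunctions) (s : Set X) :
    Iso ((X.sub s).prod Y) ((X.prod Y).sub {p | p.1 ∈ s}) where
  toFun p := ⟨(p.1.1, p.2), p.1.2⟩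
  invFun p := (⟨p.1.1, p.2⟩, p.1.2)
  left_inv _ := rfl
  right_inv _ := rfl
  isMorphism_toFun := isMorphism_sub_iff.2
    (isMorphism_prodMap (isMorphism_val X s) (isMorphism_id Y))
  isMorphism_invFun := by
    have h := isMorphism_val (X.prod Y) {p | p.1 ∈ s}
    exact isMorphism_prodMk
      (isMorphism_sub_iff.2 ((isMorphism_fst X Y).comp h)) ((isMorphism_snd X Y).comp h)

end SpaceWithFunctions

/-! ### Varieties and varieties with actions of finite groups -/

/-- Complex quasi-projective varieties (not necessarily irreducible; possibly empty). -/
structure Variety : Type 1 where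
  space : SpaceWithFunctions
  isQuasiProjective : space.IsQuasiProjective

instance : CoeSort Variety Type := ⟨fun X => X.space⟩

namespace Variety

/-- A locally closed subvariety. -/
def sub (X : Variety) (s : Set X.space) (hs : IsLocallyClosed s) : Variety :=
  ⟨X.space.sub s, X.isQuasiProjective.sub hs⟩

def prod (X Y : Variety) : Variety :=
  ⟨X.space.prod Y.space, X.isQuasiProjective.prod Y.isQuasiProjective⟩

def point : Variety := ⟨SpaceWithFunctions.point, SpaceWithFunctions.isQuasiProjective_point⟩

instance isoSetoid : Setoid Variety where
  r X Y := Nonempty (Iso X.space Y.space)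
  iseqv := ⟨fun X => ⟨Iso.refl X.space⟩, fun ⟨e⟩ => ⟨e.symm⟩, fun ⟨e⟩ ⟨e'⟩ => ⟨e.trans e'⟩⟩

end Variety

/-- Isomorphism classes of complex quasi-projective varieties, with the Cartesian product. -/
def VarietyClass : Type 1 := Quotient Variety.isoSetoid

def VarietyClass.mk (X : Variety) : VarietyClass := Quotient.mk _ X

instance : CommMonoid VarietyClass where
  mul := Quotient.map₂ Variety.prod fun _ _ ⟨e⟩ _ _ ⟨e'⟩ => ⟨SpaceWithFunctions.isoProdCongr e e'⟩
  one := Quotient.mk _ Variety.point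
  mul_assoc := by
    rintro ⟨X⟩ ⟨Y⟩ ⟨Z⟩
    exact Quotient.sound ⟨SpaceWithFunctions.isoProdAssoc X.space Y.space Z.space⟩
  mul_comm := by
    rintro ⟨X⟩ ⟨Y⟩
    exact Quotient.sound ⟨SpaceWithFunctions.isoProdComm X.space Y.space⟩
  one_mul := by
    rintro ⟨X⟩
    exact Quotient.sound ⟨SpaceWithFunctions.isoPointProd X.space⟩
  mul_one := by
    rintro ⟨X⟩
    exact Quotient.sound ⟨(SpaceWithFunctions.isoProdComm X.space SpaceWithFunctions.point).trans
      (SpaceWithFunctions.isoPointProd X.space)⟩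

/-- A `G`-variety: a complex quasi-projective variety `X` with an action of a finite group `G` by
automorphisms of the variety. -/
structure GVariety : Type 1 where
  X : Variety
  G : Type
  [group : Group G]
  [finite : Finite G]
  [action : MulAction G X.space]
  isMorphism_smul : ∀ g : G, IsMorphism (fun x : X.space => g • x)

attribute [instance] GVariety.group GVariety.finite GVariety.action

namespace GVariety

/-- Isomorphisms of varieties with actions of finite groups: an isomorphism `ψ` of varieties and an
isomorphism `φ` of groups with `ψ (g x) = φ g (ψ x)`. -/
structure Iso (V W : GVariety) where
  ψ : MotivicEuler.Iso V.X.space W.X.space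
  φ : V.G ≃* W.G
  map_smul : ∀ (g : V.G) (x : V.X.space), ψ.toFun (g • x) = φ g • ψ.toFun x

def Iso.refl (V : GVariety) : Iso V V := ⟨.refl _, .refl _, fun _ _ => rfl⟩

def Iso.symm {V W : GVariety} (e : Iso V W) : Iso W V :=
  ⟨e.ψ.symm, e.φ.symm, fun g x => by
    have h := e.map_smul (e.φ.symm g) (e.ψ.invFun x)
    rw [MulEquiv.apply_symm_apply, e.ψ.right_inv x] at h
    have h' := congrArg e.ψ.invFun h
    rw [e.ψ.left_inv] at h'
    exact h'.symm⟩

def Iso.trans {V W U : GVariety} (e : Iso V W) (e' : Iso W U) : Iso V U :=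
  ⟨e.ψ.trans e'.ψ, e.φ.trans e'.φ, fun g x =>
    (congrArg e'.ψ.toFun (e.map_smul g x)).trans (e'.map_smul (e.φ g) (e.ψ.toFun x))⟩

instance isoSetoid : Setoid GVariety where
  r V W := Nonempty (Iso V W)
  iseqv := ⟨fun V => ⟨Iso.refl V⟩, fun ⟨e⟩ => ⟨e.symm⟩, fun ⟨e⟩ ⟨e'⟩ => ⟨e.trans e'⟩⟩

/-- A locally closed `G`-invariant subvariety. -/
def sub (V : GVariety) (s : Set V.X.space) (hs : IsLocallyClosed s)
    (hG : ∀ (g : V.G), ∀ x ∈ s, g • x ∈ s) : GVariety where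
  X := V.X.sub s hs
  G := V.G
  action :=
    { smul := fun g x => ⟨g • x.1, hG g x.1 x.2⟩
      one_smul := fun x => Subtype.ext (one_smul V.G x.1)
      mul_smul := fun g h x => Subtype.ext (mul_smul g h x.1) }
  isMorphism_smul g := SpaceWithFunctions.isMorphism_sub_iff.2
    ((V.isMorphism_smul g).comp (V.X.space.isMorphism_val s))

theorem compl_invariant {V : GVariety} {s : Set V.X.space}
    (hG : ∀ (g : V.G), ∀ x ∈ s, g • x ∈ s) (g : V.G) : ∀ x ∈ sᶜ, g • x ∈ sᶜ := by
  intro x hx hgx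
  refine hx ?_
  have h := hG g⁻¹ _ hgx
  rwa [inv_smul_smul] at h

/-- The product `(X × Y, G × H)`. -/
def prod (V W : GVariety) : GVariety where
  X := V.X.prod W.X
  G := V.G × W.G
  action :=
    { smul := fun g p => (g.1 • p.1, g.2 • p.2)
      one_smul := fun p => Prod.ext (one_smul V.G p.1) (one_smul W.G p.2)
      mul_smul := fun g h p => Prod.ext (mul_smul g.1 h.1 p.1) (mul_smul g.2 h.2 p.2) }
  isMorphism_smul g :=
    SpaceWithFunctions.isMorphism_prodMap (V.isMorphism_smul g.1) (W.isMorphism_smul g.2)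

/-- The one-point variety with the action of the group with one element. -/
def point : GVariety where
  X := Variety.point
  G := Unit
  action :=
    { smul := fun _ x => x
      one_smul := fun _ => rfl
      mul_smul := fun _ _ _ => rfl }
  isMorphism_smul _ := isMorphism_id _

/-- The fixed point set `X^⟨g⟩` with the action of the centralizer of `g`. -/
def fixed (V : GVariety) (g : V.G) : GVariety where
  X := V.X.sub {x | g • x = x} (isClosed_setOf_eq V.X.isQuasiProjective (V.isMorphism_smul g)
    (isMorphism_id V.X.space)).isLocallyClosed
  G := Subgroup.centralizer ({g} : Set V.G)
  action :=
    { smul := fun h x => ⟨h.1 • x.1, by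
        have hx : g • x.1 = x.1 := x.2
        have hc : g * h.1 = h.1 * g := Subgroup.mem_centralizer_singleton_iff.1 h.2 |>.symm
        change g • h.1 • x.1 = h.1 • x.1
        rw [← mul_smul, hc, mul_smul, hx]⟩
      one_smul := fun x => Subtype.ext (one_smul V.G x.1)
      mul_smul := fun h h' x => Subtype.ext (mul_smul h.1 h'.1 x.1) }
  isMorphism_smul h := SpaceWithFunctions.isMorphism_sub_iff.2
    ((V.isMorphism_smul h.1).comp (V.X.space.isMorphism_val _))

/-- The quotient `X / G`: the set of orbits with the quotient topology, and the functions whose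
pull-backs to `X` are regular. -/
def quotientSpace (V : GVariety) : SpaceWithFunctions :=
  V.X.space.quotient (MulAction.orbitRel V.G V.X.space)

/-! ### Induction -/

section Induction

variable (V : GVariety) {H : Type} [Group H] (i : V.G →* H)

theorem copies_ext {I : Type} {X : SpaceWithFunctions} {j k : I} {x y : X} (h : j = k)
    (h' : x = y) : (⟨j, x⟩ : Σ _ : I, X) = ⟨k, y⟩ := by
  rw [h, h']

/-- The orbit relation of the right action `(h, x) * g = (h g, g⁻¹ x)` of `G` on `H × X`. -/
def indSetoid : Setoid (V.X.space.copies H) where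
  r p q := ∃ g : V.G, q = ⟨p.1 * i g, g⁻¹ • p.2⟩
  iseqv := by
    refine ⟨fun p => ⟨1, copies_ext (by simp) (by simp)⟩, ?_, ?_⟩
    · rintro p q ⟨g, rfl⟩
      exact ⟨g⁻¹, copies_ext (by simp) (by simp)⟩
    · rintro p q r ⟨g, rfl⟩ ⟨g', rfl⟩
      exact ⟨g * g', copies_ext (by simp [mul_assoc]) (by simp [mul_smul])⟩

/-- `Ind_G^H X` as a space with functions: the quotient of `H × X` by the right action of `G`. -/
def indSpace : SpaceWithFunctions := (V.X.space.copies H).quotient (V.indSetoid i)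

theorem exists_coset_rep (h : H) :
    ∃ g : V.G, h = (Quotient.out (h : H ⧸ i.range) : H) * i g := by
  have h1 : ((Quotient.out (h : H ⧸ i.range) : H) : H ⧸ i.range) = h := Quotient.out_eq' _
  obtain ⟨g, hg⟩ := QuotientGroup.eq.1 h1
  exact ⟨g, by rw [hg]; group⟩

/-- The element `g` of `G` with `h = h₀ g`, where `h₀` is the representative of the coset of `h`. -/
def cosetCoord (h : H) : V.G := (V.exists_coset_rep i h).choose

theorem cosetCoord_spec (h : H) :
    h = (Quotient.out (h : H ⧸ i.range) : H) * i (V.cosetCoord i h) :=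
  (V.exists_coset_rep i h).choose_spec

theorem cosetCoord_eq (hi : Function.Injective i) {h : H} {c : H ⧸ i.range}
    (hc : (h : H ⧸ i.range) = c) {g : V.G} (hg : h = (Quotient.out c : H) * i g) :
    V.cosetCoord i h = g := by
  apply hi
  have e := V.cosetCoord_spec i h
  rw [hc] at e
  exact mul_left_cancel (e.symm.trans hg)

/-- `Ind_G^H X` is a disjoint union of copies of `X`, indexed by `H / G`. -/
def indIso (hi : Function.Injective i) :
    MotivicEuler.Iso (V.indSpace i) (V.X.space.copies (H ⧸ i.range)) where
  toFun := Quotient.lift (fun p => (⟨(p.1 : H ⧸ i.range), V.cosetCoord i p.1 • p.2⟩ :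
      Σ _ : H ⧸ i.range, V.X.space)) (by
    rintro ⟨h, x⟩ q ⟨g, rfl⟩
    have h1 : ((h * i g : H) : H ⧸ i.range) = h := by
      rw [QuotientGroup.eq]
      exact ⟨g⁻¹, by simp⟩
    refine copies_ext h1.symm ?_
    have e : V.cosetCoord i (h * i g) = V.cosetCoord i h * g := by
      refine V.cosetCoord_eq i hi h1 ?_
      rw [map_mul, ← mul_assoc, ← V.cosetCoord_spec i h]
    change V.cosetCoord i h • x = V.cosetCoord i (h * i g) • g⁻¹ • x
    rw [e, mul_smul, smul_inv_smul])
  invFun p := Quotient.mk _ ⟨Quotient.out p.1, p.2⟩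
  left_inv := by
    rintro ⟨h, x⟩
    refine Quotient.sound ⟨V.cosetCoord i h, copies_ext (V.cosetCoord_spec i h) ?_⟩
    exact (inv_smul_smul _ _).symm
  right_inv := by
    rintro ⟨c, x⟩
    have h1 : ((Quotient.out c : H) : H ⧸ i.range) = c := Quotient.out_eq' c
    have e2 : V.cosetCoord i (Quotient.out c) = 1 := V.cosetCoord_eq i hi h1 (by simp)
    refine copies_ext h1 ?_
    change V.cosetCoord i (Quotient.out c) • x = x
    rw [e2, one_smul]
  isMorphism_toFun := by
    refine SpaceWithFunctions.isMorphism_quotient_iff.2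
      (SpaceWithFunctions.isMorphism_copies_iff.2 fun h => ?_)
    exact SpaceWithFunctions.isMorphism_to_copies (fun _ => (h : H ⧸ i.range)) _
      (fun _ => Eventually.of_forall fun _ => rfl)
      (V.isMorphism_smul (V.cosetCoord i h))
  isMorphism_invFun := SpaceWithFunctions.isMorphism_copies_iff.2 fun c =>
    (SpaceWithFunctions.isMorphism_quotient_mk _ _).comp
      (SpaceWithFunctions.isMorphism_copies_mk H V.X.space (Quotient.out c))

/-- The induced `H`-variety `Ind_G^H X`, for an embedding `i : G → H` of `G` in a finite
group `H`, with the action `h₀ [h, x] = [h₀ h, x]`. -/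
def ind [Finite H] (hi : Function.Injective i) : GVariety where
  X := ⟨V.indSpace i, V.X.isQuasiProjective.copies.of_isImmersion (V.indIso i hi).isImmersion⟩
  G := H
  action :=
    { smul := fun h₀ => Quotient.map (fun p => ⟨h₀ * p.1, p.2⟩) (by
        rintro p q ⟨g, rfl⟩
        exact ⟨g, copies_ext (mul_assoc _ _ _).symm rfl⟩)
      one_smul := by
        rintro ⟨h, x⟩
        exact congrArg (Quotient.mk _) (copies_ext (one_mul h) rfl)
      mul_smul := by
        rintro h₁ h₂ ⟨h, x⟩
        exact congrArg (Quotient.mk _) (copies_ext (mul_assoc h₁ h₂ h) rfl) }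
  isMorphism_smul h₀ := SpaceWithFunctions.isMorphism_quotient_iff.2
    (SpaceWithFunctions.isMorphism_copies_iff.2 fun h =>
      (SpaceWithFunctions.isMorphism_quotient_mk _ _).comp
        (SpaceWithFunctions.isMorphism_copies_mk H V.X.space (h₀ * h)))

end Induction

/-! ### The operations on varieties with actions are compatible with products -/

def isoProdCongr {V W V' W' : GVariety} (e : Iso V V') (e' : Iso W W') :
    Iso (V.prod W) (V'.prod W') :=
  ⟨SpaceWithFunctions.isoProdCongr e.ψ e'.ψ, e.φ.prodCongr e'.φ,
    fun g p => Prod.ext (e.map_smul g.1 p.1) (e'.map_smul g.2 p.2)⟩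

def isoProdComm (V W : GVariety) : Iso (V.prod W) (W.prod V) :=
  ⟨SpaceWithFunctions.isoProdComm V.X.space W.X.space, MulEquiv.prodComm, fun _ _ => rfl⟩

def isoProdAssoc (V W U : GVariety) : Iso ((V.prod W).prod U) (V.prod (W.prod U)) :=
  ⟨SpaceWithFunctions.isoProdAssoc V.X.space W.X.space U.X.space, MulEquiv.prodAssoc,
    fun _ _ => rfl⟩

def isoPointProd (V : GVariety) : Iso (point.prod V) V :=
  ⟨SpaceWithFunctions.isoPointProd V.X.space,
    { toEquiv := Equiv.punitProd V.G, map_mul' := fun _ _ => rfl }, fun _ _ => rfl⟩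

theorem isLocallyClosed_fst {V : GVariety} (W : GVariety) {s : Set V.X.space}
    (hs : IsLocallyClosed s) : IsLocallyClosed {p : (V.prod W).X.space | p.1 ∈ s} :=
  hs.preimage (SpaceWithFunctions.isMorphism_fst V.X.space W.X.space).continuous

def isoSubProd (V W : GVariety) (s : Set V.X.space) (hs : IsLocallyClosed s)
    (hG : ∀ (g : V.G), ∀ x ∈ s, g • x ∈ s) :
    Iso ((V.sub s hs hG).prod W) ((V.prod W).sub {p | p.1 ∈ s} (isLocallyClosed_fst W hs)
      (fun g p hp => hG g.1 p.1 hp)) :=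
  ⟨SpaceWithFunctions.isoSubProd V.X.space W.X.space s, .refl _, fun _ _ => rfl⟩

theorem prodMap_injective {V W : GVariety} {H : Type} [Group H] {i : V.G →* H}
    (hi : Function.Injective i) : Function.Injective (i.prodMap (MonoidHom.id W.G)) :=
  fun _ _ h => Prod.ext (hi (Prod.ext_iff.1 h).1) (Prod.ext_iff.1 h).2

def isoIndProd (V W : GVariety) {H : Type} [Group H] [Finite H] (i : V.G →* H)
    (hi : Function.Injective i) :
    Iso ((V.prod W).ind (H := H × W.G) (i.prodMap (MonoidHom.id W.G)) (prodMap_injective hi))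
      ((V.ind i hi).prod W) where
  φ := .refl _
  ψ :=
    { toFun := Quotient.lift (fun p => (Quotient.mk _ ⟨p.1.1, p.2.1⟩, p.1.2 • p.2.2)) (by
        rintro ⟨⟨h, k⟩, x, w⟩ q ⟨⟨g, k'⟩, rfl⟩
        refine Prod.ext (Quotient.sound ⟨g, rfl⟩) ?_
        change k • w = (k * k') • k'⁻¹ • w
        rw [mul_smul, smul_inv_smul])
      invFun := fun p => Quotient.lift (fun q => Quotient.mk _ ⟨(q.1, 1), (q.2, p.2)⟩) (by
        rintro ⟨h, x⟩ q ⟨g, rfl⟩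
        refine Quotient.sound ⟨(g, 1), ?_⟩
        refine copies_ext (I := H × W.G) (X := (V.prod W).X.space)
          (Prod.ext rfl ?_) (Prod.ext rfl ?_)
        · exact (mul_one (1 : W.G)).symm
        · exact (show p.2 = (1 : W.G)⁻¹ • p.2 by rw [inv_one, one_smul])) p.1
      left_inv := by
        rintro ⟨⟨h, k⟩, x, w⟩
        refine Quotient.sound ⟨(1, k), ?_⟩
        refine copies_ext (I := H × W.G) (X := (V.prod W).X.space)
          (Prod.ext ?_ ?_) (Prod.ext ?_ ?_)
        · exact (show h = h * i 1 by rw [map_one, mul_one])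
        · exact (one_mul k).symm
        · exact (show x = (1 : V.G)⁻¹ • x by rw [inv_one, one_smul])
        · exact (show w = k⁻¹ • k • w by rw [inv_smul_smul])
      right_inv := by
        rintro ⟨⟨h, x⟩, w⟩
        refine Prod.ext rfl ?_
        exact one_smul W.G w
      isMorphism_toFun := by
        refine SpaceWithFunctions.isMorphism_quotient_iff.2
          (SpaceWithFunctions.isMorphism_copies_iff.2 fun hk => ?_)
        exact SpaceWithFunctions.isMorphism_prodMap
          ((SpaceWithFunctions.isMorphism_quotient_mk _ _).comp
            (SpaceWithFunctions.isMorphism_copies_mk H V.X.space hk.1)) (W.isMorphism_smul hk.2)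
      isMorphism_invFun := by
        let ε := V.indIso i hi
        have hfst := SpaceWithFunctions.isMorphism_fst (V.indSpace i) W.X.space
        have hfold : IsMorphism (X := V.X.space.copies (H ⧸ i.range)) (fun q => q.2) :=
          SpaceWithFunctions.isMorphism_copies_iff.2 fun _ => isMorphism_id _
        have hlab : ∀ p : (V.indSpace i).prod W.X.space, ∀ᶠ z : (V.indSpace i).prod W.X.space
            in 𝓝 p, (ε.toFun z.1).1 = (ε.toFun p.1).1 := by
          intro p
          refine (ε.isMorphism_toFun.continuous.comp hfst.continuous).continuousAt.eventually
            (p := fun q => q.1 = (ε.toFun p.1).1) ?_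
          exact eventually_copies.2 (Eventually.of_forall fun _ => rfl)
        have h := (SpaceWithFunctions.isMorphism_quotient_mk _
          ((V.prod W).indSetoid (i.prodMap (MonoidHom.id W.G)))).comp
          (SpaceWithFunctions.isMorphism_to_copies (W := (V.indSpace i).prod W.X.space)
            (fun p => ((Quotient.out (ε.toFun p.1).1 : H), (1 : W.G)))
            (fun p => ((ε.toFun p.1).2, p.2)) (fun p => (hlab p).mono fun z hz => by simp only [hz])
            (SpaceWithFunctions.isMorphism_prodMk
              (hfold.comp (ε.isMorphism_toFun.comp hfst))
              (SpaceWithFunctions.isMorphism_snd (V.indSpace i) W.X.space)))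
        refine (congrArg (fun f => IsMorphism (X := (V.indSpace i).prod W.X.space) f) ?_).mp h
        funext ⟨q, w⟩
        obtain ⟨r, rfl⟩ : ∃ r, ε.invFun r = q := ⟨_, ε.left_inv q⟩
        have hr : ε.toFun (ε.invFun r) = r := ε.right_inv r
        change Quotient.mk ((V.prod W).indSetoid (i.prodMap (MonoidHom.id W.G)))
          ⟨((Quotient.out (ε.toFun (ε.invFun r)).1 : H), (1 : W.G)),
            ((ε.toFun (ε.invFun r)).2, w)⟩ = _
        rw [hr]
        rfl }
  map_smul := by
    rintro ⟨h₀, k₀⟩ ⟨⟨h, k⟩, x, w⟩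
    refine Prod.ext rfl ?_
    exact mul_smul k₀ k w

end GVariety

/-! ### The Grothendieck rings -/

/-- The ideal of a group ring whose underlying additive group is generated by a set `S` which is
stable under multiplication by the elements of the monoid. -/
def idealOfRelators {M : Type 1} [CommMonoid M] (S : Set (FreeAbelianGroup M))
    (hS : ∀ (m : M), ∀ s ∈ S, s * FreeAbelianGroup.of m ∈ S) : Ideal (FreeAbelianGroup M) where
  carrier := AddSubgroup.closure S
  zero_mem' := zero_mem (AddSubgroup.closure S)
  add_mem' := fun ha hb => add_mem (S := AddSubgroup (FreeAbelianGroup M)) ha hb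
  smul_mem' := by
    intro c x hx
    change c * x ∈ AddSubgroup.closure S
    induction c using FreeAbelianGroup.induction_on with
    | zero => rw [zero_mul]; exact zero_mem _
    | of m =>
      have hx' : x ∈ AddSubgroup.closure S := hx
      induction hx' using AddSubgroup.closure_induction with
      | mem s hs => rw [mul_comm]; exact AddSubgroup.subset_closure (hS m s hs)
      | zero => rw [mul_zero]; exact zero_mem _
      | add a b ha hb iha ihb => rw [mul_add]; exact add_mem (iha ha) (ihb hb)
      | neg a ha iha => rw [mul_neg]; exact neg_mem (iha ha)
    | neg m hm => rw [neg_mul]; exact neg_mem hm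
    | add a b ha hb => rw [add_mul]; exact add_mem ha hb

/-- The relators `[X] - [Y] - [X ∖ Y]`, for `Y` Zariski closed in `X`. -/
def varietyRelators : Set (FreeAbelianGroup VarietyClass) :=
  {r | ∃ (X : Variety) (Y : Set X.space) (hY : IsClosed Y),
    r = FreeAbelianGroup.of (VarietyClass.mk X) -
      FreeAbelianGroup.of (VarietyClass.mk (X.sub Y hY.isLocallyClosed)) -
      FreeAbelianGroup.of (VarietyClass.mk (X.sub Yᶜ hY.isOpen_compl.isLocallyClosed))}

theorem varietyRelators_mul (m : VarietyClass) :
    ∀ r ∈ varietyRelators, r * FreeAbelianGroup.of m ∈ varietyRelators := by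
  rintro _ ⟨X, Y, hY, rfl⟩
  obtain ⟨Z, rfl⟩ : ∃ Z, VarietyClass.mk Z = m := Quotient.exists_rep m
  have hc := (SpaceWithFunctions.isMorphism_fst X.space Z.space).continuous
  refine ⟨X.prod Z, {p | p.1 ∈ Y}, hY.preimage hc, ?_⟩
  rw [sub_mul, sub_mul, FreeAbelianGroup.of_mul_of, FreeAbelianGroup.of_mul_of,
    FreeAbelianGroup.of_mul_of]
  refine congrArg₂ _ (congrArg₂ _ rfl (congrArg _ ?_)) (congrArg _ ?_)
  · exact Quotient.sound ⟨SpaceWithFunctions.isoSubProd X.space Z.space Y⟩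
  · exact Quotient.sound ⟨SpaceWithFunctions.isoSubProd X.space Z.space Yᶜ⟩

/-- The Grothendieck ring `K₀(Var_ℂ)` of complex quasi-projective varieties. -/
def K0Var : Type 1 :=
  FreeAbelianGroup VarietyClass ⧸ idealOfRelators varietyRelators varietyRelators_mul

instance : CommRing K0Var :=
  inferInstanceAs (CommRing
    (FreeAbelianGroup VarietyClass ⧸ idealOfRelators varietyRelators varietyRelators_mul))

/-- The class `[X]` in `K₀(Var_ℂ)`. -/
def K0Var.cls (X : Variety) : K0Var :=
  Ideal.Quotient.mk (idealOfRelators varietyRelators varietyRelators_mul)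
    (FreeAbelianGroup.of (VarietyClass.mk X))

/-- Isomorphism classes of varieties with actions of finite groups, with the product
`(X, G) × (Y, H) = (X × Y, G × H)`. -/
def GVarietyClass : Type 1 := Quotient GVariety.isoSetoid

def GVarietyClass.mk (V : GVariety) : GVarietyClass := Quotient.mk _ V

instance : CommMonoid GVarietyClass where
  mul := Quotient.map₂ GVariety.prod fun _ _ ⟨e⟩ _ _ ⟨e'⟩ => ⟨GVariety.isoProdCongr e e'⟩
  one := Quotient.mk _ GVariety.point
  mul_assoc := by
    rintro ⟨V⟩ ⟨W⟩ ⟨U⟩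
    exact Quotient.sound ⟨GVariety.isoProdAssoc V W U⟩
  mul_comm := by
    rintro ⟨V⟩ ⟨W⟩
    exact Quotient.sound ⟨GVariety.isoProdComm V W⟩
  one_mul := by
    rintro ⟨V⟩
    exact Quotient.sound ⟨GVariety.isoPointProd V⟩
  mul_one := by
    rintro ⟨V⟩
    exact Quotient.sound ⟨(GVariety.isoProdComm V GVariety.point).trans (GVariety.isoPointProd V)⟩

/-- The relators `[(X, G)] - [(Y, G)] - [(X ∖ Y, G)]`, for `Y` a Zariski closed `G`-subvariety of
`X`, and `[(Ind_G^H X, H)] - [(X, G)]`, for `G` embedded in a finite group `H`. -/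
def gVarietyRelators : Set (FreeAbelianGroup GVarietyClass) :=
  {r | ∃ (V : GVariety) (Y : Set V.X.space) (hY : IsClosed Y)
      (hG : ∀ (g : V.G), ∀ x ∈ Y, g • x ∈ Y),
    r = FreeAbelianGroup.of (GVarietyClass.mk V) -
      FreeAbelianGroup.of (GVarietyClass.mk (V.sub Y hY.isLocallyClosed hG)) -
      FreeAbelianGroup.of (GVarietyClass.mk (V.sub Yᶜ hY.isOpen_compl.isLocallyClosed
        (GVariety.compl_invariant hG)))} ∪
  {r | ∃ (V : GVariety) (H : Type) (_ : Group H) (_ : Finite H) (i : V.G →* H)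
      (hi : Function.Injective i),
    r = FreeAbelianGroup.of (GVarietyClass.mk (V.ind i hi)) -
      FreeAbelianGroup.of (GVarietyClass.mk V)}

theorem gVarietyRelators_mul (m : GVarietyClass) :
    ∀ r ∈ gVarietyRelators, r * FreeAbelianGroup.of m ∈ gVarietyRelators := by
  obtain ⟨W, rfl⟩ : ∃ W, GVarietyClass.mk W = m := Quotient.exists_rep m
  rintro _ (⟨V, Y, hY, hG, rfl⟩ | ⟨V, H, _, _, i, hi, rfl⟩)
  · have hc := (SpaceWithFunctions.isMorphism_fst V.X.space W.X.space).continuous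
    refine Or.inl ⟨V.prod W, {p | p.1 ∈ Y}, hY.preimage hc, fun g p hp => hG g.1 p.1 hp, ?_⟩
    rw [sub_mul, sub_mul, FreeAbelianGroup.of_mul_of, FreeAbelianGroup.of_mul_of,
      FreeAbelianGroup.of_mul_of]
    refine congrArg₂ _ (congrArg₂ _ rfl (congrArg _ ?_)) (congrArg _ ?_)
    · exact Quotient.sound ⟨GVariety.isoSubProd V W Y _ _⟩
    · exact Quotient.sound ⟨GVariety.isoSubProd V W Yᶜ _ _⟩
  · refine Or.inr ⟨V.prod W, H × W.G, inferInstance, inferInstance, _,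
      GVariety.prodMap_injective hi, ?_⟩
    rw [sub_mul, FreeAbelianGroup.of_mul_of, FreeAbelianGroup.of_mul_of]
    refine congrArg₂ _ (congrArg _ ?_) rfl
    exact Quotient.sound ⟨(GVariety.isoIndProd V W i hi).symm⟩

/-- The Grothendieck ring `K₀^fGr(Var_ℂ)` of complex quasi-projective varieties with actions of
finite groups. -/
def K0fGr : Type 1 :=
  FreeAbelianGroup GVarietyClass ⧸ idealOfRelators gVarietyRelators gVarietyRelators_mul

instance : CommRing K0fGr :=
  inferInstanceAs (CommRing
    (FreeAbelianGroup GVarietyClass ⧸ idealOfRelators gVarietyRelators gVarietyRelators_mul))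

/-- The class `[(X, G)]` in `K₀^fGr(Var_ℂ)`. -/
def K0fGr.cls (V : GVariety) : K0fGr :=
  Ideal.Quotient.mk (idealOfRelators gVarietyRelators gVarietyRelators_mul)
    (FreeAbelianGroup.of (GVarietyClass.mk V))

/-! ### The generalized Euler characteristics of higher orders -/

open Classical in
/-- The class in `K₀(Var_ℂ)` of a space with functions that is a quasi-projective variety
(and `0` for the other ones). -/
def K0Var.clsOfSpace (X : SpaceWithFunctions) : K0Var :=
  if h : X.IsQuasiProjective then K0Var.cls ⟨X, h⟩ else 0

/-- The generalized Euler characteristic of order `k` of `(X, G)`: `[X / G]` for `k = 0`, and the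
sum over the conjugacy classes `[g]` of `G` of the generalized Euler characteristics of order
`k - 1` of `(X^⟨g⟩, C_G(g))` for `k ≥ 1`, where `g` is some representative of `[g]`. -/
def chi : ℕ → GVariety → K0Var
  | 0, V => K0Var.clsOfSpace V.quotientSpace
  | k + 1, V => ∑ᶠ c : ConjClasses V.G, chi k (V.fixed (Quotient.out c))

end MotivicEuler

end

open Topology Filter

noncomputable section

namespace MotivicEuler

/-! ### Morphisms to projective spaces -/

namespace SpaceWithFunctions

/-! The inertia variety I(X, G) consists of the pairs (g, x) with gx = x, and G acts on it by h(g,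
x) = (hgh⁻¹, hx). Its part over the conjugacy class of g is induced from X^⟨g⟩ with the action of
C_G(g) (`conjPartIso`). If F is a function of G-varieties that respects the three relations, then
F(I(X, G)) is therefore the sum of the F(X^⟨g⟩, C_G(g)) over the conjugacy classes, for every choice
of representatives (`inertia_eq_finsum`). This turns the recursion into χ^(k+1)(V) = χ^(k)(I(V)).
Since I commutes with isomorphisms, invariant subvarieties, induction and products, the properties
collected in `IsMotivic` pass from χ^(k) to χ^(k+1), and only χ^(0)(X, G) = [X/G] remains.

For k = 0 one needs that X/G is quasi-projective and that quotients, as spaces with functions, are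
compatible with invariant locally closed subvarieties, products and induction. The geometric
arguments rest on averaging. Near x, a regular function is written as a fraction a/b such that a and
b are regular near the whole orbit of x and b vanishes at the points of the orbit other than x
(`exists_tensorOn_fraction`). At x the sum of the translates of b is then |Stab x| · b(x) ≠ 0
(`sum_smul_ne_zero`), and an invariant function equals the sum of the translates of a divided by
that of b.

For quasi-projectivity, let e embed X in a projective space. The map x ↦ ⊗_g e(g⁻¹x) is an
equivariant embedding in a projective space on which G permutes the coordinates
(`exists_isImmersion_permSpace`), so it suffices to treat the latter. The algebra of invariant
polynomials is finitely generated, and all polynomials are integral over it. For a suitable d,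
finitely many invariant forms of degree d generate all invariant forms of degree divisible by d
(`exists_veronese`). They have no common zero; the map to a projective space that they define is
closed by integrality (`isClosedMap_formMap`), and averaging shows that it separates orbits and
induces the right regular functions on the quotient. -/

theorem regularAt_finset_sum (X : SpaceWithFunctions) {α : Type*} (s : Finset α) {f : α → X → ℂ}
    {x : X} (h : ∀ a ∈ s, X.RegularAt (f a) x) : X.RegularAt (fun y => ∑ a ∈ s, f a y) x := by
  classical
  induction s using Finset.induction_on with
  | empty => simpa using! X.regularAt_const 0 x
  | insert a s ha ih =>
    simp only [Finset.sum_insert ha]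
    exact X.regularAt_add (h a (Finset.mem_insert_self a s))
      (ih fun b hb => h b (Finset.mem_insert_of_mem hb))

theorem regularAt_finset_prod (X : SpaceWithFunctions) {α : Type*} (s : Finset α) {f : α → X → ℂ}
    {x : X} (h : ∀ a ∈ s, X.RegularAt (f a) x) : X.RegularAt (fun y => ∏ a ∈ s, f a y) x := by
  classical
  induction s using Finset.induction_on with
  | empty => simpa using! X.regularAt_const 1 x
  | insert a s ha ih =>
    simp only [Finset.prod_insert ha]
    exact X.regularAt_mul (h a (Finset.mem_insert_self a s))
      (ih fun b hb => h b (Finset.mem_insert_of_mem hb))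

theorem regularAt_eval (X : SpaceWithFunctions) {ι : Type} {c : ι → X → ℂ} {x : X}
    (hc : ∀ i, X.RegularAt (c i) x) (P : MvPolynomial ι ℂ) :
    X.RegularAt (fun y => MvPolynomial.eval (fun i => c i y) P) x := by
  induction P using MvPolynomial.induction_on with
  | C a => simpa using! X.regularAt_const a x
  | add P Q hP hQ => simpa only [map_add] using! X.regularAt_add hP hQ
  | mul_X P i hP => simpa only [map_mul, MvPolynomial.eval_X] using! X.regularAt_mul hP (hc i)

end SpaceWithFunctions

/-- A map to a projective space that is locally given by regular homogeneous coordinates is a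
morphism. -/
theorem isMorphism_to_projectiveSpace {X : SpaceWithFunctions} {ι : Type}
    {φ : X → projectiveSpace ι}
    (h : ∀ x, ∃ c : ι → X → ℂ, (∀ i, X.RegularAt (c i) x) ∧
      ∀ᶠ y in 𝓝 x, ∃ l : ℂ, l ≠ 0 ∧ Projectivization.rep (φ y) = l • fun i => c i y) :
    IsMorphism φ := by
  have hcont : Continuous φ := by
    refine continuous_iff_continuousAt.2 fun x => tendsto_projectiveSpace fun d P hP hp => ?_
    obtain ⟨c, hc, hev⟩ := h x
    obtain ⟨l, hl, hx⟩ := hev.self_of_nhds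
    rw [hx, eval_smul_of_isHomogeneous hP] at hp
    filter_upwards [hev, X.eventually_ne_zero (X.regularAt_eval hc P) (right_ne_zero_of_mul hp)]
      with y ⟨l', hl', hy⟩ hne
    rw [hy, eval_smul_of_isHomogeneous hP]
    exact mul_ne_zero (pow_ne_zero _ hl') hne
  refine ⟨hcont, ?_⟩
  rintro f x ⟨d, P, Q, hP, hQ, hp, hf⟩
  obtain ⟨c, hc, hev⟩ := h x
  obtain ⟨l, hl, hx⟩ := hev.self_of_nhds
  rw [hx, eval_smul_of_isHomogeneous hQ] at hp
  refine X.regularAt_congr ?_ (X.regularAt_div (X.regularAt_eval hc P) (X.regularAt_eval hc Q)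
    (right_ne_zero_of_mul hp))
  filter_upwards [hev, hcont.continuousAt.eventually hf] with y ⟨l', hl', hy⟩ hfy
  refine Eq.symm (Eq.trans hfy ?_)
  rw [hy, eval_div_of_isHomogeneous hP hQ hl']

/-- Dividing by a coordinate that does not vanish at φ(x) gives regular coordinates. Together with
`isMorphism_to_projectiveSpace`, this lets maps between projective spaces be checked on coordinates.
-/
theorem IsMorphism.exists_homogeneous_coordinates {X : SpaceWithFunctions} {ι : Type}
    {φ : X → projectiveSpace ι} (hφ : IsMorphism φ) (x : X) :
    ∃ c : ι → X → ℂ, (∀ i, X.RegularAt (c i) x) ∧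
      ∀ᶠ y in 𝓝 x, ∃ l : ℂ, l ≠ 0 ∧ Projectivization.rep (φ y) = l • fun i => c i y := by
  obtain ⟨i, hi⟩ := exists_rep_ne_zero (φ x)
  refine ⟨fun j y => Projectivization.rep (φ y) j / Projectivization.rep (φ y) i,
    fun j => hφ.regularAt_comp _ x (regularAt_coordinate j hi), ?_⟩
  filter_upwards [hφ.continuous.continuousAt.eventually (eventually_rep_ne_zero hi)] with y hy
  refine ⟨Projectivization.rep (φ y) i, hy, ?_⟩
  ext j
  simp only [Pi.smul_apply, smul_eq_mul]
  exact (mul_div_cancel₀ _ hy).symm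

/-! ### Separating points by homogeneous polynomials -/

section Separation

variable {ι : Type}

/-- A point of a projective space is separated from a closed set by a homogeneous polynomial. -/
theorem exists_isHomogeneous_separating {Z : Set (projectiveSpace ι)} (hZ : IsClosed Z)
    {x : projectiveSpace ι} (hx : x ∉ Z) :
    ∃ (d : ℕ) (M : MvPolynomial ι ℂ), M.IsHomogeneous d ∧
      MvPolynomial.eval (Projectivization.rep x) M ≠ 0 ∧
      ∀ z ∈ Z, MvPolynomial.eval (Projectivization.rep z) M = 0 := by
  -- By definition the sets {M ≠ 0} only generate the topology. Induction over `GenerateOpen` shows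
  -- that they form a basis: an intersection is handled by a product of forms.
  have key : ∀ U : Set (projectiveSpace ι), IsOpen U → ∀ x ∈ U,
      ∃ (d : ℕ) (M : MvPolynomial ι ℂ), M.IsHomogeneous d ∧
        MvPolynomial.eval (Projectivization.rep x) M ≠ 0 ∧
        ∀ z, MvPolynomial.eval (Projectivization.rep z) M ≠ 0 → z ∈ U := by
    intro U hU
    replace hU : TopologicalSpace.GenerateOpen _ U := hU
    induction hU with
    | basic s hs =>
      obtain ⟨d, p, hp, rfl⟩ := hs
      exact fun x hx => ⟨d, p, hp, hx, fun z hz => hz⟩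
    | univ => exact fun x _ => ⟨0, 1, MvPolynomial.isHomogeneous_one _ _, by simp, fun _ _ => trivial⟩
    | inter s t _ _ hs ht =>
      rintro x ⟨hxs, hxt⟩
      obtain ⟨d, M, hM, hxM, h⟩ := hs x hxs
      obtain ⟨d', M', hM', hxM', h'⟩ := ht x hxt
      refine ⟨d + d', M * M', hM.mul hM', by simpa using ⟨hxM, hxM'⟩, fun z hz => ?_⟩
      rw [map_mul] at hz
      exact ⟨h z (left_ne_zero_of_mul hz), h' z (right_ne_zero_of_mul hz)⟩
    | sUnion S _ hS =>
      rintro x ⟨s, hs, hxs⟩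
      obtain ⟨d, M, hM, hxM, h⟩ := hS s hs x hxs
      exact ⟨d, M, hM, hxM, fun z hz => ⟨s, hs, h z hz⟩⟩
  obtain ⟨d, M, hM, hxM, h⟩ := key Zᶜ hZ.isOpen_compl x hx
  exact ⟨d, M, hM, hxM, fun z hz => by_contra fun h0 => h z h0 hz⟩

/-- A point is cut out by the linear forms xᵢXⱼ − xⱼXᵢ. What is needed later is that finite orbits
are closed. -/
instance : T1Space (projectiveSpace ι) := by
  refine ⟨fun x => ?_⟩
  refine isClosed_projectiveSpace (J := ι × ι) 1
    (fun r => MvPolynomial.C (Projectivization.rep x r.1) * MvPolynomial.X r.2 -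
      MvPolynomial.C (Projectivization.rep x r.2) * MvPolynomial.X r.1)
    (fun r => (MvPolynomial.isHomogeneous_C_mul_X _ _).sub
      (MvPolynomial.isHomogeneous_C_mul_X _ _)) fun z => ⟨?_, fun hz => ?_⟩
  · rintro rfl r
    simp [mul_comm]
  · obtain ⟨i, hi⟩ := exists_rep_ne_zero x
    refine projectiveSpace_ext (c := Projectivization.rep z i / Projectivization.rep x i) ?_
    ext j
    have h0 := hz (i, j)
    simp only [map_sub, map_mul, MvPolynomial.eval_C, MvPolynomial.eval_X] at h0
    simp only [Pi.smul_apply, smul_eq_mul]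
    rw [div_mul_eq_mul_div, eq_div_iff hi]
    linear_combination h0

/-- Finitely many points of a projective space lie in the complement of a hyperplane. -/
theorem exists_linear_ne_zero [Fintype ι] {S : Set (projectiveSpace ι)} (hS : S.Finite) :
    ∃ L : MvPolynomial ι ℂ, L.IsHomogeneous 1 ∧
      ∀ x ∈ S, MvPolynomial.eval (Projectivization.rep x) L ≠ 0 := by
  classical
  have := hS.to_subtype
  -- Over an infinite field, some linear functional is nonzero on any finite list of nonzero
  -- vectors. The coefficients of L are the values of this functional on the standard basis.
  obtain ⟨f, hf⟩ := Module.exists_dual_forall_apply_ne_zero (K := ℂ)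
    (fun x : S => Projectivization.rep x.1) fun x => Projectivization.rep_nonzero x.1
  refine ⟨∑ i, MvPolynomial.C (f fun j => if i = j then 1 else 0) * MvPolynomial.X i,
    MvPolynomial.IsHomogeneous.sum _ _ _ fun i _ => MvPolynomial.isHomogeneous_C_mul_X _ _,
    fun x hx => ?_⟩
  have h := hf ⟨x, hx⟩
  rw [LinearMap.pi_apply_eq_sum_univ f] at h
  simpa [mul_comm] using h

end Separation

theorem IsImmersion.t1Space {X Y : SpaceWithFunctions} {e : X → Y} (he : IsImmersion e)
    [T1Space Y] : T1Space X :=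
  he.isEmbedding.t1Space

theorem SpaceWithFunctions.IsQuasiProjective.t1Space {X : SpaceWithFunctions}
    (hX : X.IsQuasiProjective) : T1Space X := by
  obtain ⟨ι, _, e, he⟩ := hX
  exact he.t1Space

/-! ### Sums over orbits -/

/-- Only the stabilizer of x contributes, each element with b(x), so the sum is |Stab x| · b(x),
which is nonzero in characteristic zero. This keeps averaged denominators invertible. -/
theorem sum_smul_ne_zero {G α : Type} [Group G] [Fintype G] [MulAction G α] {b : α → ℂ} {x : α}
    (hx : b x ≠ 0) (h : ∀ g : G, g • x ≠ x → b (g • x) = 0) : ∑ g : G, b (g • x) ≠ 0 := by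
  classical
  have h1 : ∀ g : G, b (g • x) = if g • x = x then b x else 0 := by
    intro g
    split_ifs with hg
    · rw [hg]
    · exact h g hg
  simp only [h1]
  rw [Finset.sum_ite, Finset.sum_const_zero, add_zero, Finset.sum_const, nsmul_eq_mul]
  refine mul_ne_zero (Nat.cast_ne_zero.2 (Finset.card_ne_zero.2 ⟨1, ?_⟩)) hx
  simp

theorem sum_smul_smul {G α : Type} [Group G] [Fintype G] [MulAction G α] (b : α → ℂ) (h : G)
    (x : α) : ∑ g : G, b (g • h • x) = ∑ g : G, b (g • x) := by
  simp only [← mul_smul]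
  exact Fintype.sum_equiv (Equiv.mulRight h) _ _ fun _ => rfl

/-! ### Fractions with denominators that are regular near a finite set -/

namespace SpaceWithFunctions

/-- The functions `∑ aᵢ(x) bᵢ(y)` on `X × Y`, with `aᵢ` regular on `U` and `bᵢ` regular on `V`. -/
def tensorOn {X Y : SpaceWithFunctions} (U : Set X) (V : Set Y) : Submodule ℂ (X × Y → ℂ) :=
  Submodule.span ℂ {h | ∃ (a : X → ℂ) (b : Y → ℂ), (∀ x ∈ U, X.RegularAt a x) ∧
    (∀ y ∈ V, Y.RegularAt b y) ∧ h = fun q => a q.1 * b q.2}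

/-- A monomial in the products aᵢ(x)bⱼ(y) separates into a function of x times a function of y. -/
theorem eval_mul_mem_tensorOn {X Y : SpaceWithFunctions} {U : Set X} {V : Set Y} {ι κ : Type}
    {a : ι → X → ℂ} {b : κ → Y → ℂ} (ha : ∀ i, ∀ x ∈ U, X.RegularAt (a i) x)
    (hb : ∀ j, ∀ y ∈ V, Y.RegularAt (b j) y) (P : MvPolynomial (ι × κ) ℂ) :
    (fun q : X × Y => MvPolynomial.eval (fun r : ι × κ => a r.1 q.1 * b r.2 q.2) P) ∈
      tensorOn U V := by
  have h : (fun q : X × Y => MvPolynomial.eval (fun r : ι × κ => a r.1 q.1 * b r.2 q.2) P) =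
      ∑ m ∈ P.support, P.coeff m • fun q : X × Y =>
        (∏ r ∈ m.support, a r.1 q.1 ^ m r) * ∏ r ∈ m.support, b r.2 q.2 ^ m r := by
    ext q
    rw [MvPolynomial.eval_eq, Finset.sum_apply]
    refine Finset.sum_congr rfl fun m _ => ?_
    simp only [Pi.smul_apply, smul_eq_mul, mul_pow, Finset.prod_mul_distrib]
  rw [h]
  refine Submodule.sum_mem _ fun m _ => Submodule.smul_mem _ _ (Submodule.subset_span
    ⟨fun x => ∏ r ∈ m.support, a r.1 x ^ m r, fun y => ∏ r ∈ m.support, b r.2 y ^ m r,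
      fun x hx => ?_, fun y hy => ?_, rfl⟩)
  · refine X.regularAt_finset_prod _ fun r _ => ?_
    simpa using! X.regularAt_finset_prod (Finset.range (m r)) fun _ _ => ha r.1 x hx
  · refine Y.regularAt_finset_prod _ fun r _ => ?_
    simpa using! Y.regularAt_finset_prod (Finset.range (m r)) fun _ _ => hb r.2 y hy

/-- A function on a product of quasi-projective varieties that is regular at a point `p` is a
fraction near `p` whose numerator and denominator have the form `∑ aᵢ(x) bᵢ(y)` with `aᵢ` and
`bᵢ` regular near given finite sets; numerator and denominator may be chosen to vanish on a given
closed set not containing `p`. -/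
theorem exists_tensorOn_fraction {X Y : SpaceWithFunctions} (hX : X.IsQuasiProjective)
    (hY : Y.IsQuasiProjective) {S : Set X} (hS : S.Finite) {T : Set Y} (hT : T.Finite)
    {p : X.prod Y} (hpS : p.1 ∈ S) (hpT : p.2 ∈ T) {Z : Set (X.prod Y)} (hZ : IsClosed Z)
    (hp : p ∉ Z) {F : X.prod Y → ℂ} (hF : (X.prod Y).RegularAt F p) :
    ∃ (U : Set X) (V : Set Y), IsOpen U ∧ IsOpen V ∧ S ⊆ U ∧ T ⊆ V ∧
      ∃ a ∈ tensorOn U V, ∃ b ∈ tensorOn U V, b p ≠ 0 ∧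
        ∀ q : X.prod Y, q.1 ∈ U → q.2 ∈ V → a q = F q * b q ∧ (q ∈ Z → b q = 0) := by
  obtain ⟨ι, _, e, he⟩ := hX
  obtain ⟨κ, _, e', he'⟩ := hY
  -- The Segre embedding puts X × Y in a single projective space, where F is a quotient P/Q of forms
  -- of equal degree on a neighbourhood O of p.
  have hm := isImmersion_segre.comp (isImmersion_prodMap he he')
  set m : X.prod Y → projectiveSpace (ι × κ) := segre ∘ fun p : X.prod Y => (e p.1, e' p.2)
    with hmdef
  obtain ⟨F', ⟨d, P, Q, hP, hQ, hpQ, hF'⟩, hFF'⟩ := (hm.regularAt_iff F p).1 hF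
  have hO : ∀ᶠ q in 𝓝 p, F q = MvPolynomial.eval (Projectivization.rep (m q)) P /
      MvPolynomial.eval (Projectivization.rep (m q)) Q ∧
      MvPolynomial.eval (Projectivization.rep (m q)) Q ≠ 0 := by
    filter_upwards [hFF', hm.isEmbedding.continuous.continuousAt.eventually hF',
      hm.isEmbedding.continuous.continuousAt.eventually (eventually_eval_ne_zero hQ hpQ)]
      with q h1 h2 h3
    exact ⟨h1.trans h2, h3⟩
  obtain ⟨O, hOsub, hOo, hpO⟩ := mem_nhds_iff.1 hO
  -- The closed set C cuts out Z ∪ Oᶜ. A form M that vanishes on C but not at p will multiply P and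
  -- Q: the identity a = F b then holds outside O as well, where both sides are zero, and b vanishes
  -- on Z.
  obtain ⟨C, hC, hCZ⟩ := hm.isEmbedding.isInducing.isClosed_iff.1
    (hZ.union hOo.isClosed_compl)
  have hmemC : ∀ q, m q ∈ C ↔ q ∈ Z ∪ Oᶜ := fun q => Set.ext_iff.1 hCZ q
  obtain ⟨D, M, hM, hpM, hMC⟩ := exists_isHomogeneous_separating hC (x := m p)
    (by rw [hmemC]; rintro (h | h); exacts [hp h, h hpO])
  -- Coordinates are made into functions by dividing by linear forms L and L' without zeros on the
  -- given finite sets. This makes them regular near all of `S` and `T`, not only near p.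
  obtain ⟨L, hL, hLS⟩ := exists_linear_ne_zero (hS.image e)
  obtain ⟨L', hL', hLT⟩ := exists_linear_ne_zero (hT.image e')
  let u : ι → X → ℂ := fun i x => MvPolynomial.eval (Projectivization.rep (e x)) (MvPolynomial.X i) /
    MvPolynomial.eval (Projectivization.rep (e x)) L
  let w : κ → Y → ℂ := fun i x => MvPolynomial.eval (Projectivization.rep (e' x)) (MvPolynomial.X i) /
    MvPolynomial.eval (Projectivization.rep (e' x)) L'
  let z : X.prod Y → ι × κ → ℂ := fun q r => u r.1 q.1 * w r.2 q.2
  let U : Set X := {x | MvPolynomial.eval (Projectivization.rep (e x)) L ≠ 0}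
  let V : Set Y := {x | MvPolynomial.eval (Projectivization.rep (e' x)) L' ≠ 0}
  -- The products of the normalized coordinates are homogeneous coordinates of the Segre point. The
  -- forms PM and QM have the same degree, so the scalar c enters numerator and denominator with the
  -- same power.
  have hz : ∀ q : X.prod Y, q.1 ∈ U → q.2 ∈ V →
      ∃ c : ℂ, c ≠ 0 ∧ z q = c • Projectivization.rep (m q) := by
    intro q hq hq'
    obtain ⟨c, hc, hrep⟩ := exists_rep_segre
      ((e q.1, e' q.2) : (projectiveSpace ι).prod (projectiveSpace κ))
    refine ⟨(c * MvPolynomial.eval (Projectivization.rep (e q.1)) L *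
      MvPolynomial.eval (Projectivization.rep (e' q.2)) L')⁻¹,
      inv_ne_zero (mul_ne_zero (mul_ne_zero hc hq) hq'), ?_⟩
    have hq1 : MvPolynomial.eval (Projectivization.rep (e q.1)) L ≠ 0 := hq
    have hq2 : MvPolynomial.eval (Projectivization.rep (e' q.2)) L' ≠ 0 := hq'
    rw [show m q = segre ((e q.1, e' q.2) : (projectiveSpace ι).prod (projectiveSpace κ)) from rfl,
      hrep]
    ext r
    simp only [z, u, w, MvPolynomial.eval_X, Pi.smul_apply, smul_eq_mul]
    field_simp
  have hu : ∀ i, ∀ x ∈ U, X.RegularAt (u i) x := fun i x hx =>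
    he.isMorphism.regularAt_comp _ x ⟨1, MvPolynomial.X i, L, MvPolynomial.isHomogeneous_X _ _, hL,
      hx, Eventually.of_forall fun _ => rfl⟩
  have hw : ∀ i, ∀ x ∈ V, Y.RegularAt (w i) x := fun i x hx =>
    he'.isMorphism.regularAt_comp _ x ⟨1, MvPolynomial.X i, L', MvPolynomial.isHomogeneous_X _ _,
      hL', hx, Eventually.of_forall fun _ => rfl⟩
  have hSU : S ⊆ U := fun x hx => hLS _ ⟨x, hx, rfl⟩
  have hTV : T ⊆ V := fun x hx => hLT _ ⟨x, hx, rfl⟩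
  refine ⟨U, V, ?_, ?_, hSU, hTV, _, eval_mul_mem_tensorOn hu hw (P * M), _,
    eval_mul_mem_tensorOn hu hw (Q * M), ?_, fun q hq hq' => ?_⟩
  · exact isOpen_iff_mem_nhds.2 fun x hx =>
      he.isEmbedding.continuous.continuousAt.eventually (eventually_eval_ne_zero hL hx)
  · exact isOpen_iff_mem_nhds.2 fun x hx =>
      he'.isEmbedding.continuous.continuousAt.eventually (eventually_eval_ne_zero hL' hx)
  · obtain ⟨c, hc, hzp⟩ := hz p (hSU hpS) (hTV hpT)
    change MvPolynomial.eval (z p) (Q * M) ≠ 0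
    rw [hzp, eval_smul_of_isHomogeneous (hQ.mul hM), map_mul]
    exact mul_ne_zero (pow_ne_zero _ hc) (mul_ne_zero hpQ hpM)
  · obtain ⟨c, hc, hzq⟩ := hz q hq hq'
    change MvPolynomial.eval (z q) (P * M) = F q * MvPolynomial.eval (z q) (Q * M) ∧
      (q ∈ Z → MvPolynomial.eval (z q) (Q * M) = 0)
    rw [hzq, eval_smul_of_isHomogeneous (hQ.mul hM), eval_smul_of_isHomogeneous (hP.mul hM),
      map_mul, map_mul]
    refine ⟨?_, fun hqZ => ?_⟩
    · by_cases hqO : q ∈ O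
      · obtain ⟨h1, h2⟩ := hOsub hqO
        rw [h1]
        field_simp
      · rw [hMC _ ((hmemC q).2 (Or.inr hqO))]
        simp
    · rw [hMC _ ((hmemC q).2 (Or.inl hqZ))]
      simp

/-- The case of one factor of `exists_tensorOn_fraction`. -/
theorem exists_fraction {X : SpaceWithFunctions} (hX : X.IsQuasiProjective) {S : Set X}
    (hS : S.Finite) {p : X} (hpS : p ∈ S) {Z : Set X} (hZ : IsClosed Z) (hp : p ∉ Z) {F : X → ℂ}
    (hF : X.RegularAt F p) :
    ∃ U : Set X, IsOpen U ∧ S ⊆ U ∧ ∃ a b : X → ℂ, (∀ x ∈ U, X.RegularAt a x) ∧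
      (∀ x ∈ U, X.RegularAt b x) ∧ b p ≠ 0 ∧
        ∀ q ∈ U, a q = F q * b q ∧ (q ∈ Z → b q = 0) := by
  have hfst := isMorphism_fst X point
  obtain ⟨U, V, hU, hV, hSU, hTV, a, ha, b, hb, hbp, h⟩ := exists_tensorOn_fraction hX
    isQuasiProjective_point hS (Set.finite_singleton ()) (p := (p, ())) hpS rfl
    (hZ.preimage hfst.continuous) hp (F := F ∘ Prod.fst) (hfst.regularAt_comp F _ hF)
  have hV : () ∈ V := hTV rfl
  have key : ∀ a ∈ tensorOn U V, ∀ x ∈ U, X.RegularAt (fun x => a (x, ())) x := by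
    intro a ha x hx
    induction ha using Submodule.span_induction with
    | mem h hh =>
      obtain ⟨α, β, hα, -, rfl⟩ := hh
      exact X.regularAt_mul (hα x hx) (X.regularAt_const (β ()) x)
    | zero => exact X.regularAt_const 0 x
    | add f g _ _ hf hg => exact X.regularAt_add hf hg
    | smul c f _ hf => exact X.regularAt_mul (X.regularAt_const c x) hf
  exact ⟨U, hU, hSU, _, _, key a ha, key b hb, hbp, fun q hq => h (q, ()) hq hV⟩

end SpaceWithFunctions

/-! ### Quotients by finite groups -/

namespace GVariety

instance (V : GVariety) : ContinuousConstSMul V.G V.X.space :=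
  ⟨fun g => (V.isMorphism_smul g).continuous⟩

instance (V : GVariety) : T1Space V.X.space := V.X.isQuasiProjective.t1Space

/-- The quotient map. -/
def quotientMk (V : GVariety) (x : V.X.space) : V.quotientSpace :=
  Quotient.mk (MulAction.orbitRel V.G V.X.space) x

theorem quotientMk_surjective (V : GVariety) : Function.Surjective V.quotientMk :=
  Quotient.mk_surjective

theorem quotientMk_eq_iff {V : GVariety} {x y : V.X.space} :
    V.quotientMk x = V.quotientMk y ↔ ∃ g : V.G, g • y = x :=
  Quotient.eq (r := MulAction.orbitRel V.G V.X.space)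

theorem quotientMk_smul (V : GVariety) (g : V.G) (x : V.X.space) :
    V.quotientMk (g • x) = V.quotientMk x :=
  quotientMk_eq_iff.2 ⟨g, rfl⟩

theorem isMorphism_quotientMk (V : GVariety) : IsMorphism V.quotientMk :=
  SpaceWithFunctions.isMorphism_quotient_mk _ _

theorem isOpenQuotientMap_quotientMk (V : GVariety) : IsOpenQuotientMap V.quotientMk :=
  MulAction.isOpenQuotientMap_quotientMk (Γ := V.G) (T := V.X.space)

/-- The orbit is finite and points are closed. Denominators are made to vanish on this set so that
`sum_smul_ne_zero` applies. -/
theorem isClosed_orbit_diff (V : GVariety) (x : V.X.space) :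
    IsClosed {y | (∃ g : V.G, g • x = y) ∧ y ≠ x} :=
  ((Set.finite_range fun g : V.G => g • x).subset fun _ hy => hy.1).isClosed

/-- The intersection of the finitely many translates of U is open and contains the orbit of x. Its
image in the quotient is open because the quotient map is open. -/
theorem exists_isOpen_invariant (V : GVariety) {x : V.X.space} {U : Set V.X.space} (hU : IsOpen U)
    (hx : ∀ g : V.G, g • x ∈ U) : ∃ U' : Set V.quotientSpace, IsOpen U' ∧ V.quotientMk x ∈ U' ∧
      ∀ y, V.quotientMk y ∈ U' → ∀ g : V.G, g • y ∈ U := by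
  refine ⟨V.quotientMk '' ⋂ g : V.G, (fun y => g • y) ⁻¹' U, 
    V.isOpenQuotientMap_quotientMk.isOpenMap _
    (isOpen_iInter_of_finite fun g => hU.preimage (continuous_const_smul g)),
    ⟨x, Set.mem_iInter.2 hx, rfl⟩, ?_⟩
  rintro y ⟨z, hz, hzy⟩ g
  obtain ⟨h, rfl⟩ := quotientMk_eq_iff.1 hzy
  have := Set.mem_iInter.1 hz (g * h⁻¹)
  simpa [mul_smul] using this

open Classical in
instance (V : GVariety) : Fintype V.G := Fintype.ofFinite V.G

/-- The sum of the translates of a function, as a function on the quotient. -/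
def orbitSum (V : GVariety) (a : V.X.space → ℂ) : V.quotientSpace → ℂ :=
  Quotient.lift (s := MulAction.orbitRel V.G V.X.space) (fun x => ∑ g : V.G, a (g • x)) (by
    rintro x y ⟨g, rfl⟩
    exact sum_smul_smul a g y)

theorem orbitSum_quotientMk (V : GVariety) (a : V.X.space → ℂ) (x : V.X.space) :
    V.orbitSum a (V.quotientMk x) = ∑ g : V.G, a (g • x) := rfl

/-- The summands involve `a` near every translate of x, so `a` has to be regular near the whole
orbit; near the orbit of x, all translates of a point stay in U. -/
theorem regularAt_orbitSum (V : GVariety) {a : V.X.space → ℂ} {U : Set V.X.space} (hU : IsOpen U)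
    (ha : ∀ x ∈ U, V.X.space.RegularAt a x) {x : V.X.space} (hx : ∀ g : V.G, g • x ∈ U) :
    V.quotientSpace.RegularAt (V.orbitSum a) (V.quotientMk x) := by
  obtain ⟨U', hU', hxU', h⟩ := V.exists_isOpen_invariant hU hx
  refine eventually_nhds_iff.2 ⟨U', ?_, hU', hxU'⟩
  rintro q hq y rfl
  exact V.X.space.regularAt_finset_sum _ fun g _ =>
    (V.isMorphism_smul g).regularAt_comp a y (ha _ (h y hq g))

/-- The quotient of a locally closed invariant subvariety is a locally closed subspace of the
quotient. -/
theorem isImmersion_quotient_sub (V : GVariety) {s : Set V.X.space} (hs : IsLocallyClosed s)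
    (hG : ∀ (g : V.G), ∀ x ∈ s, g • x ∈ s) :
    ∃ j : (V.sub s hs hG).quotientSpace → V.quotientSpace, IsImmersion j ∧
      (∀ x, j ((V.sub s hs hG).quotientMk x) = V.quotientMk x.1) ∧
        Set.range j = V.quotientMk '' s := by
  set W := V.sub s hs hG with hW
  let j : W.quotientSpace → V.quotientSpace :=
    Quotient.lift (s := MulAction.orbitRel W.G W.X.space) (fun x => V.quotientMk x.1) (by
      rintro x y ⟨g, rfl⟩
      exact V.quotientMk_smul g y.1)
  have hj : ∀ x, j (W.quotientMk x) = V.quotientMk x.1 := fun x => rfl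
  have hjm : IsMorphism j := SpaceWithFunctions.isMorphism_quotient_iff.2
    (V.isMorphism_quotientMk.comp (V.X.space.isMorphism_val s))
  have hinj : Function.Injective j := by
    intro p q h
    obtain ⟨x, rfl⟩ := W.quotientMk_surjective p
    obtain ⟨y, rfl⟩ := W.quotientMk_surjective q
    obtain ⟨g, hg⟩ := quotientMk_eq_iff.1 h
    exact quotientMk_eq_iff.2 ⟨g, Subtype.ext hg⟩
  have hrange : Set.range j = V.quotientMk '' s := by
    ext q
    constructor
    · rintro ⟨p, rfl⟩
      obtain ⟨x, rfl⟩ := W.quotientMk_surjective p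
      exact ⟨x.1, x.2, rfl⟩
    · rintro ⟨x, hx, rfl⟩
      exact ⟨W.quotientMk ⟨x, hx⟩, rfl⟩
  have hpre : V.quotientMk ⁻¹' (V.quotientMk '' s) = s := by
    refine Set.Subset.antisymm ?_ (Set.subset_preimage_image _ _)
    rintro x ⟨y, hy, hxy⟩
    obtain ⟨g, rfl⟩ := quotientMk_eq_iff.1 hxy
    have := hG g⁻¹ _ hy
    rwa [inv_smul_smul] at this
  -- A set is locally closed when its coborder is open. Taking closures commutes with preimages
  -- under the open continuous quotient map, and s is saturated, so the coborder of the image pulls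
  -- back to the coborder of s.
  have hlc : IsLocallyClosed (V.quotientMk '' s) := by
    rw [isLocallyClosed_iff_isOpen_coborder,
      ← V.isOpenQuotientMap_quotientMk.isQuotientMap.isOpen_preimage]
    have : V.quotientMk ⁻¹' coborder (V.quotientMk '' s) = coborder s := by
      rw [coborder, coborder, Set.preimage_compl, Set.preimage_sdiff,
        V.isOpenQuotientMap_quotientMk.isOpenMap.preimage_closure_eq_closure_preimage
          V.isOpenQuotientMap_quotientMk.continuous, hpre]
    rw [this]
    exact hs.isOpen_coborder
  -- The preimage in s of an open set O of the quotient of s is the trace of an open set U of X. The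
  -- image of U in X/G is open, and it pulls back into O because that preimage is invariant.
  have hind : IsInducing j := by
    refine isInducing_iff_nhds.2 fun p => le_antisymm
      (tendsto_iff_comap.1 hjm.continuous.continuousAt) fun t ht => ?_
    obtain ⟨O, hOt, hO, hpO⟩ := mem_nhds_iff.1 ht
    obtain ⟨U, hU, hUO⟩ := isOpen_induced_iff.1
      (hO.preimage W.isOpenQuotientMap_quotientMk.continuous)
    obtain ⟨x, rfl⟩ := W.quotientMk_surjective p
    have hxU : x.1 ∈ U := by
      have : x ∈ Subtype.val ⁻¹' U := hUO ▸ hpO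
      exact this
    refine mem_comap.2 ⟨V.quotientMk '' U, (V.isOpenQuotientMap_quotientMk.isOpenMap U hU).mem_nhds
      ⟨x.1, hxU, rfl⟩, ?_⟩
    rintro q ⟨u, hu, huq⟩
    obtain ⟨y, rfl⟩ := W.quotientMk_surjective q
    obtain ⟨g, hg⟩ := quotientMk_eq_iff.1 huq
    refine hOt ?_
    have h1 : (show W.G from g) • y ∈ W.quotientMk ⁻¹' O := by
      rw [← hUO]
      exact (show g • y.1 ∈ U from hg ▸ hu)
    have h2 : W.quotientMk ((show W.G from g) • y) ∈ O := h1
    rwa [W.quotientMk_smul] at h2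
  refine ⟨j, ⟨⟨hind, hinj⟩, hrange ▸ hlc, fun f p => ⟨fun hf => ?_, ?_⟩⟩, hj, hrange⟩
  · obtain ⟨x, rfl⟩ := W.quotientMk_surjective p
    -- The pull-back of f agrees on s ∩ O with a function F that is regular on X at x. F need not be
    -- invariant, so it is written as a/b and averaged. The denominator vanishes outside O, where F
    -- is unrelated to f, and at the other points of the orbit.
    obtain ⟨F, hF, hfF⟩ := W.isMorphism_quotientMk.regularAt_comp f x hf
    obtain ⟨O', hO', hO'o, hxO'⟩ := eventually_nhds_iff.1 hfF
    obtain ⟨O, hO, rfl⟩ := isOpen_induced_iff.1 hO'o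
    obtain ⟨U, hU, hSU, a, b, ha, hb, hbx, hab⟩ := SpaceWithFunctions.exists_fraction
      V.X.isQuasiProjective (Set.finite_range fun g : V.G => g • x.1) (p := x.1)
      ⟨1, one_smul _ _⟩ (hO.isClosed_compl.union (V.isClosed_orbit_diff x.1))
      (by rintro (h | h); exacts [h hxO', h.2 rfl]) hF
    have hxU : ∀ g : V.G, g • x.1 ∈ U := fun g => hSU ⟨g, rfl⟩
    have hB0 : V.orbitSum b (V.quotientMk x.1) ≠ 0 := by
      refine sum_smul_ne_zero hbx fun g hg => ?_
      exact (hab _ (hxU g)).2 (Or.inr ⟨⟨g, rfl⟩, hg⟩)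
    have hA := V.regularAt_orbitSum hU ha hxU
    have hB := V.regularAt_orbitSum hU hb hxU
    refine ⟨_, V.quotientSpace.regularAt_div hA hB hB0, ?_⟩
    obtain ⟨U', hU', hxU', hUU'⟩ := V.exists_isOpen_invariant hU hxU
    filter_upwards [hjm.continuous.continuousAt.eventually (hU'.mem_nhds hxU'),
      hjm.continuous.continuousAt.eventually (V.quotientSpace.eventually_ne_zero hB hB0)]
      with q h1 h2
    obtain ⟨y, rfl⟩ := W.quotientMk_surjective q
    rw [eq_div_iff h2, hj, orbitSum_quotientMk, orbitSum_quotientMk, Finset.mul_sum]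
    refine Finset.sum_congr rfl fun g _ => ?_
    obtain ⟨e1, e2⟩ := hab _ (hUU' y.1 h1 g)
    -- For a translate in O, the value of F is f at the class of y, by invariance. For the others,
    -- both a and b vanish.
    by_cases hgO : g • y.1 ∈ O
    · have h3 : f (W.quotientMk ((show W.G from g) • y)) = F (g • y.1) :=
        hO' ((show W.G from g) • y) hgO
      rw [W.quotientMk_smul] at h3
      rw [e1, h3]
    · rw [e1, e2 (Or.inl hgO), mul_zero, mul_zero]
  · rintro ⟨F, hF, hz⟩
    exact W.quotientSpace.regularAt_congr (hz.mono fun z hz => hz.symm)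
      (hjm.regularAt_comp F p hF)

/-- Isomorphic varieties with actions have isomorphic quotients. -/
def quotientIso {V W : GVariety} (e : Iso V W) :
    MotivicEuler.Iso V.quotientSpace W.quotientSpace where
  toFun := Quotient.map e.ψ.toFun (by
    rintro x y ⟨g, rfl⟩
    exact ⟨e.φ g, (e.map_smul g y).symm⟩)
  invFun := Quotient.map e.ψ.invFun (by
    rintro x y ⟨g, rfl⟩
    exact ⟨e.φ.symm g, (e.symm.map_smul g y).symm⟩)
  left_inv := by
    rintro ⟨x⟩
    exact congrArg V.quotientMk (e.ψ.left_inv x)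
  right_inv := by
    rintro ⟨x⟩
    exact congrArg W.quotientMk (e.ψ.right_inv x)
  isMorphism_toFun := SpaceWithFunctions.isMorphism_quotient_iff.2
    (W.isMorphism_quotientMk.comp e.ψ.isMorphism_toFun)
  isMorphism_invFun := SpaceWithFunctions.isMorphism_quotient_iff.2
    (V.isMorphism_quotientMk.comp e.ψ.isMorphism_invFun)

/-! ### The quotient of a product -/

section Prod

open SpaceWithFunctions

variable (V W : GVariety)

/-- A pair of points as a point of the product. -/
abbrev pair {V W : GVariety} (x : V.X.space) (y : W.X.space) : (V.prod W).X.space := (x, y)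

/-- The map from the product of the quotients to the quotient of the product. -/
def quotientProdInv (q : V.quotientSpace.prod W.quotientSpace) : (V.prod W).quotientSpace :=
  Quotient.map₂ (sa := MulAction.orbitRel V.G V.X.space) (sb := MulAction.orbitRel W.G W.X.space)
    (sc := MulAction.orbitRel (V.prod W).G (V.prod W).X.space) (fun x y => (x, y))
    (by
      rintro _ x ⟨g, rfl⟩ _ y ⟨h, rfl⟩
      exact ⟨(g, h), rfl⟩) q.1 q.2

/-- The sum of the translates of a function on a product, as a function on the product of the
quotients. -/
def prodOrbitSum (a : V.X.space × W.X.space → ℂ) : V.quotientSpace × W.quotientSpace → ℂ :=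
  fun q => (V.prod W).orbitSum a (V.quotientProdInv W q)

theorem prodOrbitSum_quotientMk (a : V.X.space × W.X.space → ℂ) (x : V.X.space) (y : W.X.space) :
    V.prodOrbitSum W a (V.quotientMk x, W.quotientMk y) =
      ∑ g : V.G, ∑ h : W.G, a (g • x, h • y) := by
  rw [← Fintype.sum_prod_type' fun (g : V.G) (h : W.G) => a (g • x, h • y)]
  exact Fintype.sum_equiv (ι := (V.prod W).G) (Equiv.refl (V.G × W.G))
    (fun g : V.G × W.G => a (g.1 • x, g.2 • y)) (fun g : V.G × W.G => a (g.1 • x, g.2 • y)) fun _ => rfl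

variable {V W}

theorem prodOrbitSum_ext {f f' : V.quotientSpace × W.quotientSpace → ℂ}
    (h : ∀ x y, f (V.quotientMk x, W.quotientMk y) = f' (V.quotientMk x, W.quotientMk y)) :
    f = f' := by
  ext ⟨p, q⟩
  obtain ⟨x, rfl⟩ := V.quotientMk_surjective p
  obtain ⟨y, rfl⟩ := W.quotientMk_surjective q
  exact h x y

/-- The sum of α(gx)β(hy) over all (g, h) is the product of the orbit sums of α and β, and averaging
is linear. -/
theorem prodOrbitSum_mem_tensorFunctions {a : V.X.space × W.X.space → ℂ} {U : Set V.X.space}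
    {U' : Set W.X.space} (hU : IsOpen U) (hU' : IsOpen U') (ha : a ∈ tensorOn U U')
    {x : V.X.space} {y : W.X.space} (hx : ∀ g : V.G, g • x ∈ U) (hy : ∀ g : W.G, g • y ∈ U') :
    V.prodOrbitSum W a ∈
      tensorFunctions V.quotientSpace W.quotientSpace (V.quotientMk x, W.quotientMk y) := by
  induction ha using Submodule.span_induction with
  | mem a h =>
    obtain ⟨α, β, hα, hβ, rfl⟩ := h
    have : V.prodOrbitSum W (fun q => α q.1 * β q.2) =
        (V.orbitSum α ∘ Prod.fst) * (W.orbitSum β ∘ Prod.snd) := by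
      refine prodOrbitSum_ext fun x y => ?_
      rw [prodOrbitSum_quotientMk]
      exact (Finset.sum_mul_sum Finset.univ Finset.univ (fun g : V.G => α (g • x))
        fun g : W.G => β (g • y)).symm
    rw [this]
    exact mul_mem (fst_mem_tensorFunctions (V.regularAt_orbitSum hU hα hx))
      (snd_mem_tensorFunctions (W.regularAt_orbitSum hU' hβ hy))
  | zero =>
    have : V.prodOrbitSum W 0 = 0 := prodOrbitSum_ext fun x y => by
      simp [prodOrbitSum_quotientMk]
    rw [this]
    exact zero_mem _
  | add a b _ _ ha hb =>
    have : V.prodOrbitSum W (a + b) = V.prodOrbitSum W a + V.prodOrbitSum W b :=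
      prodOrbitSum_ext fun x y => by
        simp only [Pi.add_apply, prodOrbitSum_quotientMk, Finset.sum_add_distrib]
    rw [this]
    exact add_mem ha hb
  | smul c a _ ha =>
    have : V.prodOrbitSum W (c • a) = c • V.prodOrbitSum W a :=
      prodOrbitSum_ext fun x y => by
        simp only [Pi.smul_apply, prodOrbitSum_quotientMk, Finset.smul_sum]
    rw [this]
    exact Subalgebra.smul_mem _ ha c

/-- The topology and the functions on a product are defined by tensor functions, so both must be
recovered on X/G × Y/H from (X × Y)/(G × H). A fraction with tensor numerator and denominator is
averaged. The denominator vanishes on the preimage of Oᶜ, so b(q) ≠ 0 forces the image of q into O,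
and at the other points of the orbit, so its average is nonzero at the given point. -/
theorem exists_tensorFunctions_fraction (x : V.X.space) (y : W.X.space)
    {O : Set (V.prod W).quotientSpace} (hO : IsOpen O) (hxy : (V.prod W).quotientMk (pair x y) ∈ O)
    {f : (V.prod W).quotientSpace → ℂ}
    (hf : (V.prod W).quotientSpace.RegularAt f ((V.prod W).quotientMk (pair x y))) :
    ∃ a ∈ tensorFunctions V.quotientSpace W.quotientSpace (V.quotientMk x, W.quotientMk y),
      ∃ b ∈ tensorFunctions V.quotientSpace W.quotientSpace (V.quotientMk x, W.quotientMk y),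
        b (V.quotientMk x, W.quotientMk y) ≠ 0 ∧
        ∀ᶠ q in @nhds _ (prodTopology V.quotientSpace W.quotientSpace) (V.quotientMk x, W.quotientMk y),
          b q ≠ 0 ∧ a q = f (V.quotientProdInv W q) * b q ∧ V.quotientProdInv W q ∈ O := by
  obtain ⟨U, U', hU, hU', hSU, hSU', a, ha, b, hb, hbp, hab⟩ := exists_tensorOn_fraction
    V.X.isQuasiProjective W.X.isQuasiProjective (Set.finite_range fun g : V.G => g • x)
    (Set.finite_range fun g : W.G => g • y) (p := pair x y) ⟨1, one_smul _ _⟩ ⟨1, one_smul _ _⟩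
    (Z := (V.prod W).quotientMk ⁻¹' Oᶜ ∪ {q | (∃ g : (V.prod W).G, g • pair x y = q) ∧ q ≠ pair x y})
    ((hO.isClosed_compl.preimage (V.prod W).isMorphism_quotientMk.continuous).union
      ((V.prod W).isClosed_orbit_diff (pair x y)))
    (by rintro (h | h); exacts [h hxy, h.2 rfl])
    ((V.prod W).isMorphism_quotientMk.regularAt_comp f (pair x y) hf)
  have hxU : ∀ g : V.G, g • x ∈ U := fun g => hSU ⟨g, rfl⟩
  have hyU : ∀ g : W.G, g • y ∈ U' := fun g => hSU' ⟨g, rfl⟩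
  obtain ⟨T, hT, hxT, hUT⟩ := V.exists_isOpen_invariant hU hxU
  obtain ⟨T', hT', hyT', hUT'⟩ := W.exists_isOpen_invariant hU' hyU
  have hA := prodOrbitSum_mem_tensorFunctions hU hU' ha hxU hyU
  have hB := prodOrbitSum_mem_tensorFunctions hU hU' hb hxU hyU
  have hB0 : V.prodOrbitSum W b (V.quotientMk x, W.quotientMk y) ≠ 0 := by
    refine sum_smul_ne_zero (G := (V.prod W).G) (x := pair x y) hbp fun g hg => ?_
    exact (hab _ (hxU g.1) (hyU g.2)).2 (Or.inr ⟨⟨g, rfl⟩, hg⟩)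
  refine ⟨_, hA, _, hB, hB0, ?_⟩
  filter_upwards [eventually_prod_ne_zero hB hB0,
    eventually_prod (P := fun q => q.1 ∈ T ∧ q.2 ∈ T') (one_mem _) hT hT' hxT hyT' one_ne_zero
      fun q h1 h2 _ => ⟨h1, h2⟩] with q h1 h2
  obtain ⟨p, q⟩ := q
  obtain ⟨x', rfl⟩ := V.quotientMk_surjective p
  obtain ⟨y', rfl⟩ := W.quotientMk_surjective q
  refine ⟨h1, ?_, ?_⟩
  · change ∑ g : (V.prod W).G, _ = f ((V.prod W).quotientMk (pair x' y')) * ∑ g : (V.prod W).G, _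
    rw [Finset.mul_sum]
    refine Finset.sum_congr rfl fun g _ => ?_
    have h3 := (hab (g • pair x' y') (hUT x' h2.1 g.1) (hUT' y' h2.2 g.2)).1
    rwa [Function.comp_apply, (V.prod W).quotientMk_smul] at h3
  · by_contra hn
    refine h1 (Finset.sum_eq_zero fun g _ => ?_)
    refine (hab (g • pair x' y') (hUT x' h2.1 g.1) (hUT' y' h2.2 g.2)).2
      (Or.inl ?_)
    change (V.prod W).quotientMk (g • pair x' y') ∉ O
    rwa [(V.prod W).quotientMk_smul]

variable (V W)

theorem isMorphism_quotientProdInv : IsMorphism (V.quotientProdInv W) := by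
  have hc : Continuous (V.quotientProdInv W) := by
    refine continuous_iff_continuousAt.2 ?_
    rintro ⟨p, q⟩ s hs
    obtain ⟨O, hOs, hO, hp⟩ := mem_nhds_iff.1 hs
    obtain ⟨x, rfl⟩ := V.quotientMk_surjective p
    obtain ⟨y, rfl⟩ := W.quotientMk_surjective q
    -- Continuity uses only the condition on O, so the zero function serves as f; for regularity
    -- below, f is given and O is everything.
    obtain ⟨_, _, _, _, _, h⟩ := exists_tensorFunctions_fraction x y hO hp
      ((V.prod W).quotientSpace.regularAt_const 0 _)
    exact h.mono fun q hq => hOs hq.2.2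
  refine ⟨hc, ?_⟩
  rintro f ⟨p, q⟩ hf
  obtain ⟨x, rfl⟩ := V.quotientMk_surjective p
  obtain ⟨y, rfl⟩ := W.quotientMk_surjective q
  obtain ⟨a, ha, b, hb, hb0, h⟩ := exists_tensorFunctions_fraction x y isOpen_univ trivial hf
  exact ⟨a, ha, b, hb, hb0, h.mono fun q hq => (eq_div_iff hq.1).2 hq.2.1.symm⟩

/-- The quotient of a product by a product of groups is the product of the quotients. -/
def quotientProdIso :
    MotivicEuler.Iso (V.prod W).quotientSpace (V.quotientSpace.prod W.quotientSpace) where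
  toFun := Quotient.lift (s := MulAction.orbitRel (V.prod W).G (V.prod W).X.space)
    (fun p => (V.quotientMk p.1, W.quotientMk p.2)) (by
      rintro _ p ⟨g, rfl⟩
      exact Prod.ext (V.quotientMk_smul g.1 p.1) (W.quotientMk_smul g.2 p.2))
  invFun := V.quotientProdInv W
  left_inv := by
    rintro ⟨p⟩
    rfl
  right_inv := by
    rintro ⟨p, q⟩
    obtain ⟨x, rfl⟩ := V.quotientMk_surjective p
    obtain ⟨y, rfl⟩ := W.quotientMk_surjective q
    rfl
  isMorphism_toFun := isMorphism_quotient_iff.2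
    (isMorphism_prodMap V.isMorphism_quotientMk W.isMorphism_quotientMk)
  isMorphism_invFun := V.isMorphism_quotientProdInv W

end Prod

end GVariety

/-! ### Invariant polynomials of a permutation group -/

section Invariants

variable {ι : Type}

/-- The polynomials that are invariant under permutations of the variables by a group. -/
def invariants (G ι : Type) [Group G] [MulAction G ι] : Subalgebra ℂ (MvPolynomial ι ℂ) where
  carrier := {P | ∀ g : G, MvPolynomial.rename (g • ·) P = P}
  mul_mem' ha hb g := by rw [map_mul, ha g, hb g]
  add_mem' ha hb g := by rw [map_add, ha g, hb g]
  algebraMap_mem' c g := by simp [MvPolynomial.algebraMap_eq]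

variable {G : Type} [Group G] [MulAction G ι]

/-- Permuting the variables preserves degrees, hence commutes with taking homogeneous components. -/
theorem homogeneousComponent_mem_invariants {P : MvPolynomial ι ℂ} (hP : P ∈ invariants G ι)
    (n : ℕ) : MvPolynomial.homogeneousComponent n P ∈ invariants G ι := by
  intro g
  conv_rhs => rw [← hP g]
  have h : MvPolynomial.rename (g • ·) P = ∑ i ∈ Finset.range (P.totalDegree + 1),
      MvPolynomial.rename (g • ·) (MvPolynomial.homogeneousComponent i P) := by
    rw [← map_sum, MvPolynomial.sum_homogeneousComponent]
  rw [h, map_sum]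
  have h2 : ∀ i, MvPolynomial.homogeneousComponent n (MvPolynomial.rename (g • ·)
      (MvPolynomial.homogeneousComponent i P)) =
        if i = n then MvPolynomial.rename (g • ·) (MvPolynomial.homogeneousComponent i P)
          else 0 := fun i => by
    have h3 : (MvPolynomial.rename (g • ·) (MvPolynomial.homogeneousComponent i P)).IsHomogeneous i :=
      (MvPolynomial.homogeneousComponent_isHomogeneous i P).rename_isHomogeneous
    rw [MvPolynomial.homogeneousComponent_of_mem h3]
    simp only [eq_comm]
  simp only [h2]
  rw [Finset.sum_ite_eq']
  split_ifs with hn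
  · rfl
  · rw [MvPolynomial.homogeneousComponent_eq_zero _ _ (by simpa using hn), map_zero]

theorem sum_rename_mem_invariants [Fintype G] (P : MvPolynomial ι ℂ) :
    ∑ g : G, MvPolynomial.rename (g • ·) P ∈ invariants G ι := by
  intro h
  rw [map_sum]
  refine Fintype.sum_equiv (Equiv.mulLeft h) _ _ fun g => ?_
  rw [MvPolynomial.rename_rename]
  congr 2
  ext i
  exact (mul_smul h g i).symm

/-- The action of a group on polynomials by permutations of the variables. -/
@[reducible] def renameAction (G ι : Type) [Group G] [MulAction G ι] :
    MulSemiringAction G (MvPolynomial ι ℂ) where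
  smul g P := MvPolynomial.rename (g • ·) P
  one_smul P := by
    change MvPolynomial.rename (fun i => (1 : G) • i) P = P
    simp only [one_smul]
    exact MvPolynomial.rename_id_apply P
  mul_smul g h P := by
    change MvPolynomial.rename _ P = MvPolynomial.rename _ (MvPolynomial.rename _ P)
    rw [MvPolynomial.rename_rename]
    congr 2
    ext i
    exact mul_smul g h i
  smul_zero g := map_zero _
  smul_add g := map_add _
  smul_one g := map_one _
  smul_mul g := map_mul _

variable [Finite G]

/-- Each P is a root of the monic polynomial ∏_g (T − gP), whose coefficients are invariant. -/
theorem isIntegral_invariants : Algebra.IsIntegral (invariants G ι) (MvPolynomial ι ℂ) := by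
  let _ := renameAction G ι
  have : Algebra.IsInvariant (invariants G ι) (MvPolynomial ι ℂ) G :=
    ⟨fun P hP => ⟨⟨P, hP⟩, rfl⟩⟩
  exact Algebra.IsInvariant.isIntegral (invariants G ι) (MvPolynomial ι ℂ) G

variable [Finite ι]

/-- Noether's argument: the polynomial ring is of finite type over ℂ and integral over the
invariants, hence a finite module over them; the Artin–Tate lemma then gives finite generation of
the invariants. -/
theorem invariants_fg : (invariants G ι).FG := by
  have := isIntegral_invariants (G := G) (ι := ι)
  have h1 : Algebra.FiniteType ℂ (MvPolynomial ι ℂ) := inferInstance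
  have h2 : Algebra.FiniteType (invariants G ι) (MvPolynomial ι ℂ) :=
    .of_restrictScalars_finiteType ℂ _ _
  have h3 : Module.Finite (invariants G ι) (MvPolynomial ι ℂ) := Algebra.IsIntegral.finite
  refine (Subalgebra.fg_top _).1 (fg_of_fg_of_fg ℂ (invariants G ι) (MvPolynomial ι ℂ) h1.1 h3.1 ?_)
  exact Subtype.val_injective

end Invariants

/-! ### Monomials of given weight -/

section Weights

variable {J : Type} [Fintype J] {w : J → ℕ} {l : ℕ}

/-- Pigeonhole: if the total weight exceeds |J| · l, some index j has m_j w_j ≥ l. Taking l / w_j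
copies of j splits off weight exactly l, and this is repeated n times. It is used to factor
monomials in the generators of the invariants. -/
theorem exists_le_weight_eq (hw : ∀ j, 0 < w j) (hl : 0 < l) (hwl : ∀ j, w j ∣ l) (n : ℕ)
    (m : J → ℕ) (hm : (Fintype.card J + n) * l ≤ ∑ j, m j * w j) :
    ∃ m' ≤ m, ∑ j, m' j * w j = n * l := by
  classical
  induction n generalizing m with
  | zero => exact ⟨0, Pi.le_def.2 fun j => Nat.zero_le _, by simp⟩
  | succ n ih =>
    obtain ⟨j, hj⟩ : ∃ j, l ≤ m j * w j := by
      by_contra! h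
      have h1 : ∑ j, m j * w j ≤ ∑ _j : J, l := Finset.sum_le_sum fun j _ => (h j).le
      rw [Finset.sum_const, smul_eq_mul, Finset.card_univ] at h1
      nlinarith
    have hjl : l / w j * w j = l := Nat.div_mul_cancel (hwl j)
    have hs : Pi.single j (l / w j) ≤ m := by
      intro i
      by_cases h : i = j
      · subst h
        rw [Pi.single_eq_same]
        exact Nat.le_of_mul_le_mul_right (hjl.trans_le hj) (hw i)
      · rw [Pi.single_eq_of_ne h]
        exact Nat.zero_le _
    have hsw : ∑ i, (Pi.single j (l / w j) : J → ℕ) i * w i = l := by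
      rw [Finset.sum_eq_single j, Pi.single_eq_same, hjl]
      · intro i _ h
        rw [Pi.single_eq_of_ne h, zero_mul]
      · simp
    obtain ⟨m', hm'⟩ : ∃ m', m = Pi.single j (l / w j) + m' :=
      ⟨m - Pi.single j (l / w j), by
        ext i
        exact (Nat.add_sub_cancel' (hs i)).symm⟩
    subst hm'
    simp only [Pi.add_apply, add_mul, Finset.sum_add_distrib, hsw] at hm
    obtain ⟨m'', h1, h2⟩ := ih m' (by nlinarith)
    refine ⟨Pi.single j (l / w j) + m'', by gcongr, ?_⟩
    simp only [Pi.add_apply, add_mul, Finset.sum_add_distrib, hsw, h2]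
    ring

theorem finite_setOf_weight_eq (hw : ∀ j, 0 < w j) (d : ℕ) :
    {m : J → ℕ | ∑ j, m j * w j = d}.Finite := by
  classical
  refine (Set.finite_Icc 0 (fun _ : J => d)).subset fun m hm =>
    ⟨fun _ => Nat.zero_le _, fun j => ?_⟩
  have hm' : ∑ j, m j * w j = d := hm
  rw [← hm']
  exact (Nat.le_mul_of_pos_right _ (hw j)).trans
    (Finset.single_le_sum (f := fun j => m j * w j) (fun _ _ => Nat.zero_le _) (Finset.mem_univ j))

end Weights

/-- Invariant forms whose degree is a multiple of some `d > 0` are polynomials in finitely many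
invariant forms of degree `d`. -/
theorem exists_veronese (G ι : Type) [Group G] [MulAction G ι] [Finite G] [Finite ι] :
    ∃ (σ : Type) (_ : Fintype σ) (d : ℕ) (θ : σ → MvPolynomial ι ℂ), 0 < d ∧
      (∀ s, (θ s).IsHomogeneous d) ∧ (∀ s, θ s ∈ invariants G ι) ∧
      ∀ (k : ℕ), ∀ P ∈ invariants G ι, P.IsHomogeneous (k * d) →
        ∃ H : MvPolynomial σ ℂ, H.IsHomogeneous k ∧ MvPolynomial.aeval θ H = P := by
  classical
  obtain ⟨t, ht⟩ := invariants_fg (G := G) (ι := ι)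
  have htA : ∀ p ∈ t, p ∈ invariants G ι := fun p hp => ht ▸ Algebra.subset_adjoin hp
  let N := t.sup MvPolynomial.totalDegree
  let J := t × Fin N
  -- The homogeneous components of positive degree of the generators still generate. Constant terms
  -- are left out, so all weights are positive.
  let w : J → ℕ := fun j => j.2 + 1
  let f : J → MvPolynomial ι ℂ := fun j => MvPolynomial.homogeneousComponent (w j) j.1.1
  have hw : ∀ j, 0 < w j := fun j => Nat.succ_pos _
  have hf : ∀ j, (f j).IsHomogeneous (w j) := fun j =>
    MvPolynomial.homogeneousComponent_isHomogeneous _ _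
  have hfA : ∀ j, f j ∈ invariants G ι := fun j =>
    homogeneousComponent_mem_invariants (htA _ j.1.2) _
  have hgen : ∀ P ∈ invariants G ι, ∃ Q : MvPolynomial J ℂ, MvPolynomial.aeval f Q = P := by
    intro P hP
    have hle : invariants G ι ≤ (MvPolynomial.aeval (R := ℂ) f).range := by
      rw [← ht]
      refine Algebra.adjoin_le fun p hp => ?_
      rw [SetLike.mem_coe, ← MvPolynomial.sum_homogeneousComponent p]
      refine sum_mem fun n hn => ?_
      rcases n with _ | n
      · rw [MvPolynomial.homogeneousComponent_zero, ← MvPolynomial.algebraMap_eq]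
        exact Subalgebra.algebraMap_mem _ _
      · have hn' : n < N := by
          have h1 : p.totalDegree ≤ N := Finset.le_sup hp
          have := Finset.mem_range.1 hn
          omega
        exact ⟨MvPolynomial.X (⟨p, hp⟩, ⟨n, hn'⟩), by simp [f, w]⟩
    exact hle hP
  let l := ∏ j, w j
  have hl : 0 < l := Finset.prod_pos fun j _ => hw j
  have hwl : ∀ j, w j ∣ l := fun j => Finset.dvd_prod_of_mem _ (Finset.mem_univ j)
  -- Here l is a common multiple of the weights. A monomial of weight kd with k ≥ 2 has weight at
  -- least 2(|J| + 1)l ≥ (|J| + (|J| + 1))l, so `exists_le_weight_eq` with n = |J| + 1 gives a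
  -- divisor of weight exactly d. For k = 1 the monomial itself is taken.
  let d := (Fintype.card J + 1) * l
  have hd : 0 < d := Nat.mul_pos (Nat.succ_pos _) hl
  have hmon : ∀ m : J → ℕ, (∏ j, f j ^ m j).IsHomogeneous (∑ j, m j * w j) := fun m =>
    MvPolynomial.IsHomogeneous.prod _ _ _ fun j _ => by
      rw [mul_comm]
      exact (hf j).pow (m j)
  let σ := {m : J → ℕ // ∑ j, m j * w j = d}
  have hσ : Finite σ := (finite_setOf_weight_eq hw d).to_subtype
  let θ : σ → MvPolynomial ι ℂ := fun m => ∏ j, f j ^ m.1 j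
  have key : ∀ (k : ℕ) (m : J → ℕ), ∑ j, m j * w j = k * d →
      ∃ H : MvPolynomial σ ℂ, H.IsHomogeneous k ∧ MvPolynomial.aeval θ H = ∏ j, f j ^ m j := by
    intro k
    induction k with
    | zero =>
      intro m hm
      refine ⟨1, MvPolynomial.isHomogeneous_one _ _, ?_⟩
      rw [map_one, Finset.prod_eq_one]
      intro j hj
      have h0 := (Finset.sum_eq_zero_iff.1 (hm.trans (zero_mul d))) j hj
      rw [(mul_eq_zero.1 h0).resolve_right (hw j).ne', pow_zero]
    | succ k ih =>
      intro m hm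
      obtain ⟨m', hm', hmd⟩ : ∃ m' ≤ m, ∑ j, m' j * w j = d := by
        rcases k with _ | k
        · exact ⟨m, le_rfl, by simpa using hm⟩
        · refine exists_le_weight_eq hw hl hwl _ m ?_
          rw [hm]
          have : Fintype.card J + (Fintype.card J + 1) ≤ (k + 1 + 1) * (Fintype.card J + 1) := by
            nlinarith
          exact (Nat.mul_le_mul_right l this).trans (by rw [mul_assoc])
      obtain ⟨m'', rfl⟩ : ∃ m'', m = m' + m'' := ⟨m - m', by
        ext i
        exact (Nat.add_sub_cancel' (hm' i)).symm⟩
      simp only [Pi.add_apply, add_mul, Finset.sum_add_distrib, hmd] at hm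
      obtain ⟨H, hH, hHe⟩ := ih m'' (by omega)
      refine ⟨MvPolynomial.X ⟨m', hmd⟩ * H, ?_, ?_⟩
      · rw [add_comm k 1]
        exact (MvPolynomial.isHomogeneous_X _ _).mul hH
      · rw [map_mul, MvPolynomial.aeval_X, hHe]
        simp only [θ, Pi.add_apply, pow_add, Finset.prod_mul_distrib]
  refine ⟨σ, Fintype.ofFinite σ, d, θ, hd, fun s => ?_, fun s => ?_, fun k P hP hPk => ?_⟩
  · have := hmon s.1
    rwa [s.2] at this
  · exact prod_mem fun j _ => pow_mem (hfA j) _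
  · obtain ⟨Q, rfl⟩ := hgen P hP
    have h1 : MvPolynomial.aeval f Q = ∑ m ∈ Q.support, MvPolynomial.C (Q.coeff m) *
        ∏ j, f j ^ m j := by
      rw [MvPolynomial.aeval_def, MvPolynomial.eval₂_eq']
      rfl
    -- The polynomial Q that expresses P may contain monomials of other weights. Passing to the
    -- component of degree kd discards them without changing P.
    have h2 := MvPolynomial.homogeneousComponent_of_mem (m := k * d) hPk
    rw [if_pos rfl] at h2
    rw [← h2, h1, map_sum]
    have h3 : ∀ m : J →₀ ℕ, ∃ H : MvPolynomial σ ℂ, H.IsHomogeneous k ∧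
        MvPolynomial.aeval θ H = MvPolynomial.homogeneousComponent (k * d)
          (MvPolynomial.C (Q.coeff m) * ∏ j, f j ^ m j) := by
      intro m
      rw [MvPolynomial.homogeneousComponent_C_mul,
        MvPolynomial.homogeneousComponent_of_mem (hmon m)]
      split_ifs with h
      · obtain ⟨H, hH, hHe⟩ := key k m h.symm
        refine ⟨MvPolynomial.C (Q.coeff m) * H, ?_, ?_⟩
        · simpa using (MvPolynomial.isHomogeneous_C σ (Q.coeff m)).mul hH
        · rw [map_mul, hHe, MvPolynomial.aeval_C, MvPolynomial.algebraMap_eq]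
      · exact ⟨0, MvPolynomial.isHomogeneous_zero _ _ _, by simp⟩
    choose H hH hHe using h3
    exact ⟨∑ m ∈ Q.support, H m, MvPolynomial.IsHomogeneous.sum _ _ _ fun m _ => hH m, by
      rw [map_sum]
      exact Finset.sum_congr rfl fun m _ => hHe m⟩

/-! ### The quotient of a projective space by a permutation group -/

section Lift

variable {G ι σ : Type} [Group G] [MulAction G ι] [Finite G] {d : ℕ}
  {θ : σ → MvPolynomial ι ℂ}

/-- A homogeneous invariant of degree n has a d-th power of degree nd, which lies in the algebra
generated by θ. Hence the invariants are integral over that algebra, and all polynomials are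
integral over the invariants. -/
theorem isIntegral_aeval (hd : 0 < d)
    (hθ : ∀ (k : ℕ), ∀ P ∈ invariants G ι, P.IsHomogeneous (k * d) →
      ∃ H : MvPolynomial σ ℂ, MvPolynomial.aeval θ H = P) :
    (MvPolynomial.aeval (R := ℂ) θ).toRingHom.IsIntegral := by
  let _ := (MvPolynomial.aeval (R := ℂ) θ).toRingHom.toAlgebra
  have halg : algebraMap (MvPolynomial σ ℂ) (MvPolynomial ι ℂ) =
    (MvPolynomial.aeval (R := ℂ) θ).toRingHom := rfl
  have hinv : ∀ P ∈ invariants G ι, P ∈ integralClosure (MvPolynomial σ ℂ) (MvPolynomial ι ℂ) := by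
    intro P hP
    rw [← MvPolynomial.sum_homogeneousComponent P]
    refine sum_mem fun n _ => IsIntegral.of_pow hd ?_
    obtain ⟨H, hH⟩ := hθ n _ (pow_mem (homogeneousComponent_mem_invariants hP n) d)
      ((MvPolynomial.homogeneousComponent_isHomogeneous n P).pow d)
    rw [← hH]
    exact isIntegral_algebraMap (x := H)
  have hint := isIntegral_invariants (G := G) (ι := ι)
  intro P
  let i : invariants G ι →+* integralClosure (MvPolynomial σ ℂ) (MvPolynomial ι ℂ) :=
    ((invariants G ι).val : invariants G ι →+* MvPolynomial ι ℂ).codRestrict _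
      fun x => hinv x.1 x.2
  have h1 : ((algebraMap (integralClosure (MvPolynomial σ ℂ) (MvPolynomial ι ℂ))
      (MvPolynomial ι ℂ)).comp i).IsIntegralElem P := hint.isIntegral P
  exact isIntegral_trans (R := MvPolynomial σ ℂ)
    (A := integralClosure (MvPolynomial σ ℂ) (MvPolynomial ι ℂ)) P (h1.of_comp)

/-- Lying over, for points of affine spaces. -/
theorem exists_eval_eq_of_isIntegral [Finite ι]
    (hint : (MvPolynomial.aeval (R := ℂ) θ).toRingHom.IsIntegral)
    {I : Ideal (MvPolynomial ι ℂ)} {u : σ → ℂ}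
    (h : ∀ H : MvPolynomial σ ℂ, MvPolynomial.aeval θ H ∈ I → MvPolynomial.eval u H = 0) :
    ∃ v : ι → ℂ, (∀ P ∈ I, MvPolynomial.eval v P = 0) ∧ ∀ s, MvPolynomial.eval v (θ s) = u s := by
  let _ := (MvPolynomial.aeval (R := ℂ) θ).toRingHom.toAlgebra
  have : Algebra.IsIntegral (MvPolynomial σ ℂ) (MvPolynomial ι ℂ) := ⟨hint⟩
  -- The maximal ideal of the point u contains the contraction of I, so lying over gives a prime
  -- above it that contains I. This prime is again maximal by integrality, hence the ideal of a
  -- point v by the Nullstellensatz.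
  have hmax : (RingHom.ker (MvPolynomial.eval u)).IsMaximal :=
    RingHom.ker_isMaximal_of_surjective _ fun c => ⟨MvPolynomial.C c, MvPolynomial.eval_C c⟩
  obtain ⟨Q, hIQ, hQ, hQu⟩ := Ideal.exists_ideal_over_prime_of_isIntegral
    (RingHom.ker (MvPolynomial.eval u)) I fun H hH => h H hH
  have hQmax : Q.IsMaximal := by
    refine Ideal.isMaximal_of_isIntegral_of_isMaximal_comap (R := MvPolynomial σ ℂ) Q ?_
    rwa [hQu]
  obtain ⟨v, rfl⟩ := (MvPolynomial.isMaximal_iff_eq_vanishingIdeal_singleton (K := ℂ)).1 hQmax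
  refine ⟨v, fun P hP => by simpa using hIQ hP, fun s => ?_⟩
  have h1 : MvPolynomial.X s - MvPolynomial.C (u s) ∈ RingHom.ker (MvPolynomial.eval u) := by
    simp [RingHom.mem_ker]
  rw [← hQu, Ideal.mem_comap] at h1
  have h2 : algebraMap (MvPolynomial σ ℂ) (MvPolynomial ι ℂ)
      (MvPolynomial.X s - MvPolynomial.C (u s)) = θ s - MvPolynomial.C (u s) := by
    change MvPolynomial.aeval θ _ = _
    simp
  rw [h2] at h1
  have h3 : MvPolynomial.eval v (θ s - MvPolynomial.C (u s)) = 0 := by simpa using h1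
  rw [map_sub, MvPolynomial.eval_C] at h3
  exact sub_eq_zero.1 h3

end Lift

section PermAction

variable {G ι : Type} [Group G] [MulAction G ι]

theorem comp_smul_ne_zero (g : G) (x : projectiveSpace ι) :
    (fun i => Projectivization.rep x (g⁻¹ • i)) ≠ 0 := by
  obtain ⟨i, hi⟩ := exists_rep_ne_zero x
  exact fun h => hi (by simpa using congrFun h (g • i))

/-- The action of a permutation of the coordinates on a projective space. -/
def permSMul (g : G) (x : projectiveSpace ι) : projectiveSpace ι :=
  Projectivization.mk ℂ _ (comp_smul_ne_zero g x)

theorem exists_rep_permSMul (g : G) (x : projectiveSpace ι) : ∃ c : ℂ, c ≠ 0 ∧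
    Projectivization.rep (permSMul g x) = c • fun i => Projectivization.rep x (g⁻¹ • i) :=
  exists_rep_mk _ (comp_smul_ne_zero g x)

theorem isMorphism_permSMul (g : G) : IsMorphism (permSMul g : projectiveSpace ι → _) := by
  refine isMorphism_to_projectiveSpace fun x => ?_
  obtain ⟨c, hc, h⟩ := (isMorphism_id (projectiveSpace ι)).exists_homogeneous_coordinates x
  refine ⟨fun i => c (g⁻¹ • i), fun i => hc _, h.mono ?_⟩
  rintro y ⟨l, hl, hy⟩
  obtain ⟨l', hl', hy'⟩ := exists_rep_permSMul g y
  refine ⟨l' * l, mul_ne_zero hl' hl, ?_⟩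
  rw [hy', mul_smul]
  congr 1
  ext i
  exact congrFun hy (g⁻¹ • i)

theorem isQuasiProjective_projectiveSpace [Fintype ι] : (projectiveSpace ι).IsQuasiProjective :=
  ⟨ι, inferInstance, _, (Iso.refl (projectiveSpace ι)).isImmersion⟩

variable (G ι) in
/-- The projective space `ℙ(ℂ^ι)` with the action of `G` by permutations of the coordinates. -/
def permSpace [Finite G] [Fintype ι] : GVariety where
  X := ⟨projectiveSpace ι, isQuasiProjective_projectiveSpace⟩
  G := G
  action :=
    { smul := permSMul
      one_smul := fun x => by
        obtain ⟨c, -, h⟩ := exists_rep_permSMul (1 : G) x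
        refine projectiveSpace_ext (c := c) (h.trans ?_)
        simp only [inv_one, one_smul]
      mul_smul := fun g h x => by
        obtain ⟨c, -, e⟩ := exists_rep_permSMul (g * h) x
        obtain ⟨c', hc', e'⟩ := exists_rep_permSMul h x
        obtain ⟨c'', hc'', e''⟩ := exists_rep_permSMul g (permSMul h x)
        refine projectiveSpace_ext (c := c * (c'' * c')⁻¹) ?_
        change Projectivization.rep (permSMul (g * h) x) =
          (c * (c'' * c')⁻¹) • Projectivization.rep (permSMul g (permSMul h x))
        rw [e, e'', e']
        ext i
        simp only [Pi.smul_apply, smul_eq_mul, mul_inv_rev, mul_smul]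
        field_simp }
  isMorphism_smul := isMorphism_permSMul

/-- The value of a translate of a form. -/
theorem eval_rename_smul (g : G) (x : projectiveSpace ι) : ∃ c : ℂ, c ≠ 0 ∧
    ∀ (n : ℕ) (P : MvPolynomial ι ℂ), P.IsHomogeneous n →
      MvPolynomial.eval (Projectivization.rep x) (MvPolynomial.rename (g • ·) P) =
        c ^ n * MvPolynomial.eval (Projectivization.rep (permSMul g⁻¹ x)) P := by
  obtain ⟨c, hc, h⟩ := exists_rep_permSMul g⁻¹ x
  refine ⟨c⁻¹, inv_ne_zero hc, fun n P hP => ?_⟩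
  rw [h, eval_smul_of_isHomogeneous hP, ← mul_assoc, ← mul_pow, inv_mul_cancel₀ hc, one_pow,
    one_mul, MvPolynomial.eval_rename, inv_inv]
  rfl

/-- An element g that fixes a point of projective space multiplies its coordinate vector by a scalar
c. Since g to the power |G| is 1, so is c to the power |G|, and a form of degree divisible by |G|
does not see c. Averaging of forms works in these degrees. -/
theorem eval_rename_of_permSMul_eq [Fintype G] {g : G} {x : projectiveSpace ι}
    (hx : permSMul g⁻¹ x = x) {n : ℕ} {P : MvPolynomial ι ℂ}
    (hP : P.IsHomogeneous (n * Fintype.card G)) :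
    MvPolynomial.eval (Projectivization.rep x) (MvPolynomial.rename (g • ·) P) =
      MvPolynomial.eval (Projectivization.rep x) P := by
  obtain ⟨c, hc, h⟩ := exists_rep_permSMul g⁻¹ x
  rw [hx, inv_inv] at h
  have hk : ∀ (k : ℕ) i, Projectivization.rep x i = c ^ k * Projectivization.rep x (g ^ k • i) := by
    intro k
    induction k with
    | zero => simp
    | succ k ih =>
      intro i
      have h1 := congrFun h (g ^ k • i)
      simp only [Pi.smul_apply, smul_eq_mul] at h1
      rw [ih, h1, smul_smul, ← pow_succ', pow_succ]
      ring
  have hc1 : c ^ Fintype.card G = 1 := by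
    obtain ⟨i, hi⟩ := exists_rep_ne_zero x
    have h1 := hk (Fintype.card G) i
    rw [pow_card_eq_one, one_smul] at h1
    exact mul_right_cancel₀ hi (h1.symm.trans (one_mul _).symm)
  rw [MvPolynomial.eval_rename]
  conv_rhs => rw [h]
  rw [eval_smul_of_isHomogeneous hP, mul_comm n, pow_mul, hc1, one_pow, one_mul]
  rfl

/-- The sum of the translates of a form of suitable degree that vanishes at the other points of the
orbit of a point. -/
theorem eval_sum_rename_ne_zero [Fintype G] {x : projectiveSpace ι} {n : ℕ} {P : MvPolynomial ι ℂ}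
    (hP : P.IsHomogeneous (n * Fintype.card G))
    (hx : MvPolynomial.eval (Projectivization.rep x) P ≠ 0)
    (h : ∀ g : G, permSMul g x ≠ x →
      MvPolynomial.eval (Projectivization.rep (permSMul g x)) P = 0) :
    MvPolynomial.eval (Projectivization.rep x) (∑ g : G, MvPolynomial.rename (g • ·) P) ≠ 0 := by
  classical
  rw [map_sum]
  have h1 : ∀ g : G, MvPolynomial.eval (Projectivization.rep x) (MvPolynomial.rename (g • ·) P) =
      if permSMul g⁻¹ x = x then MvPolynomial.eval (Projectivization.rep x) P else 0 := by
    intro g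
    split_ifs with hg
    · exact eval_rename_of_permSMul_eq hg hP
    · obtain ⟨c, hc, e⟩ := eval_rename_smul g x
      rw [e _ _ hP, h _ hg, mul_zero]
  simp only [h1]
  rw [Finset.sum_ite, Finset.sum_const_zero, add_zero, Finset.sum_const, nsmul_eq_mul]
  refine mul_ne_zero (Nat.cast_ne_zero.2 (Finset.card_ne_zero.2 ⟨1, ?_⟩)) hx
  obtain ⟨c, -, e⟩ := exists_rep_permSMul (1 : G) x
  simp only [Finset.mem_filter, Finset.mem_univ, true_and, inv_one]
  refine projectiveSpace_ext (c := c) (e.trans ?_)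
  simp only [inv_one, one_smul]

theorem isHomogeneous_sum_rename [Fintype G] {n : ℕ} {P : MvPolynomial ι ℂ}
    (hP : P.IsHomogeneous n) : (∑ g : G, MvPolynomial.rename (g • ·) P).IsHomogeneous n :=
  MvPolynomial.IsHomogeneous.sum _ _ _ fun _ _ => hP.rename_isHomogeneous

end PermAction

section Veronese

variable {G ι σ : Type} [Group G] [MulAction G ι] {d : ℕ} {θ : σ → MvPolynomial ι ℂ}

theorem eval_aeval (v : ι → ℂ) (H : MvPolynomial σ ℂ) :
    MvPolynomial.eval v (MvPolynomial.aeval θ H) =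
      MvPolynomial.eval (fun s => MvPolynomial.eval v (θ s)) H := by
  induction H using MvPolynomial.induction_on with
  | C a => simp
  | add P Q hP hQ => simp only [map_add, hP, hQ]
  | mul_X P i hP => simp only [map_mul, hP, MvPolynomial.aeval_X, MvPolynomial.eval_X]

/-- Let L be a linear form without zeros on the orbit of x. The product N of its translates is an
invariant form of degree |G| that is nonzero at x. Its power N^d is a form of positive degree |G| in
the θ, so they cannot all vanish at x. -/
theorem exists_veronese_ne_zero [Finite G] [Finite ι]
    (hθ : ∀ (k : ℕ), ∀ P ∈ invariants G ι, P.IsHomogeneous (k * d) →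
      ∃ H : MvPolynomial σ ℂ, H.IsHomogeneous k ∧ MvPolynomial.aeval θ H = P)
    (x : projectiveSpace ι) :
    (fun s => MvPolynomial.eval (Projectivization.rep x) (θ s)) ≠ 0 := by
  classical
  have := Fintype.ofFinite G
  have := Fintype.ofFinite ι
  intro h0
  obtain ⟨L, hL, hLx⟩ := exists_linear_ne_zero (Set.finite_range fun g : G => permSMul g x)
  let N := ∏ g : G, MvPolynomial.rename (g • ·) L
  have hN : N.IsHomogeneous (Fintype.card G) := by
    have : N.IsHomogeneous (∑ _g : G, 1) :=
      MvPolynomial.IsHomogeneous.prod _ _ _ fun g _ => hL.rename_isHomogeneous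
    simpa using this
  have hNx : MvPolynomial.eval (Projectivization.rep x) N ≠ 0 := by
    rw [map_prod]
    refine Finset.prod_ne_zero_iff.2 fun g _ => ?_
    obtain ⟨c, hc, e⟩ := eval_rename_smul g x
    rw [e _ _ hL]
    exact mul_ne_zero (pow_ne_zero _ hc) (hLx _ ⟨g⁻¹, rfl⟩)
  have hNG : N ∈ invariants G ι := by
    intro h
    rw [map_prod]
    refine Fintype.prod_equiv (Equiv.mulLeft h) _ _ fun g => ?_
    rw [MvPolynomial.rename_rename]
    congr 2
    ext i
    exact (mul_smul h g i).symm
  obtain ⟨H, hH, hHN⟩ := hθ (Fintype.card G) (N ^ d) (pow_mem hNG d) (hN.pow d)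
  refine pow_ne_zero d hNx ?_
  rw [← map_pow, ← hHN, eval_aeval, h0, ← zero_smul ℂ (0 : σ → ℂ), eval_smul_of_isHomogeneous hH,
    zero_pow Fintype.card_ne_zero, zero_mul]

/-- The map of projective spaces given by forms without a common zero. -/
def formMap (h : ∀ x : projectiveSpace ι,
      (fun s => MvPolynomial.eval (Projectivization.rep x) (θ s)) ≠ 0)
    (x : projectiveSpace ι) : projectiveSpace σ :=
  Projectivization.mk ℂ _ (h x)

variable (h0 : ∀ x : projectiveSpace ι,
  (fun s => MvPolynomial.eval (Projectivization.rep x) (θ s)) ≠ 0)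

theorem exists_rep_formMap (x : projectiveSpace ι) : ∃ c : ℂ, c ≠ 0 ∧
    Projectivization.rep (formMap h0 x) =
      c • fun s => MvPolynomial.eval (Projectivization.rep x) (θ s) :=
  exists_rep_mk _ (h0 x)

theorem eval_rep_formMap (x : projectiveSpace ι) : ∃ c : ℂ, c ≠ 0 ∧
    ∀ (k : ℕ) (H : MvPolynomial σ ℂ), H.IsHomogeneous k →
      MvPolynomial.eval (Projectivization.rep (formMap h0 x)) H =
        c ^ k * MvPolynomial.eval (Projectivization.rep x) (MvPolynomial.aeval θ H) := by
  obtain ⟨c, hc, e⟩ := exists_rep_formMap h0 x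
  exact ⟨c, hc, fun k H hH => by rw [e, eval_smul_of_isHomogeneous hH, eval_aeval]⟩

variable (hθd : ∀ s, (θ s).IsHomogeneous d)

include hθd in
theorem isMorphism_formMap : IsMorphism (formMap h0) := by
  refine isMorphism_to_projectiveSpace fun x => ?_
  obtain ⟨c, hc, h⟩ := (isMorphism_id (projectiveSpace ι)).exists_homogeneous_coordinates x
  refine ⟨fun s y => MvPolynomial.eval (fun i => c i y) (θ s),
    fun s => SpaceWithFunctions.regularAt_eval _ hc _, h.mono ?_⟩
  rintro y ⟨l, hl, hy⟩
  obtain ⟨l', hl', hy'⟩ := exists_rep_formMap h0 y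
  refine ⟨l' * l ^ d, mul_ne_zero hl' (pow_ne_zero _ hl), ?_⟩
  rw [hy', mul_smul]
  congr 1
  ext s
  rw [show Projectivization.rep y = l • fun i => c i y from hy,
    eval_smul_of_isHomogeneous (hθd s)]
  rfl

/-- For fixed u the value is a polynomial in t whose coefficients are the values at u of the
components of H; if it vanishes for all t, so do these values. -/
theorem sum_smul_eval_homogeneousComponent (H : MvPolynomial σ ℂ) (t : ℂ) (u : σ → ℂ) :
    MvPolynomial.eval (t • u) H = ∑ k ∈ Finset.range (H.totalDegree + 1),
      t ^ k * MvPolynomial.eval u (MvPolynomial.homogeneousComponent k H) := by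
  conv_lhs => rw [← MvPolynomial.sum_homogeneousComponent H]
  rw [map_sum]
  exact Finset.sum_congr rfl fun k _ =>
    eval_smul_of_isHomogeneous (MvPolynomial.homogeneousComponent_isHomogeneous k H) t u

include hθd in
/-- A map of projective spaces given by forms such that all coordinates are integral over the
algebra generated by them is closed. -/
theorem isClosedMap_formMap [Finite ι] (hd : 0 < d)
    (hint : (MvPolynomial.aeval (R := ℂ) θ).toRingHom.IsIntegral) :
    IsClosedMap (formMap h0) := by
  intro Z hZ
  refine isClosed_of_closure_subset fun z hz => ?_
  -- A form that vanishes on the image of Z vanishes at the point z of its closure.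
  have hz' : ∀ (k : ℕ) (H : MvPolynomial σ ℂ), H.IsHomogeneous k →
      (∀ x ∈ Z, MvPolynomial.eval (Projectivization.rep (formMap h0 x)) H = 0) →
      MvPolynomial.eval (Projectivization.rep z) H = 0 := by
    intro k H hH hHZ
    by_contra hne
    obtain ⟨y, hy, x, hx, rfl⟩ := mem_closure_iff_nhds.1 hz _ (eventually_eval_ne_zero hH hne)
    exact hy (hHZ x hx)
  -- I is the ideal of the affine cone over Z. Lying over is applied to the affine point given by
  -- the coordinates of z; the resulting v represents a preimage of z in Z.
  let I : Ideal (MvPolynomial ι ℂ) := ⨅ x ∈ Z, ⨅ c : ℂ,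
    RingHom.ker (MvPolynomial.eval (c • Projectivization.rep x))
  have hI : ∀ P, P ∈ I ↔ ∀ x ∈ Z, ∀ c : ℂ,
      MvPolynomial.eval (c • Projectivization.rep x) P = 0 := fun P => by
    simp only [I, Ideal.mem_iInf, RingHom.mem_ker]
  obtain ⟨v, hvI, hv⟩ := exists_eval_eq_of_isIntegral hint (I := I)
    (u := Projectivization.rep z) fun H hH => by
      rw [← one_smul ℂ (Projectivization.rep z), sum_smul_eval_homogeneousComponent]
      refine Finset.sum_eq_zero fun k hk => ?_
      rw [hz' k _ (MvPolynomial.homogeneousComponent_isHomogeneous k H) fun x hx => ?_, mul_zero]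
      obtain ⟨c, hc, e⟩ := exists_rep_formMap h0 x
      rw [e, eval_smul_of_isHomogeneous (MvPolynomial.homogeneousComponent_isHomogeneous k H)]
      refine mul_eq_zero_of_right _ ?_
      set u : σ → ℂ := fun s => MvPolynomial.eval (Projectivization.rep x) (θ s)
      -- H need not be homogeneous, so its components are isolated: H(θ) vanishes at all multiples
      -- s·x, where the values of θ are s^d · u. Every t in ℂ is such a power s^d, so p vanishes
      -- identically and each component of H vanishes at u.
      let p : Polynomial ℂ := ∑ k ∈ Finset.range (H.totalDegree + 1), Polynomial.C
        (MvPolynomial.eval u (MvPolynomial.homogeneousComponent k H)) * Polynomial.X ^ k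
      have hp : p = 0 := by
        refine Polynomial.funext fun t => ?_
        obtain ⟨s, hs⟩ := IsAlgClosed.exists_pow_nat_eq t hd
        have h1 := (hI _).1 hH x hx s
        rw [eval_aeval] at h1
        have h2 : (fun a => MvPolynomial.eval (s • Projectivization.rep x) (θ a)) = t • u := by
          ext a
          rw [eval_smul_of_isHomogeneous (hθd a), hs]
          rfl
        rw [h2, sum_smul_eval_homogeneousComponent] at h1
        simp only [p, Polynomial.eval_finsetSum, Polynomial.eval_mul, Polynomial.eval_C,
          Polynomial.eval_pow, Polynomial.eval_X, Polynomial.eval_zero]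
        rw [← h1]
        exact Finset.sum_congr rfl fun _ _ => mul_comm _ _
      have h3 : p.coeff k = MvPolynomial.eval u (MvPolynomial.homogeneousComponent k H) := by
        simp only [p, Polynomial.finsetSum_coeff, Polynomial.coeff_C_mul_X_pow]
        rw [Finset.sum_ite_eq, if_pos hk]
      rw [← h3, hp, Polynomial.coeff_zero]
  -- The forms θ have positive degree, so v = 0 would make all coordinates of z zero.
  have hv0 : v ≠ 0 := by
    rintro rfl
    obtain ⟨s, hs⟩ := exists_rep_ne_zero z
    refine hs ?_
    rw [← hv s, ← zero_smul ℂ (0 : ι → ℂ), eval_smul_of_isHomogeneous (hθd s), zero_pow hd.ne',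
      zero_mul]
  obtain ⟨c, hc, hrep⟩ := exists_rep_mk v hv0
  refine ⟨(Projectivization.mk ℂ v hv0 : projectiveSpace ι), ?_, ?_⟩
  -- If [v] were outside Z, a form vanishing on Z but not at [v] would exist; it lies in I and hence
  -- vanishes at v.
  · by_contra hx
    obtain ⟨D, M, hM, hMx, hMZ⟩ := exists_isHomogeneous_separating hZ hx
    refine hMx ?_
    have hMI : M ∈ I := (hI M).2 fun x hx c => by
      rw [eval_smul_of_isHomogeneous hM, hMZ x hx, mul_zero]
    rw [hrep, eval_smul_of_isHomogeneous hM, hvI M hMI, mul_zero]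
  · obtain ⟨c', hc', e⟩ := exists_rep_formMap h0 (Projectivization.mk ℂ v hv0 : projectiveSpace ι)
    refine projectiveSpace_ext (c := c' * c ^ d) (e.trans ?_)
    rw [mul_smul]
    congr 1
    ext s
    rw [hrep, eval_smul_of_isHomogeneous (hθd s), hv]
    rfl

end Veronese

/-- The quotient of a projective space by a group that permutes the coordinates is a
quasi-projective variety. -/
theorem isQuasiProjective_quotientSpace_permSpace (G ι : Type) [Group G] [MulAction G ι] [Finite G]
    [Fintype ι] : (permSpace G ι).quotientSpace.IsQuasiProjective := by
  classical
  have := Fintype.ofFinite G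
  obtain ⟨σ, _, d, θ, hd, hθd, hθG, hθ⟩ := exists_veronese G ι
  have h0 := exists_veronese_ne_zero hθ
  have hint := isIntegral_aeval (G := G) hd fun k P hP hPk => (hθ k P hP hPk).imp fun _ h => h.2
  let V := permSpace G ι
  let π : projectiveSpace ι → V.quotientSpace := V.quotientMk
  have hπ : Function.Surjective π := V.quotientMk_surjective
  have hπm : IsMorphism π := V.isMorphism_quotientMk
  have hπs : ∀ (g : G) (x : projectiveSpace ι), π (permSMul g x) = π x := V.quotientMk_smul
  have hπe : ∀ x y : projectiveSpace ι, π x = π y ↔ ∃ g : G, permSMul g y = x := fun x y =>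
    GVariety.quotientMk_eq_iff (V := V)
  have horb : ∀ x : projectiveSpace ι, IsClosed {z | (∃ g : G, permSMul g x = z) ∧ z ≠ x} :=
    V.isClosed_orbit_diff
  have hsmul : ∀ (g : G) (x : projectiveSpace ι), formMap h0 (permSMul g x) = formMap h0 x := by
    intro g x
    obtain ⟨c, hc, e⟩ := exists_rep_formMap h0 x
    obtain ⟨c', hc', e'⟩ := exists_rep_formMap h0 (permSMul g x)
    obtain ⟨b, hb, eb⟩ := eval_rename_smul g⁻¹ x
    refine projectiveSpace_ext (c := c' * (b ^ d)⁻¹ * c⁻¹) ?_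
    rw [e, e']
    ext s
    have h1 := eb d (θ s) (hθd s)
    rw [hθG s, inv_inv] at h1
    simp only [Pi.smul_apply, smul_eq_mul, h1]
    field_simp
  let φ : V.quotientSpace → projectiveSpace σ :=
    Quotient.lift (s := MulAction.orbitRel V.G V.X.space) (formMap h0) (by
      rintro x y ⟨g, rfl⟩
      exact hsmul g y)
  have hφ : ∀ x, φ (π x) = formMap h0 x := fun _ => rfl
  have hm : IsMorphism φ :=
    SpaceWithFunctions.isMorphism_quotient_iff.2 (isMorphism_formMap h0 hθd)
  have hcl : IsClosedMap φ := by
    intro Z hZ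
    have h1 := isClosedMap_formMap h0 hθd hd hint _ (hZ.preimage hπm.continuous)
    have h2 : formMap h0 '' (π ⁻¹' Z) = φ '' Z := by
      conv_rhs => rw [← Set.image_preimage_eq Z hπ, ← Set.image_comp]
      rfl
    rwa [← h2]
  -- Raising forms to the power |G| · d makes their degree divisible by d, so that invariants are
  -- forms in θ, and by |G|, so that averages stay nonzero.
  have hdeg : ∀ D : ℕ, D * (Fintype.card G * d) = D * Fintype.card G * d ∧
      D * (Fintype.card G * d) = D * d * Fintype.card G := fun D => by
    constructor <;> ring
  have hn : 0 < Fintype.card G * d := Nat.mul_pos Fintype.card_pos hd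
  -- For different orbits, M is nonzero at x and vanishes on the rest of the orbit of x and on the
  -- orbit of y. The average of M^(|G|d) is a form in θ that is nonzero at x and zero at y.
  have hinj : Function.Injective φ := by
    intro p q hpq
    obtain ⟨x, rfl⟩ := hπ p
    obtain ⟨y, rfl⟩ := hπ q
    by_contra hne
    have hZ : IsClosed ({z | (∃ g : G, permSMul g x = z) ∧ z ≠ x} ∪
        Set.range fun g : G => permSMul g y) :=
      (horb x).union (Set.finite_range _).isClosed
    obtain ⟨D, M, hM, hMx, hMZ⟩ := exists_isHomogeneous_separating (x := x) hZ (by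
      rintro (h | ⟨g, hg⟩)
      · exact h.2 rfl
      · exact hne ((hπe x y).2 ⟨g, hg⟩))
    have hM' := hM.pow (Fintype.card G * d)
    have hMx' := eval_sum_rename_ne_zero (G := G) ((hdeg D).2 ▸ hM')
      (by rw [map_pow]; exact pow_ne_zero _ hMx) fun g hg => by
        rw [map_pow, hMZ _ (Or.inl ⟨⟨g, rfl⟩, hg⟩), zero_pow hn.ne']
    obtain ⟨H, hH, hHe⟩ := hθ _ _ (sum_rename_mem_invariants (G := G) (M ^ (Fintype.card G * d)))
      ((hdeg D).1 ▸ isHomogeneous_sum_rename hM')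
    obtain ⟨c, hc, e⟩ := eval_rep_formMap h0 x
    obtain ⟨c', hc', e'⟩ := eval_rep_formMap h0 y
    have h1 := e _ H hH
    rw [show formMap h0 x = formMap h0 y from hpq, e' _ H hH, hHe, map_sum,
      Finset.sum_eq_zero, mul_zero] at h1
    · exact mul_ne_zero (pow_ne_zero _ hc) hMx' h1.symm
    · intro g _
      obtain ⟨b, hb, eb⟩ := eval_rename_smul g y
      rw [eb _ _ hM', map_pow, hMZ (permSMul g⁻¹ y) (Or.inr ⟨g⁻¹, rfl⟩), zero_pow hn.ne', mul_zero]
  refine ⟨σ, inferInstance, φ,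
    (IsClosedEmbedding.of_continuous_injective_isClosedMap hm.continuous hinj hcl).isEmbedding,
    hcl.isClosed_range.isLocallyClosed, fun f p => ⟨fun hf => ?_, ?_⟩⟩
  · obtain ⟨x, rfl⟩ := hπ p
    obtain ⟨e, P, Q, hP, hQ, hxQ, hfPQ⟩ := hπm.regularAt_comp f x hf
    have hev : ∀ᶠ z in 𝓝 x, f (π z) * MvPolynomial.eval (Projectivization.rep z) Q =
        MvPolynomial.eval (Projectivization.rep z) P := by
      filter_upwards [hfPQ, eventually_eval_ne_zero hQ hxQ] with z h1 h2
      exact (eq_div_iff h2).1 h1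
    obtain ⟨O, hO, hOo, hxO⟩ := eventually_nhds_iff.1 hev
    have hZ : IsClosed ({z | (∃ g : G, permSMul g x = z) ∧ z ≠ x} ∪ Oᶜ) :=
      (horb x).union hOo.isClosed_compl
    obtain ⟨D, M, hM, hMx, hMZ⟩ := exists_isHomogeneous_separating (x := x) hZ (by
      rintro (h | h)
      exacts [h.2 rfl, h hxO])
    -- The fraction P/Q is rewritten as PM(QM)^n / (QM)^(n+1), with degrees divisible by |G| · d.
    -- The factor M makes both sides vanish outside O, so the relation with f holds everywhere and
    -- can be summed over translates.
    obtain ⟨n, hn'⟩ : ∃ n, Fintype.card G * d = n + 1 := ⟨_, (Nat.succ_pred hn.ne').symm⟩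
    have hb : ((Q * M) ^ (n + 1)).IsHomogeneous ((e + D) * (Fintype.card G * d)) := by
      rw [hn']
      exact (hQ.mul hM).pow _
    have ha : (P * M * (Q * M) ^ n).IsHomogeneous ((e + D) * (Fintype.card G * d)) := by
      rw [hn', mul_add, mul_one, add_comm]
      exact (hP.mul hM).mul ((hQ.mul hM).pow n)
    have hab : ∀ z : projectiveSpace ι, MvPolynomial.eval (Projectivization.rep z) (P * M * (Q * M) ^ n) =
        f (π z) * MvPolynomial.eval (Projectivization.rep z) ((Q * M) ^ (n + 1)) := by
      intro z
      simp only [map_mul, map_pow]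
      by_cases hz : z ∈ O
      · rw [← hO z hz]
        ring
      · rw [hMZ z (Or.inr hz)]
        ring
    obtain ⟨A, hA, hAe⟩ := hθ _ _ (sum_rename_mem_invariants (G := G) _)
      ((hdeg _).1 ▸ isHomogeneous_sum_rename ha)
    obtain ⟨B, hB, hBe⟩ := hθ _ _ (sum_rename_mem_invariants (G := G) _)
      ((hdeg _).1 ▸ isHomogeneous_sum_rename hb)
    have hBx : MvPolynomial.eval (Projectivization.rep x) (MvPolynomial.aeval θ B) ≠ 0 := by
      rw [hBe]
      refine eval_sum_rename_ne_zero (G := G) ((hdeg _).2 ▸ hb) ?_ fun g hg => ?_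
      · rw [map_pow, map_mul]
        exact pow_ne_zero _ (mul_ne_zero hxQ hMx)
      · rw [map_pow, map_mul, hMZ _ (Or.inl ⟨⟨g, rfl⟩, hg⟩), mul_zero, zero_pow n.succ_ne_zero]
    have hBx' : MvPolynomial.eval (Projectivization.rep (formMap h0 x)) B ≠ 0 := by
      obtain ⟨c, hc, ec⟩ := eval_rep_formMap h0 x
      rw [ec _ B hB]
      exact mul_ne_zero (pow_ne_zero _ hc) hBx
    have hAB : ∀ z : projectiveSpace ι, MvPolynomial.eval (Projectivization.rep z) (MvPolynomial.aeval θ A) =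
        f (π z) *
          MvPolynomial.eval (Projectivization.rep z) (MvPolynomial.aeval θ B) := by
      intro z
      rw [hAe, hBe, map_sum, map_sum, Finset.mul_sum]
      refine Finset.sum_congr rfl fun g _ => ?_
      obtain ⟨c, hc, ec⟩ := eval_rename_smul g z
      rw [ec _ _ ha, ec _ _ hb, hab, hπs]
      ring
    refine ⟨fun z => MvPolynomial.eval (Projectivization.rep z) A /
      MvPolynomial.eval (Projectivization.rep z) B, ⟨_, A, B, hA, hB, hBx',
        Eventually.of_forall fun _ => rfl⟩, ?_⟩
    filter_upwards [hm.continuous.continuousAt.eventually (eventually_eval_ne_zero hB hBx')]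
      with q hq
    obtain ⟨z, rfl⟩ := hπ q
    obtain ⟨c, hc, ec⟩ := eval_rep_formMap h0 z
    have hq' : MvPolynomial.eval (Projectivization.rep (formMap h0 z)) B ≠ 0 := hq
    rw [ec _ B hB] at hq'
    rw [hφ, ec _ A hA, ec _ B hB, mul_div_mul_left _ _ (pow_ne_zero _ hc), hAB,
      mul_div_cancel_right₀ _ (right_ne_zero_of_mul hq')]
  · rintro ⟨F, hF, hz⟩
    exact V.quotientSpace.regularAt_congr (hz.mono fun z hz => hz.symm)
      (hm.regularAt_comp F p hF)

/-! ### Equivariant embeddings -/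

/-- The graph of ψ is closed in X × Z because Z is separated, and the first projection inverts x ↦
(x, ψ(x)). Then e is applied to the first factor. -/
theorem isImmersion_graph {X Y Z : SpaceWithFunctions} {e : X → Y} (he : IsImmersion e) {ψ : X → Z}
    (hψ : IsMorphism ψ) (hZ : Z.IsQuasiProjective) :
    IsImmersion (X := X) (Y := Y.prod Z) (fun x => (e x, ψ x)) := by
  have hg : IsMorphism (X := X) (Y := X.prod Z) (fun x => (x, ψ x)) :=
    SpaceWithFunctions.isMorphism_prodMk (isMorphism_id X) hψ
  have hfst := SpaceWithFunctions.isMorphism_fst X Z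
  have h : IsImmersion (X := X) (Y := X.prod Z) (fun x => (x, ψ x)) := by
    refine ⟨.of_leftInverse (X := X.prod Z) (Y := X) (f := fun p : X.prod Z => (show X × Z from p).1)
      (fun _ => rfl) hfst.continuous hg.continuous, ?_,
      fun f x => ⟨fun hf => ⟨f ∘ Prod.fst, hfst.regularAt_comp f (x, ψ x) hf,
        Eventually.of_forall fun _ => rfl⟩, ?_⟩⟩
    · have hr : Set.range (fun x => ((x, ψ x) : X.prod Z)) = {p : X.prod Z | ψ p.1 = p.2} := by
        ext p
        exact ⟨by rintro ⟨x, rfl⟩; rfl, fun hp => ⟨p.1, Prod.ext rfl hp⟩⟩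
      exact hr ▸ (isClosed_setOf_eq hZ (hψ.comp hfst)
        (SpaceWithFunctions.isMorphism_snd X Z)).isLocallyClosed
    · rintro ⟨F, hF, hz⟩
      exact X.regularAt_congr (hz.mono fun z hz => hz.symm) (hg.regularAt_comp F x hF)
  exact (SpaceWithFunctions.isImmersion_prodMap he (Iso.refl Z).isImmersion).comp h

/-- An immersion is an isomorphism onto its image. -/
def IsImmersion.isoRange {X Y : SpaceWithFunctions} {e : X → Y} (he : IsImmersion e) :
    Iso X (Y.sub (Set.range e)) where
  toEquiv := Equiv.ofInjective e he.isEmbedding.injective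
  isMorphism_toFun := SpaceWithFunctions.isMorphism_sub_iff.2 he.isMorphism
  isMorphism_invFun := by
    have hc : Continuous (X := Y.sub (Set.range e)) (Y := X)
        (Equiv.ofInjective e he.isEmbedding.injective).symm :=
      he.isEmbedding.toHomeomorph.symm.continuous
    refine ⟨hc, ?_⟩
    intro f y hf
    obtain ⟨F, hF, h⟩ := (he.regularAt_iff f _).1 hf
    have hy : ∀ z : Set.range e, e ((Equiv.ofInjective e he.isEmbedding.injective).symm z) = z :=
      fun z => Equiv.apply_ofInjective_symm he.isEmbedding.injective z
    refine ⟨F, ?_, ?_⟩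
    · rw [← hy y]
      exact hF
    · filter_upwards [hc.continuousAt.eventually h] with z hz
      exact hz.trans (congrArg F (hy z))

section Reindex

variable {κ κ' : Type}

theorem reindex_ne_zero (ε : κ ≃ κ') (x : projectiveSpace κ) :
    (fun k => Projectivization.rep x (ε.symm k)) ≠ 0 := by
  obtain ⟨k, hk⟩ := exists_rep_ne_zero x
  exact fun h => hk (by simpa using congrFun h (ε k))

/-- The isomorphism of projective spaces defined by a bijection of the coordinates. -/
def reindex (ε : κ ≃ κ') (x : projectiveSpace κ) : projectiveSpace κ' :=
  Projectivization.mk ℂ _ (reindex_ne_zero ε x)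

theorem exists_rep_reindex (ε : κ ≃ κ') (x : projectiveSpace κ) : ∃ c : ℂ, c ≠ 0 ∧
    Projectivization.rep (reindex ε x) = c • fun k => Projectivization.rep x (ε.symm k) :=
  exists_rep_mk _ (reindex_ne_zero ε x)

theorem isMorphism_reindex (ε : κ ≃ κ') : IsMorphism (reindex ε) := by
  refine isMorphism_to_projectiveSpace fun x => ?_
  obtain ⟨c, hc, h⟩ := (isMorphism_id (projectiveSpace κ)).exists_homogeneous_coordinates x
  refine ⟨fun i => c (ε.symm i), fun i => hc _, h.mono ?_⟩
  rintro y ⟨l, hl, hy⟩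
  obtain ⟨l', hl', hy'⟩ := exists_rep_reindex ε y
  refine ⟨l' * l, mul_ne_zero hl' hl, ?_⟩
  rw [hy', mul_smul]
  congr 1
  ext i
  exact congrFun hy (ε.symm i)

theorem reindex_symm_reindex (ε : κ ≃ κ') (x : projectiveSpace κ) :
    reindex ε.symm (reindex ε x) = x := by
  obtain ⟨c, hc, h⟩ := exists_rep_reindex ε x
  obtain ⟨c', hc', h'⟩ := exists_rep_reindex ε.symm (reindex ε x)
  refine projectiveSpace_ext (c := c' * c) (h'.trans ?_)
  rw [h]
  ext i
  simp [mul_assoc]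

def reindexIso (ε : κ ≃ κ') : Iso (projectiveSpace κ) (projectiveSpace κ') where
  toFun := reindex ε
  invFun := reindex ε.symm
  left_inv := reindex_symm_reindex ε
  right_inv := reindex_symm_reindex ε.symm
  isMorphism_toFun := isMorphism_reindex ε
  isMorphism_invFun := isMorphism_reindex ε.symm

end Reindex

section MultiSegre

variable {ι J : Type} [Fintype J]

theorem multiSegre_ne_zero (p : J → projectiveSpace ι) :
    (fun a : J → ι => ∏ j, Projectivization.rep (p j) (a j)) ≠ 0 := by
  choose a ha using fun j => exists_rep_ne_zero (p j)
  exact fun h => Finset.prod_ne_zero_iff.2 (fun j _ => ha j) (congrFun h a)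

/-- The Segre map for several factors. -/
def multiSegre (p : J → projectiveSpace ι) : projectiveSpace (J → ι) :=
  Projectivization.mk ℂ _ (multiSegre_ne_zero p)

theorem exists_rep_multiSegre (p : J → projectiveSpace ι) : ∃ c : ℂ, c ≠ 0 ∧
    Projectivization.rep (multiSegre p) =
      c • fun a : J → ι => ∏ j, Projectivization.rep (p j) (a j) :=
  exists_rep_mk _ (multiSegre_ne_zero p)

theorem isMorphism_multiSegre {X : SpaceWithFunctions} {ψ : J → X → projectiveSpace ι}
    (hψ : ∀ j, IsMorphism (ψ j)) : IsMorphism (fun x => multiSegre fun j => ψ j x) := by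
  refine isMorphism_to_projectiveSpace fun x => ?_
  choose c hc h using fun j => (hψ j).exists_homogeneous_coordinates x
  refine ⟨fun a y => ∏ j, c j (a j) y, fun a => X.regularAt_finset_prod _ fun j _ => hc j (a j), ?_⟩
  filter_upwards [eventually_all.2 h] with y hy
  choose l hl hly using hy
  obtain ⟨l', hl', hy'⟩ := exists_rep_multiSegre fun j => ψ j y
  refine ⟨l' * ∏ j, l j, mul_ne_zero hl' (Finset.prod_ne_zero_iff.2 fun j _ => hl j), ?_⟩
  rw [hy', mul_smul]
  congr 1
  ext a
  simp only [Pi.smul_apply, smul_eq_mul, ← Finset.prod_mul_distrib]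
  exact Finset.prod_congr rfl fun j _ => congrFun (hly j) (a j)

/-- One factor that is an immersion suffices: up to reindexing the coordinates, the map is the Segre
embedding applied to the pair of ψ_{j₀} and the Segre map of the other factors, and this pair is an
immersion by `isImmersion_graph`. -/
theorem isImmersion_multiSegre [Fintype ι] {X : SpaceWithFunctions} {ψ : J → X → projectiveSpace ι}
    (hψ : ∀ j, IsMorphism (ψ j)) (j₀ : J) (h : IsImmersion (ψ j₀)) :
    IsImmersion (fun x => multiSegre fun j => ψ j x) := by
  classical
  have h1 := isImmersion_graph h (isMorphism_multiSegre fun j : {j // j ≠ j₀} => hψ j)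
    isQuasiProjective_projectiveSpace
  have h2 := (reindexIso (Equiv.funSplitAt j₀ ι).symm).isImmersion.comp (isImmersion_segre.comp h1)
  convert! h2 using 1
  ext x
  obtain ⟨c, hc, e⟩ := exists_rep_multiSegre fun j => ψ j x
  obtain ⟨c₁, hc₁, e₁⟩ := exists_rep_multiSegre fun j : {j // j ≠ j₀} => ψ j x
  let p : (projectiveSpace ι).prod (projectiveSpace ({j // j ≠ j₀} → ι)) :=
    (ψ j₀ x, multiSegre fun j : {j // j ≠ j₀} => ψ j x)
  obtain ⟨c₂, hc₂, e₂⟩ := exists_rep_segre p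
  obtain ⟨c₃, hc₃, e₃⟩ := exists_rep_reindex (Equiv.funSplitAt j₀ ι).symm (segre p)
  refine projectiveSpace_ext (c := c * (c₃ * c₂ * c₁)⁻¹) ?_
  change _ = (c * (c₃ * c₂ * c₁)⁻¹) • Projectivization.rep (reindex _ (segre p))
  rw [e, e₃, e₂]
  ext a
  simp only [Pi.smul_apply, smul_eq_mul, p, e₁, Equiv.symm_symm, Equiv.funSplitAt_apply]
  rw [← Finset.mul_prod_erase Finset.univ _ (Finset.mem_univ j₀),
    Finset.prod_subtype (p := fun j => j ≠ j₀) (Finset.univ.erase j₀) (by simp)]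
  field_simp

end MultiSegre

namespace GVariety

/-- A variety with an action of a finite group has an equivariant embedding in a projective space
on which the group acts by permutations of the coordinates. -/
theorem exists_isImmersion_permSpace (V : GVariety) :
    ∃ (κ : Type) (_ : Fintype κ) (_ : MulAction V.G κ) (φ : V.X.space → projectiveSpace κ),
      IsImmersion φ ∧ ∀ (g : V.G) x, φ (g • x) = permSMul g (φ x) := by
  classical
  obtain ⟨ι, _, e, he⟩ := V.X.isQuasiProjective
  let _ : MulAction V.G (V.G → ι) := arrowAction
  -- Since k⁻¹gx = (g⁻¹k)⁻¹x, replacing x by gx permutes the tensor factors, that is, the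
  -- coordinates indexed by functions G → ι. The factor at 1 is e itself, an immersion.
  refine ⟨V.G → ι, inferInstance, inferInstance, fun x => multiSegre fun g : V.G => e (g⁻¹ • x),
    isImmersion_multiSegre (ψ := fun (g : V.G) (x : V.X.space) => e (g⁻¹ • x))
      (fun g => he.isMorphism.comp (V.isMorphism_smul g⁻¹)) 1 ?_, fun g x => ?_⟩
  · simpa using! he
  · obtain ⟨c, hc, h⟩ := exists_rep_multiSegre fun h : V.G => e (h⁻¹ • x)
    obtain ⟨c', hc', h'⟩ := exists_rep_multiSegre fun h : V.G => e (h⁻¹ • g • x)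
    obtain ⟨c'', hc'', h''⟩ := exists_rep_permSMul g (multiSegre fun h : V.G => e (h⁻¹ • x))
    refine projectiveSpace_ext (c := c' * (c'' * c)⁻¹) ?_
    rw [h', h'', h]
    ext a
    have key : ∏ k : V.G, Projectivization.rep (e (k⁻¹ • g • x)) (a k) =
        ∏ k : V.G, Projectivization.rep (e (k⁻¹ • x)) ((g⁻¹ • a) k) := by
      refine (Fintype.prod_equiv (Equiv.mulLeft g) _ _ fun k => ?_).symm
      rw [← mul_smul]
      simp only [Equiv.coe_mulLeft, mul_inv_rev, inv_mul_cancel_right]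
      refine congrArg _ ?_
      change a (g⁻¹⁻¹ * k) = a (g * k)
      rw [inv_inv]
    simp only [Pi.smul_apply, smul_eq_mul, key]
    field_simp

/-- By the equivariant embedding, X is a locally closed invariant subvariety of a projective space
with permuted coordinates, so X/G is immersed in the quotient of that projective space. -/
theorem isQuasiProjective_quotientSpace (V : GVariety) : V.quotientSpace.IsQuasiProjective := by
  obtain ⟨κ, _, _, φ, hφ, hG⟩ := V.exists_isImmersion_permSpace
  let W := permSpace V.G κ
  let s : Set W.X.space := Set.range φ
  have hinv : ∀ (g : W.G), ∀ y ∈ s, g • y ∈ s := by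
    rintro g _ ⟨x, rfl⟩
    exact ⟨(show V.G from g) • x, hG g x⟩
  let i : Iso V (W.sub (Set.range φ) hφ.isLocallyClosed_range hinv) :=
    ⟨hφ.isoRange, .refl _, fun g x => Subtype.ext (hG g x)⟩
  obtain ⟨j, hj, -, -⟩ := W.isImmersion_quotient_sub hφ.isLocallyClosed_range hinv
  exact (isQuasiProjective_quotientSpace_permSpace V.G κ).of_isImmersion
    (hj.comp (quotientIso i).isImmersion)

end GVariety

/-! ### Isomorphisms with induced varieties -/

theorem IsImmersion.isMorphism_of_comp {X Y Z : SpaceWithFunctions} {e : Y → Z} (he : IsImmersion e)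
    {φ : X → Y} (h : IsMorphism (X := X) (Y := Z) (fun x => e (φ x))) : IsMorphism φ := by
  have hc : Continuous φ := he.isEmbedding.continuous_iff.2 h.continuous
  refine ⟨hc, fun f x hf => ?_⟩
  obtain ⟨F, hF, hz⟩ := (he.regularAt_iff f _).1 hf
  exact X.regularAt_congr ((hc.continuousAt.eventually hz).mono fun z hz => hz.symm)
    (h.regularAt_comp F x hF)

theorem isMorphism_of_eventuallyEq {X Y : SpaceWithFunctions} {φ : X → Y}
    (h : ∀ x, ∃ ψ : X → Y, IsMorphism ψ ∧ φ =ᶠ[𝓝 x] ψ) : IsMorphism φ := by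
  refine ⟨continuous_iff_continuousAt.2 fun x => ?_, fun f x hf => ?_⟩
  · obtain ⟨ψ, hψ, e⟩ := h x
    exact hψ.continuous.continuousAt.congr e.symm
  · obtain ⟨ψ, hψ, e⟩ := h x
    rw [e.self_of_nhds] at hf
    exact X.regularAt_congr (e.mono fun z hz => congrArg f hz.symm) (hψ.regularAt_comp f x hf)

namespace GVariety

section Ind

variable {V : GVariety} {H : Type} [Group H] {i : V.G →* H}

/-- The class of `(h, x)` in `Ind_G^H X`. -/
def indMk (i : V.G →* H) (h : H) (x : V.X.space) : V.indSpace i :=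
  Quotient.mk (V.indSetoid i) ⟨h, x⟩

theorem exists_indMk (q : V.indSpace i) : ∃ h x, indMk i h x = q := by
  obtain ⟨⟨h, x⟩, rfl⟩ := Quotient.exists_rep q
  exact ⟨h, x, rfl⟩

theorem indMk_mul (h : H) (g : V.G) (x : V.X.space) : indMk i (h * i g) x = indMk i h (g • x) :=
  Quotient.sound ⟨g⁻¹, copies_ext (by simp) (by simp)⟩

theorem indMk_eq_iff {h h' : H} {x x' : V.X.space} :
    indMk i h x = indMk i h' x' ↔ ∃ g : V.G, h' = h * i g ∧ x' = g⁻¹ • x := by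
  refine (Quotient.eq (r := V.indSetoid i)).trans ⟨?_, ?_⟩
  · rintro ⟨g, hg⟩
    exact ⟨g, congrArg Sigma.fst hg, congrArg (fun p : Σ _ : H, V.X.space => p.2) hg⟩
  · rintro ⟨g, h1, h2⟩
    exact ⟨g, copies_ext h1 h2⟩

theorem isMorphism_indMk (i : V.G →* H) (h : H) : IsMorphism (X := V.X.space) (indMk i h) :=
  (SpaceWithFunctions.isMorphism_quotient_mk _ _).comp
    (SpaceWithFunctions.isMorphism_copies_mk H V.X.space h)

theorem isMorphism_ind_iff {Y : SpaceWithFunctions} {φ : V.indSpace i → Y} :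
    IsMorphism φ ↔ ∀ h, IsMorphism (X := V.X.space) (fun x => φ (indMk i h x)) :=
  SpaceWithFunctions.isMorphism_quotient_iff.trans SpaceWithFunctions.isMorphism_copies_iff

end Ind

/-- A variety that is fibred over `H / G` in an equivariant way is induced from its fibre. -/
def isoInd {V W : GVariety} {H : Type} [Group H] [Finite H] {i : V.G →* H}
    (hi : Function.Injective i) (φ : H ≃* W.G) {f : V.X.space → W.X.space} (hf : IsMorphism f)
    (hfi : ∀ g x, f (g • x) = φ (i g) • f x)
    (l : W.X.space → H ⧸ i.range) (hl : ∀ w, ∀ᶠ z in 𝓝 w, l z = l w)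
    (hls : ∀ (h : H) w, l (φ h • w) = h • l w) (hlf : ∀ x, l (f x) = (1 : H))
    (hfl : ∀ w, l w = (1 : H) → ∃ x, f x = w)
    {Y : SpaceWithFunctions} {e : V.X.space → Y} (he : IsImmersion e) {s : W.X.space → Y}
    (hs : IsMorphism s) (hsf : ∀ x, s (f x) = e x) : Iso (V.ind i hi) W := by
  have hout (w) : (((l w).out : H) : H ⧸ i.range) = l w := Quotient.out_eq' _
  -- Translating w back by a representative of its label gives a point with label 1, hence a point
  -- of the fibre.
  have hu (w : W.X.space) : ∃ x, f x = (φ (l w).out)⁻¹ • w := by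
    refine hfl _ ?_
    rw [← map_inv, hls, ← hout w, MulAction.Quotient.smul_coe]
    simp [hout w]
  choose u hu using hu
  have hinj : Function.Injective f := fun x y h =>
    he.isEmbedding.injective (by rw [← hsf, ← hsf, h])
  -- The label is locally constant, so near w a fixed group element is used. It suffices that e ∘ u
  -- is a morphism, and e(u(z)) = s(f(u(z))) is s applied to a translate of z. The data e and s
  -- replace a retraction of W to the fibre.
  have hum : IsMorphism u := by
    refine he.isMorphism_of_comp (isMorphism_of_eventuallyEq fun w => ?_)
    refine ⟨fun z => s ((φ (l w).out)⁻¹ • z), hs.comp (W.isMorphism_smul _), ?_⟩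
    filter_upwards [hl w] with z hz
    rw [← hsf, hu, hz]
  exact
  { φ := φ
    ψ :=
    { toFun := Quotient.lift (fun p => φ p.1 • f p.2) (by
        rintro ⟨h, x⟩ q ⟨g, rfl⟩
        change φ h • f x = φ (h * i g) • f (g⁻¹ • x)
        rw [hfi, map_mul, mul_smul, map_inv, map_inv, smul_inv_smul])
      invFun := fun w => indMk i (l w).out (u w)
      left_inv := by
        rintro ⟨h, x⟩
        change indMk i (l (φ h • f x)).out (u (φ h • f x)) = indMk i h x
        have h1 : l (φ h • f x) = (h : H ⧸ i.range) := by
          rw [hls, hlf, MulAction.Quotient.smul_coe, smul_eq_mul, mul_one]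
        have h2 := V.cosetCoord_spec i h
        rw [← h1] at h2
        have h3 : u (φ h • f x) = V.cosetCoord i h • x := by
          refine hinj ?_
          rw [hu, hfi, ← mul_smul, ← map_inv, ← map_mul]
          congr 2
          rw [inv_mul_eq_iff_eq_mul]
          exact h2
        rw [h3, ← indMk_mul, ← h2]
      right_inv := fun w => by
        change φ (l w).out • f (u w) = w
        rw [hu, smul_inv_smul]
      isMorphism_toFun := isMorphism_ind_iff.2 fun h => (W.isMorphism_smul (φ h)).comp hf
      isMorphism_invFun := (SpaceWithFunctions.isMorphism_quotient_mk _ _).comp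
        (SpaceWithFunctions.isMorphism_to_copies _ _ (fun w => (hl w).mono fun z hz => by
          rw [hz]) hum) }
    map_smul := by
      rintro (h₀ : H) ⟨h, x⟩
      change φ (h₀ * h) • f x = φ h₀ • φ h • f x
      rw [map_mul, mul_smul] }

/-- The quotient of an induced variety. -/
def quotientIndIso (V : GVariety) {H : Type} [Group H] [Finite H] (i : V.G →* H)
    (hi : Function.Injective i) :
    MotivicEuler.Iso (V.ind i hi).quotientSpace V.quotientSpace where
  toFun := Quotient.lift (s := MulAction.orbitRel (V.ind i hi).G (V.ind i hi).X.space)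
    (Quotient.lift (s := V.indSetoid i) (fun p => V.quotientMk p.2) (by
      rintro ⟨h, x⟩ q ⟨g, rfl⟩
      exact (V.quotientMk_smul _ _).symm)) (by
    rintro _ ⟨h, x⟩ ⟨h₀, rfl⟩
    rfl)
  invFun := Quotient.lift (s := MulAction.orbitRel V.G V.X.space)
    (fun x => (V.ind i hi).quotientMk (indMk i 1 x)) (by
      rintro _ x ⟨g, rfl⟩
      refine quotientMk_eq_iff.2 ⟨i g, ?_⟩
      change indMk i (i g * 1) x = indMk i 1 (g • x)
      rw [← indMk_mul, mul_one, one_mul])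
  left_inv := by
    rintro ⟨⟨h, x⟩⟩
    refine quotientMk_eq_iff.2 ⟨h⁻¹, ?_⟩
    change indMk i (h⁻¹ * h) x = indMk i 1 x
    rw [inv_mul_cancel]
  right_inv := by
    rintro ⟨x⟩
    rfl
  isMorphism_toFun := SpaceWithFunctions.isMorphism_quotient_iff.2
    (isMorphism_ind_iff.2 fun _ => V.isMorphism_quotientMk)
  isMorphism_invFun := SpaceWithFunctions.isMorphism_quotient_iff.2
    ((V.ind i hi).isMorphism_quotientMk.comp (isMorphism_indMk i 1))

/-! ### The inertia variety -/

/-- The copies of `X` indexed by `G`, with the action `h (g, x) = (h g h⁻¹, h x)`. -/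
def conjCopies (V : GVariety) : GVariety where
  X := ⟨V.X.space.copies V.G, V.X.isQuasiProjective.copies⟩
  G := V.G
  action :=
    { smul := fun h p => ⟨h * p.1 * h⁻¹, h • p.2⟩
      one_smul := fun p => copies_ext (by simp) (one_smul _ _)
      mul_smul := fun h h' p => copies_ext
        (show h * h' * p.1 * (h * h')⁻¹ = h * (h' * p.1 * h'⁻¹) * h⁻¹ by simp [mul_assoc])
        (mul_smul h h' p.2) }
  isMorphism_smul h := SpaceWithFunctions.isMorphism_copies_iff.2 fun g =>
    (SpaceWithFunctions.isMorphism_copies_mk V.G V.X.space (h * g * h⁻¹)).comp (V.isMorphism_smul h)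

theorem isMorphism_snd_copies (I : Type) (X : SpaceWithFunctions) :
    IsMorphism (X := X.copies I) (Y := X) (fun p => p.2) :=
  SpaceWithFunctions.isMorphism_copies_iff.2 fun _ => isMorphism_id X

theorem isClosed_inertia (V : GVariety) :
    IsClosed {p : V.conjCopies.X.space | p.1 • p.2 = p.2} :=
  isClosed_setOf_eq (X := V.conjCopies.X.space) V.X.isQuasiProjective
    (φ := fun p : V.conjCopies.X.space => p.1 • p.2)
    (SpaceWithFunctions.isMorphism_copies_iff.2 fun g => V.isMorphism_smul g)
    (isMorphism_snd_copies V.G V.X.space)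

/-- The variety of the pairs `(g, x)` with `g x = x`, with the action
`h (g, x) = (h g h⁻¹, h x)`. -/
def inertia (V : GVariety) : GVariety :=
  V.conjCopies.sub {p | p.1 • p.2 = p.2} V.isClosed_inertia.isLocallyClosed (by
    intro (h : V.G) p hp
    change (h * p.1 * h⁻¹) • h • p.2 = h • p.2
    rw [mul_smul, inv_smul_smul, mul_smul]
    exact congrArg (h • ·) hp)

section Inertia

variable {V W : GVariety}

/-- The group component of a point of the inertia variety. -/
def label (p : V.inertia.X.space) : V.G := Sigma.fst (Subtype.val p)

/-- The point component of a point of the inertia variety. -/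
def pt (p : V.inertia.X.space) : V.X.space := Sigma.snd (Subtype.val p)

theorem label_smul_pt (p : V.inertia.X.space) : label p • pt p = pt p := Subtype.property p

/-- The point `(g, x)` of the inertia variety. -/
def inertiaMk (g : V.G) (x : V.X.space) (h : g • x = x) : V.inertia.X.space := ⟨⟨g, x⟩, h⟩

theorem inertia_ext {p q : V.inertia.X.space} (h : label p = label q) (h' : pt p = pt q) : p = q :=
  Subtype.ext (copies_ext h h')

theorem eventually_label_eq (p : V.inertia.X.space) : ∀ᶠ q in 𝓝 p, label q = label p :=
  (V.conjCopies.X.space.isMorphism_val _).continuous.continuousAt.eventually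
    (p := fun q : V.X.space.copies V.G => q.1 = label p)
    (eventually_copies.2 (Eventually.of_forall fun _ => rfl))

theorem isMorphism_pt (V : GVariety) : IsMorphism (X := V.inertia.X.space) (Y := V.X.space) pt :=
  (isMorphism_snd_copies V.G V.X.space).comp (V.conjCopies.X.space.isMorphism_val _)

theorem isMorphism_to_inertia {Z : SpaceWithFunctions} {φ : Z → V.inertia.X.space}
    (hl : ∀ z, ∀ᶠ z' in 𝓝 z, label (φ z') = label (φ z))
    (hp : IsMorphism (Y := V.X.space) (fun z => pt (φ z))) : IsMorphism φ :=
  SpaceWithFunctions.isMorphism_sub_iff.2 (SpaceWithFunctions.isMorphism_to_copies _ _ hl hp)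

theorem eventually_label_comp_eq {Z : SpaceWithFunctions} {φ : Z → V.inertia.X.space}
    (hφ : IsMorphism φ) (z : Z) : ∀ᶠ z' in 𝓝 z, label (φ z') = label (φ z) :=
  hφ.continuous.continuousAt.eventually (eventually_label_eq (φ z))

/-- The map of inertia varieties defined by an equivariant map. -/
def inertiaMap (α : V.G →* W.G) (ψ : V.X.space → W.X.space) (h : ∀ g x, ψ (g • x) = α g • ψ x)
    (p : V.inertia.X.space) : W.inertia.X.space :=
  inertiaMk (α (label p)) (ψ (pt p)) (by rw [← h, label_smul_pt])

theorem isMorphism_inertiaMap {α : V.G →* W.G} {ψ : V.X.space → W.X.space}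
    (h : ∀ g x, ψ (g • x) = α g • ψ x) (hψ : IsMorphism ψ) : IsMorphism (inertiaMap α ψ h) :=
  isMorphism_to_inertia (fun p => (eventually_label_eq p).mono fun _ hq => congrArg α hq)
    (hψ.comp V.isMorphism_pt)

def inertiaIso (e : Iso V W) : Iso V.inertia W.inertia where
  φ := e.φ
  ψ :=
    { toFun := inertiaMap e.φ.toMonoidHom e.ψ.toFun e.map_smul
      invFun := inertiaMap e.φ.symm.toMonoidHom e.ψ.invFun e.symm.map_smul
      left_inv := fun p => inertia_ext (e.φ.symm_apply_apply _) (e.ψ.left_inv _)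
      right_inv := fun p => inertia_ext (e.φ.apply_symm_apply _) (e.ψ.right_inv _)
      isMorphism_toFun := isMorphism_inertiaMap _ e.ψ.isMorphism_toFun
      isMorphism_invFun := isMorphism_inertiaMap _ e.ψ.isMorphism_invFun }
  map_smul := fun (g : V.G) p => inertia_ext (by
    change e.φ (g * label p * g⁻¹) = e.φ g * e.φ (label p) * (e.φ g)⁻¹
    simp) (e.map_smul g (pt p))

theorem inertia_sub_invariant {s : Set V.X.space} (hG : ∀ (g : V.G), ∀ x ∈ s, g • x ∈ s)
    (g : V.inertia.G) : ∀ p ∈ {p : V.inertia.X.space | pt p ∈ s}, g • p ∈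
      {p : V.inertia.X.space | pt p ∈ s} :=
  fun p hp => hG g (pt p) hp

def inertiaSubIso {s : Set V.X.space} (hs : IsLocallyClosed s)
    (hG : ∀ (g : V.G), ∀ x ∈ s, g • x ∈ s) :
    Iso (V.sub s hs hG).inertia (V.inertia.sub {p | pt p ∈ s}
      (hs.preimage V.isMorphism_pt.continuous) (inertia_sub_invariant hG)) where
  φ := .refl _
  ψ :=
    { toFun := fun p => ⟨inertiaMap (V := V.sub s hs hG) (W := V) (MonoidHom.id V.G)
          Subtype.val (fun _ _ => rfl) p,
        (pt p).2⟩
      invFun := fun p => inertiaMk (V := V.sub s hs hG) (label (V := V) p.1) ⟨pt (V := V) p.1, p.2⟩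
        (Subtype.ext (label_smul_pt p.1))
      left_inv := fun _ => rfl
      right_inv := fun _ => rfl
      isMorphism_toFun := SpaceWithFunctions.isMorphism_sub_iff.2
        (isMorphism_inertiaMap (V := V.sub s hs hG) (W := V) (fun _ _ => rfl)
          (V.X.space.isMorphism_val s))
      isMorphism_invFun := isMorphism_to_inertia
        (eventually_label_comp_eq (V := V) (V.inertia.X.space.isMorphism_val _))
        (SpaceWithFunctions.isMorphism_sub_iff.2
          (V.isMorphism_pt.comp (V.inertia.X.space.isMorphism_val _))) }
  map_smul := fun _ _ => rfl

def inertiaProdIso (V W : GVariety) : Iso (V.prod W).inertia (V.inertia.prod W.inertia) where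
  φ := .refl _
  ψ :=
    { toFun := fun p => (inertiaMap (V := V.prod W) (MonoidHom.fst V.G W.G) Prod.fst
          (fun _ _ => rfl) p,
        inertiaMap (V := V.prod W) (MonoidHom.snd V.G W.G) Prod.snd (fun _ _ => rfl) p)
      invFun := fun p => inertiaMk (V := V.prod W) (label p.1, label p.2) (pt p.1, pt p.2)
        (Prod.ext (label_smul_pt p.1) (label_smul_pt p.2))
      left_inv := fun _ => rfl
      right_inv := fun _ => rfl
      isMorphism_toFun := SpaceWithFunctions.isMorphism_prodMk
        (isMorphism_inertiaMap _ (SpaceWithFunctions.isMorphism_fst _ _))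
        (isMorphism_inertiaMap _ (SpaceWithFunctions.isMorphism_snd _ _))
      isMorphism_invFun := isMorphism_to_inertia
        (fun p => ((eventually_label_comp_eq (SpaceWithFunctions.isMorphism_fst _ _) p).and
          (eventually_label_comp_eq (SpaceWithFunctions.isMorphism_snd _ _) p)).mono
            fun _ h => Prod.ext h.1 h.2)
        (SpaceWithFunctions.isMorphism_prodMap V.isMorphism_pt W.isMorphism_pt) }
  map_smul := fun _ _ => rfl

def inertiaPointIso : Iso point.inertia point where
  φ := .refl _
  ψ :=
    { toFun := pt
      invFun := fun x => inertiaMk (V := point) () x rfl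
      left_inv := fun _ => rfl
      right_inv := fun _ => rfl
      isMorphism_toFun := isMorphism_pt point
      isMorphism_invFun := isMorphism_to_inertia (fun _ => Eventually.of_forall fun _ => rfl)
        (isMorphism_id _) }
  map_smul := fun _ _ => rfl

end Inertia

end GVariety

/-! ### Inertia varieties of induced varieties, and their splitting by conjugacy classes -/

namespace GVariety

section

variable (V : GVariety) {H : Type} [Group H] {i : V.G →* H}
  (hi : Function.Injective i)

/-- The class in `H / G` of the first component of a point of the induced variety. -/
def indCoset (i : V.G →* H) (q : V.indSpace i) : H ⧸ i.range :=
  Quotient.lift (s := V.indSetoid i) (fun p => (p.1 : H ⧸ i.range)) (by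
    rintro ⟨h, x⟩ q ⟨g, rfl⟩
    exact QuotientGroup.eq.2 ⟨g, by simp⟩) q

theorem eventually_indCoset_eq {i : V.G →* H} (hi : Function.Injective i) (q : V.indSpace i) :
    ∀ᶠ q' in 𝓝 q, V.indCoset i q' = V.indCoset i q := by
  refine (V.indIso i hi).isMorphism_toFun.continuous.continuousAt.eventually
    (p := fun p => p.1 = V.indCoset i q) ?_ |>.mono ?_
  · obtain ⟨h, x, rfl⟩ := exists_indMk q
    exact eventually_copies.2 (Eventually.of_forall fun _ => rfl)
  · intro q' hq'
    obtain ⟨h, x, rfl⟩ := exists_indMk q'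
    exact hq'

theorem indCoset_smul [Finite H] (h : H) (q : (V.ind i hi).X.space) :
    V.indCoset i ((show (V.ind i hi).G from h) • q) = h • V.indCoset i q := by
  obtain ⟨h', x, rfl⟩ := exists_indMk q
  rfl

variable {V} in
theorem exists_indMk_one {q : V.indSpace i} (hq : V.indCoset i q = (1 : H)) :
    ∃ x, indMk i 1 x = q := by
  obtain ⟨h, x, rfl⟩ := exists_indMk q
  obtain ⟨g, hg⟩ := QuotientGroup.eq.1 hq.symm
  refine ⟨g • x, ?_⟩
  rw [← indMk_mul, hg]
  simp

/-- A retraction of the induced variety to the fibre over the coset of the neutral element. -/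
def indRetraction (q : V.indSpace i) : V.X.space :=
  (V.cosetCoord i 1)⁻¹ • ((V.indIso i hi).toFun q).2

theorem isMorphism_indRetraction : IsMorphism (V.indRetraction hi) :=
  (V.isMorphism_smul _).comp ((isMorphism_snd_copies _ _).comp (V.indIso i hi).isMorphism_toFun)

theorem indRetraction_indMk_one (x : V.X.space) : V.indRetraction hi (indMk i 1 x) = x :=
  inv_smul_smul _ x

/-- The inertia variety of an induced variety is induced. -/
def inertiaIndIso [Finite H] : Iso (V.inertia.ind (H := H) i hi) (V.ind i hi).inertia :=
  isoInd (V := V.inertia) (W := (V.ind i hi).inertia) (H := H) (i := i) hi (.refl H)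
    (f := inertiaMap (W := V.ind i hi) i (indMk i 1) fun g x => by
      change indMk i 1 (g • x) = indMk i (i g * 1) x
      rw [← indMk_mul, one_mul, mul_one])
    (isMorphism_inertiaMap _ (isMorphism_indMk i 1))
    (fun (g : V.G) p => inertia_ext (by
        change i (g * label p * g⁻¹) = i g * i (label p) * (i g)⁻¹
        rw [map_mul, map_mul, map_inv]) (by
        change indMk i 1 (g • pt p) = indMk i (i g * 1) (pt p)
        rw [← indMk_mul, one_mul, mul_one]))
    (fun w => V.indCoset i (pt w))
    (fun w => (V.ind i hi).isMorphism_pt.continuous.continuousAt.eventually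
      (V.eventually_indCoset_eq hi (pt w)))
    (fun h w => V.indCoset_smul hi h (pt w))
    (fun p => rfl)
    (by
      intro w hw
      obtain ⟨x, hx⟩ := exists_indMk_one hw
      -- An element h of H that fixes the class of (1, x) lies in the image of G: its preimage in G
      -- fixes x. So the fibre over the trivial coset is the inertia variety of V.
      have hl : indMk i ((show H from label w) * 1) x = indMk i 1 x := by
        have := label_smul_pt w
        rw [← hx] at this
        exact this
      obtain ⟨g, h1, h2⟩ := indMk_eq_iff.1 hl
      have h3 : i g⁻¹ = label w := by
        rw [map_inv]
        exact inv_eq_of_mul_eq_one_left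
          ((congrArg (· * i g) (mul_one (M := H) (label w)).symm).trans h1.symm)
      exact ⟨inertiaMk (V := V) g⁻¹ x h2.symm, inertia_ext h3 hx⟩)
    (isImmersion_val V.conjCopies.X.space V.isClosed_inertia.isLocallyClosed)
    -- On the fibre this recovers both components. For labels outside the image of i,
    -- `Function.invFun` has an arbitrary value, which is harmless: only local constancy matters
    -- there.
    (s := fun w => (⟨Function.invFun i (label w), V.indRetraction hi (pt w)⟩ :
      Σ _ : V.G, V.X.space))
    (SpaceWithFunctions.isMorphism_to_copies _ _
      (fun w => (eventually_label_eq w).mono fun _ h => congrArg _ h)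
      ((V.isMorphism_indRetraction hi).comp (isMorphism_pt _)))
    (fun p => copies_ext (Function.leftInverse_invFun hi (label p))
      (V.indRetraction_indMk_one hi (pt p)))

end

section

variable (V : GVariety)

/-- The conjugacy class of the group component of a point of the inertia variety. -/
def conjLabel (p : V.inertia.X.space) : ConjClasses V.G := ConjClasses.mk (label p)

theorem conjLabel_smul (g : V.inertia.G) (p : V.inertia.X.space) :
    V.conjLabel (g • p) = V.conjLabel p :=
  ConjClasses.mk_eq_mk_iff_isConj.2 (isConj_iff.2 ⟨g, rfl⟩).symm

theorem eventually_conjLabel_eq (p : V.inertia.X.space) :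
    ∀ᶠ q in 𝓝 p, V.conjLabel q = V.conjLabel p :=
  (eventually_label_eq p).mono fun _ h => congrArg ConjClasses.mk h

end

/-- A subvariety of a subvariety is a subvariety. -/
def subSubIso (V : GVariety) {s t : Set V.X.space} (hs : IsLocallyClosed s)
    (hG : ∀ (g : V.G), ∀ x ∈ s, g • x ∈ s) {Y : Set (V.sub s hs hG).X.space}
    (hY : IsLocallyClosed Y) (hYG : ∀ (g : (V.sub s hs hG).G), ∀ x ∈ Y, g • x ∈ Y)
    (ht : IsLocallyClosed t) (htG : ∀ (g : V.G), ∀ x ∈ t, g • x ∈ t)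
    (hts : ∀ x ∈ t, x ∈ s) (h : ∀ x : s, x ∈ Y ↔ x.1 ∈ t) :
    Iso ((V.sub s hs hG).sub Y hY hYG) (V.sub t ht htG) where
  φ := .refl _
  ψ :=
    { toFun := fun x => ⟨x.1.1, (h x.1).1 x.2⟩
      invFun := fun x => ⟨⟨x.1, hts x.1 x.2⟩, (h _).2 x.2⟩
      left_inv := fun _ => rfl
      right_inv := fun _ => rfl
      isMorphism_toFun := SpaceWithFunctions.isMorphism_sub_iff.2
        ((V.X.space.isMorphism_val s).comp ((V.X.space.sub s).isMorphism_val Y))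
      isMorphism_invFun := SpaceWithFunctions.isMorphism_sub_iff.2
        (SpaceWithFunctions.isMorphism_sub_iff.2 (V.X.space.isMorphism_val t)) }
  map_smul := fun _ _ => rfl

def subUnivIso (V : GVariety) {s : Set V.X.space} (hs : IsLocallyClosed s)
    (hG : ∀ (g : V.G), ∀ x ∈ s, g • x ∈ s) (h : ∀ x, x ∈ s) : Iso (V.sub s hs hG) V where
  φ := .refl _
  ψ :=
    { toFun := fun x => x.1
      invFun := fun x => ⟨x, h x⟩
      left_inv := fun _ => rfl
      right_inv := fun _ => rfl
      isMorphism_toFun := V.X.space.isMorphism_val s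
      isMorphism_invFun := SpaceWithFunctions.isMorphism_sub_iff.2 (isMorphism_id _) }
  map_smul := fun _ _ => rfl

section Part

variable (V : GVariety) {J : Type} (l : V.X.space → J) (hl : ∀ p, ∀ᶠ q in 𝓝 p, l q = l p)
  (hG : ∀ (g : V.G) p, l (g • p) = l p)

theorem isOpen_label_preimage {V : GVariety} {J : Type} {l : V.X.space → J}
    (hl : ∀ p, ∀ᶠ q in 𝓝 p, l q = l p) (t : Set J) : IsOpen (l ⁻¹' t) :=
  isOpen_iff_eventually.2 fun _ hp => (hl _).mono fun _ hq => show _ ∈ t from hq ▸ hp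

theorem label_preimage_invariant {V : GVariety} {J : Type} {l : V.X.space → J}
    (hG : ∀ (g : V.G) p, l (g • p) = l p) (t : Set J) (g : V.G) :
    ∀ p ∈ l ⁻¹' t, g • p ∈ l ⁻¹' t :=
  fun p hp => show _ ∈ t from (hG g p).symm ▸ hp

/-- The part of a variety on which a locally constant invariant function has its values in a given
set. -/
def part (t : Set J) : GVariety :=
  V.sub (l ⁻¹' t) (isOpen_label_preimage hl t).isLocallyClosed (label_preimage_invariant hG t)

end Part

/-- The part of the inertia variety over the conjugacy class of `g` is induced from the fixed point
set of `g`. -/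
def conjPartIso (V : GVariety) (g : V.G) :
    Iso ((V.fixed g).ind (H := V.G) (Subgroup.centralizer {g}).subtype Subtype.val_injective)
      (V.inertia.part V.conjLabel V.eventually_conjLabel_eq V.conjLabel_smul
        {ConjClasses.mk g}) := by
  let W := V.inertia.part V.conjLabel V.eventually_conjLabel_eq V.conjLabel_smul
    {ConjClasses.mk g}
  let v : W.X.space → V.inertia.X.space := Subtype.val
  have hv : IsMorphism v := V.inertia.X.space.isMorphism_val _
  have hc (w : W.X.space) : ∃ h : V.G, h * g * h⁻¹ = label (v w) :=
    isConj_iff.1 (ConjClasses.mk_eq_mk_iff_isConj.1 (Eq.symm w.2))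
  let i : (V.fixed g).G →* V.G := (Subgroup.centralizer ({g} : Set V.G)).subtype
  -- The map h ↦ hgh⁻¹ identifies G / C_G(g) with the conjugacy class of g. The label l of a point
  -- is the coset of any h that conjugates g to its group component.
  have hcoset (h h' : V.G) : (h : V.G ⧸ i.range) = h' ↔ h * g * h⁻¹ = h' * g * h'⁻¹ := by
    have h1 : i.range = Subgroup.centralizer ({g} : Set V.G) := Subgroup.range_subtype _
    rw [QuotientGroup.eq, h1, Subgroup.mem_centralizer_singleton_iff, eq_mul_inv_iff_mul_eq,
      mul_assoc, mul_assoc, mul_assoc, inv_mul_eq_iff_eq_mul, eq_comm]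
  let l : W.X.space → V.G ⧸ i.range := fun w => (hc w).choose
  have hl (w : W.X.space) (h : V.G) : l w = h ↔ label (v w) = h * g * h⁻¹ := by
    rw [hcoset, (hc w).choose_spec]
  exact isoInd (V := V.fixed g) (W := W) (i := i) Subtype.val_injective (.refl V.G)
    (f := fun x => ⟨inertiaMk g x.1 x.2, rfl⟩)
    (SpaceWithFunctions.isMorphism_sub_iff.2 (isMorphism_to_inertia
      (fun _ => Eventually.of_forall fun _ => rfl) (V.X.space.isMorphism_val _)))
    (by
      intro h x
      refine Subtype.ext (inertia_ext ?_ rfl)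
      change g = h.1 * g * h.1⁻¹
      rw [eq_mul_inv_iff_mul_eq]
      exact (Subgroup.mem_centralizer_singleton_iff.1 h.2).symm)
    l
    (by
      intro w
      filter_upwards [hv.continuous.continuousAt.eventually (eventually_label_eq (v w))] with z hz
      exact (hl _ _).2 (hz.trans (hc w).choose_spec.symm))
    (by
      intro h w
      refine (hl _ (h * (hc w).choose)).2 ?_
      exact (congrArg (fun a => h * a * h⁻¹) (hc w).choose_spec.symm).trans
        (by simp only [mul_inv_rev, mul_assoc]))
    (fun x => (hl _ 1).2 (by change g = _; simp))
    (by
      intro w hw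
      have h1 : label (v w) = g := by simpa using (hl w 1).1 hw
      exact ⟨⟨pt (v w), by
        have := label_smul_pt (v w)
        rwa [h1] at this⟩, Subtype.ext (inertia_ext h1.symm rfl)⟩)
    (isImmersion_val V.X.space (isClosed_setOf_eq V.X.isQuasiProjective
      (V.isMorphism_smul g) (isMorphism_id V.X.space)).isLocallyClosed)
    (s := fun w => pt (v w)) (V.isMorphism_pt.comp hv) (fun _ => rfl)

end GVariety

/-! ### Classes in the Grothendieck ring of varieties -/

namespace K0Var

theorem cls_prod (X Y : Variety) : cls (X.prod Y) = cls X * cls Y := by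
  refine Eq.trans ?_
    (map_mul (Ideal.Quotient.mk (idealOfRelators varietyRelators varietyRelators_mul)) _ _)
  rw [FreeAbelianGroup.of_mul_of]
  rfl

theorem cls_point : cls Variety.point = 1 :=
  map_one (Ideal.Quotient.mk (idealOfRelators varietyRelators varietyRelators_mul))

theorem cls_sub (X : Variety) {Y : Set X.space} (hY : IsClosed Y) :
    cls X = cls (X.sub Y hY.isLocallyClosed) +
      cls (X.sub Yᶜ hY.isOpen_compl.isLocallyClosed) := by
  rw [← sub_eq_iff_eq_add', ← sub_eq_zero]
  exact Ideal.Quotient.eq_zero_iff_mem.2 (AddSubgroup.subset_closure ⟨X, Y, hY, rfl⟩)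

theorem clsOfSpace_eq {X : SpaceWithFunctions} (h : X.IsQuasiProjective) :
    clsOfSpace X = cls ⟨X, h⟩ := dif_pos h

theorem clsOfSpace_congr {X Y : SpaceWithFunctions} (hY : Y.IsQuasiProjective) (e : Iso X Y) :
    clsOfSpace X = clsOfSpace Y := by
  rw [clsOfSpace_eq hY, clsOfSpace_eq (hY.of_isImmersion e.isImmersion)]
  exact congrArg (fun c => Ideal.Quotient.mk (idealOfRelators varietyRelators varietyRelators_mul)
    (FreeAbelianGroup.of c)) (Quotient.sound (s := Variety.isoSetoid) ⟨e⟩)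

theorem clsOfSpace_sub {X : SpaceWithFunctions} (h : X.IsQuasiProjective) {Y : Set X}
    (hY : IsClosed Y) : clsOfSpace X = clsOfSpace (X.sub Y) + clsOfSpace (X.sub Yᶜ) := by
  rw [clsOfSpace_eq h, clsOfSpace_eq (h.sub hY.isLocallyClosed),
    clsOfSpace_eq (h.sub hY.isOpen_compl.isLocallyClosed)]
  exact cls_sub ⟨X, h⟩ hY

theorem clsOfSpace_prod {X Y : SpaceWithFunctions} (hX : X.IsQuasiProjective)
    (hY : Y.IsQuasiProjective) : clsOfSpace (X.prod Y) = clsOfSpace X * clsOfSpace Y := by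
  rw [clsOfSpace_eq hX, clsOfSpace_eq hY, clsOfSpace_eq (hX.prod hY)]
  exact cls_prod ⟨X, hX⟩ ⟨Y, hY⟩

end K0Var

/-! ### Invariants of varieties with actions of finite groups -/

/-- The functions of varieties with actions of finite groups that define ring homomorphisms on the
Grothendieck ring. -/
structure IsMotivic (F : GVariety → K0Var) : Prop where
  iso : ∀ {V W : GVariety}, GVariety.Iso V W → F V = F W
  sub : ∀ (V : GVariety) (Y : Set V.X.space) (hY : IsClosed Y)
    (hG : ∀ (g : V.G), ∀ x ∈ Y, g • x ∈ Y), F V = F (V.sub Y hY.isLocallyClosed hG) +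
      F (V.sub Yᶜ hY.isOpen_compl.isLocallyClosed (GVariety.compl_invariant hG))
  ind : ∀ (V : GVariety) (H : Type) [Group H] [Finite H] (i : V.G →* H)
    (hi : Function.Injective i), F (V.ind i hi) = F V
  prod : ∀ V W : GVariety, F (V.prod W) = F V * F W
  point : F GVariety.point = 1

namespace GVariety

/-- Each property is the corresponding isomorphism of quotient spaces. For additivity, a closed
invariant Y has a closed image in X/G, the complement of that image is the image of Yᶜ, and both
images carry the quotient structure by `isImmersion_quotient_sub`. -/
theorem isMotivic_chi_zero : IsMotivic (chi 0) where
  iso e := K0Var.clsOfSpace_congr (isQuasiProjective_quotientSpace _) (quotientIso e)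
  sub V Y hY hG := by
    have hpre : V.quotientMk ⁻¹' (V.quotientMk '' Y) = Y := by
      refine Set.Subset.antisymm ?_ (Set.subset_preimage_image _ _)
      rintro x ⟨y, hy, hxy⟩
      obtain ⟨g, rfl⟩ := quotientMk_eq_iff.1 hxy
      exact inv_smul_smul g x ▸ hG g⁻¹ _ hy
    have hc : IsClosed (V.quotientMk '' Y) := by
      rw [← V.isOpenQuotientMap_quotientMk.isQuotientMap.isClosed_preimage, hpre]
      exact hY
    have hcompl : (V.quotientMk '' Y)ᶜ = V.quotientMk '' Yᶜ := by
      rw [← Set.image_preimage_eq (V.quotientMk '' Y)ᶜ V.quotientMk_surjective, Set.preimage_compl,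
        hpre]
    have key {s : Set V.X.space} (hs : IsLocallyClosed s)
        (hG : ∀ (g : V.G), ∀ x ∈ s, g • x ∈ s) : chi 0 (V.sub s hs hG) =
          K0Var.clsOfSpace (V.quotientSpace.sub (V.quotientMk '' s)) := by
      obtain ⟨j, hj, -, hr⟩ := V.isImmersion_quotient_sub hs hG
      rw [← hr]
      exact K0Var.clsOfSpace_congr (V.isQuasiProjective_quotientSpace.sub hj.isLocallyClosed_range)
        hj.isoRange
    rw [key, key, ← hcompl]
    exact K0Var.clsOfSpace_sub V.isQuasiProjective_quotientSpace hc
  ind V H _ _ i hi :=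
    K0Var.clsOfSpace_congr V.isQuasiProjective_quotientSpace (V.quotientIndIso i hi)
  prod V W := (K0Var.clsOfSpace_congr
    (V.isQuasiProjective_quotientSpace.prod W.isQuasiProjective_quotientSpace)
    (V.quotientProdIso W)).trans (K0Var.clsOfSpace_prod V.isQuasiProjective_quotientSpace
      W.isQuasiProjective_quotientSpace)
  point := by
    let e : MotivicEuler.Iso point.quotientSpace SpaceWithFunctions.point :=
      { toFun := fun _ => ()
        invFun := fun x => point.quotientMk x
        left_inv := by
          rintro ⟨x⟩
          rfl
        right_inv := fun _ => rfl
        isMorphism_toFun := isMorphism_const _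
        isMorphism_invFun := point.isMorphism_quotientMk }
    exact (K0Var.clsOfSpace_congr SpaceWithFunctions.isQuasiProjective_point e).trans
      ((K0Var.clsOfSpace_eq _).trans K0Var.cls_point)

end GVariety

/-! ### Motivic functions of inertia varieties -/

namespace IsMotivic

open GVariety

variable {F : GVariety → K0Var} (hF : IsMotivic F)

include hF

/-- Passing to the inertia variety commutes with every operation in `IsMotivic`, up to isomorphism.
This is the inductive step for χ^(k). -/
theorem inertia : IsMotivic fun V => F V.inertia where
  iso e := hF.iso (inertiaIso e)
  sub V Y hY hG := by
    rw [hF.iso (inertiaSubIso hY.isLocallyClosed hG),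
      hF.iso (inertiaSubIso hY.isOpen_compl.isLocallyClosed (compl_invariant hG))]
    exact hF.sub V.inertia {p | pt p ∈ Y} (hY.preimage V.isMorphism_pt.continuous)
      (inertia_sub_invariant hG)
  ind V H _ _ i hi := (hF.iso (V.inertiaIndIso hi)).symm.trans (hF.ind V.inertia H i hi)
  prod V W := (hF.iso (inertiaProdIso V W)).trans (hF.prod _ _)
  point := (hF.iso inertiaPointIso).trans hF.point

/-- The label is locally constant, so the part over s is closed in the part over s ∪ t; its
complement is the part over t. -/
theorem part_union {V : GVariety} {J : Type} {l : V.X.space → J}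
    (hl : ∀ p, ∀ᶠ q in 𝓝 p, l q = l p) (hG : ∀ (g : V.G) p, l (g • p) = l p) {s t : Set J}
    (hst : Disjoint s t) :
    F (V.part l hl hG (s ∪ t)) = F (V.part l hl hG s) + F (V.part l hl hG t) := by
  have hY : IsClosed (X := (V.part l hl hG (s ∪ t)).X.space)
      {x : (V.part l hl hG (s ∪ t)).X.space | l (Subtype.val x) ∈ s} :=
    IsClosed.preimage (V.X.space.isMorphism_val (l ⁻¹' (s ∪ t))).continuous
      (t := l ⁻¹' s) ⟨isOpen_label_preimage hl sᶜ⟩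
  rw [hF.sub _ _ hY fun g x hx => label_preimage_invariant hG s g x.1 hx]
  refine congrArg₂ _ (hF.iso (subSubIso V _ _ _ _ _ _ (fun x hx => Or.inl hx) fun _ => Iff.rfl))
    (hF.iso (subSubIso V _ _ _ _ _ _ (fun x hx => Or.inr hx) fun x => ?_))
  exact ⟨x.2.resolve_left, fun h h' => Set.disjoint_left.1 hst h' h⟩

theorem part_univ {V : GVariety} {J : Type} {l : V.X.space → J}
    (hl : ∀ p, ∀ᶠ q in 𝓝 p, l q = l p) (hG : ∀ (g : V.G) p, l (g • p) = l p) :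
    F (V.part l hl hG Set.univ) = F V :=
  hF.iso (subUnivIso V _ _ fun _ => trivial)

theorem part_finset {V : GVariety} {J : Type} {l : V.X.space → J}
    (hl : ∀ p, ∀ᶠ q in 𝓝 p, l q = l p) (hG : ∀ (g : V.G) p, l (g • p) = l p) (t : Finset J) :
    F (V.part l hl hG t) = ∑ j ∈ t, F (V.part l hl hG {j}) := by
  classical
  induction t using Finset.induction_on with
  | empty =>
    -- Additivity for ∅ = ∅ ∪ ∅ gives F(∅) = F(∅) + F(∅), hence F(∅) = 0.
    have := hF.part_union hl hG (Set.disjoint_empty (∅ : Set J))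
    rw [Set.union_empty, left_eq_add] at this
    simpa using this
  | insert j t hj ih =>
    rw [Finset.coe_insert, Set.insert_eq, hF.part_union hl hG (by simpa using hj), ih,
      Finset.sum_insert hj]

/-- The inertia variety is the disjoint union of its parts over the conjugacy classes, and each part
is induced from the fixed points of a representative. The left side involves no choice, so the sum
is independent of the representatives. -/
theorem inertia_eq_finsum (V : GVariety) {r : ConjClasses V.G → V.G}
    (hr : ∀ c, ConjClasses.mk (r c) = c) : F V.inertia = ∑ᶠ c, F (V.fixed (r c)) := by
  have : Finite (ConjClasses V.G) := Quotient.finite _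
  have := Fintype.ofFinite (ConjClasses V.G)
  rw [finsum_eq_sum_of_fintype,
    ← hF.part_univ (V := V.inertia) V.eventually_conjLabel_eq V.conjLabel_smul, ← Finset.coe_univ,
    hF.part_finset]
  refine Finset.sum_congr rfl fun c _ => ?_
  have h := hF.iso (V.conjPartIso (r c))
  rw [hr c] at h
  exact h.symm.trans (hF.ind (V.fixed (r c)) V.G
    (Subgroup.centralizer {r c}).subtype Subtype.val_injective)

end IsMotivic

/-- The definition of `chi` uses one particular choice of representatives, `Quotient.out`. -/
theorem chi_succ_eq_inertia {k : ℕ} (h : IsMotivic (chi k)) (V : GVariety) :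
    chi (k + 1) V = chi k V.inertia :=
  (h.inertia_eq_finsum V fun c => Quotient.out_eq c).symm

theorem isMotivic_chi (k : ℕ) : IsMotivic (chi k) := by
  induction k with
  | zero => exact GVariety.isMotivic_chi_zero
  | succ k ih =>
    rw [funext (chi_succ_eq_inertia ih)]
    exact ih.inertia

/-! ### The ring homomorphism defined by a motivic function -/

namespace IsMotivic

variable {F : GVariety → K0Var} (hF : IsMotivic F)

/-- The homomorphism of monoids defined by a motivic function. -/
def monoidHom : GVarietyClass →* K0Var where
  toFun := Quotient.lift F fun _ _ ⟨e⟩ => hF.iso e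
  map_one' := hF.point
  map_mul' := by
    rintro ⟨V⟩ ⟨W⟩
    exact hF.prod V W

/-- The homomorphism of rings defined by a motivic function. -/
def ringHom : K0fGr →+* K0Var :=
  Ideal.Quotient.lift (idealOfRelators gVarietyRelators gVarietyRelators_mul)
    (FreeAbelianGroup.liftMonoid hF.monoidHom) (by
      have hof (V : GVariety) : FreeAbelianGroup.liftMonoid hF.monoidHom
          (FreeAbelianGroup.of (GVarietyClass.mk V)) = F V :=
        FreeAbelianGroup.lift_apply_of _ _
      intro a ha
      have ha' : a ∈ AddSubgroup.closure gVarietyRelators := ha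
      induction ha' using AddSubgroup.closure_induction with
      | mem s hs =>
        obtain ⟨V, Y, hY, hG, rfl⟩ | ⟨V, H, _, _, i, hi, rfl⟩ := hs
        · rw [map_sub, map_sub, hof, hof, hof, hF.sub V Y hY hG]
          abel
        · rw [map_sub, hof, hof, hF.ind, sub_self]
      | zero => exact map_zero _
      | add a b ha' hb' iha ihb => rw [map_add, iha ha', ihb hb', add_zero]
      | neg a ha' iha => rw [map_neg, iha ha', neg_zero])

theorem ringHom_cls (V : GVariety) : hF.ringHom (K0fGr.cls V) = F V :=
  (Ideal.Quotient.lift_mk _ _ _).trans (FreeAbelianGroup.lift_apply_of _ _)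

end IsMotivic

/-- The classes of varieties with actions generate the ring additively. -/
theorem K0fGr.ringHom_ext {φ ψ : K0fGr →+* K0Var}
    (h : ∀ V, φ (K0fGr.cls V) = ψ (K0fGr.cls V)) : φ = ψ := by
  refine Ideal.Quotient.ringHom_ext (RingHom.coe_addMonoidHom_injective
    (FreeAbelianGroup.lift_ext _ _ ?_))
  rintro ⟨V⟩
  exact h V

end MotivicEuler

end

theorem mainTheorem3 :
    -- the quotient `X / G` of a quasi-projective variety by a finite group is a quasi-projective
    -- variety, and the invariant of order `0` is its class
    (∀ V : MotivicEuler.GVariety, ∃ h : V.quotientSpace.IsQuasiProjective,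
      MotivicEuler.chi 0 V = MotivicEuler.K0Var.cls ⟨V.quotientSpace, h⟩) ∧
    -- the recursion holds for every choice of representatives of the conjugacy classes
    (∀ (k : ℕ) (V : MotivicEuler.GVariety) (r : ConjClasses V.G → V.G),
      (∀ c : ConjClasses V.G, ConjClasses.mk (r c) = c) →
        MotivicEuler.chi (k + 1) V =
          ∑ᶠ c : ConjClasses V.G, MotivicEuler.chi k (V.fixed (r c))) ∧
    ∀ k : ℕ,
      -- relation 1: isomorphisms
      (∀ V W : MotivicEuler.GVariety, Nonempty (MotivicEuler.GVariety.Iso V W) →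
        MotivicEuler.chi k V = MotivicEuler.chi k W) ∧
      -- relation 2: closed invariant subvarieties
      (∀ (V : MotivicEuler.GVariety) (Y : Set V.X.space) (hY : IsClosed Y)
        (hG : ∀ (g : V.G), ∀ x ∈ Y, g • x ∈ Y),
        MotivicEuler.chi k V = MotivicEuler.chi k (V.sub Y hY.isLocallyClosed hG) +
          MotivicEuler.chi k (V.sub Yᶜ hY.isOpen_compl.isLocallyClosed
            (MotivicEuler.GVariety.compl_invariant hG))) ∧
      -- relation 3: induction
      (∀ (V : MotivicEuler.GVariety) (H : Type) [Group H] [Finite H] (i : V.G →* H)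
        (hi : Function.Injective i),
        MotivicEuler.chi k (V.ind i hi) = MotivicEuler.chi k V) ∧
      -- the ring homomorphism
      ∃! φ : MotivicEuler.K0fGr →+* MotivicEuler.K0Var,
        ∀ V : MotivicEuler.GVariety, φ (MotivicEuler.K0fGr.cls V) = MotivicEuler.chi k V := by
  refine ⟨fun V => ⟨V.isQuasiProjective_quotientSpace,
    MotivicEuler.K0Var.clsOfSpace_eq _⟩, fun k V r hr => ?_, fun k => ?_⟩
  · have h := MotivicEuler.isMotivic_chi k
    rw [MotivicEuler.chi_succ_eq_inertia h]
    exact h.inertia_eq_finsum V hr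
  · have h := MotivicEuler.isMotivic_chi k
    exact ⟨fun V W ⟨e⟩ => h.iso e, h.sub, h.ind, h.ringHom, h.ringHom_cls, fun φ hφ =>
      MotivicEuler.K0fGr.ringHom_ext fun V => (hφ V).trans (h.ringHom_cls V).symm⟩
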